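/- **Conventions.** Let $\mathscr P$ be a path-connected topological space, $N\subset\mathscr P$ a subspace and $\mathrm{pt}\in N$ (for example, the space of paths in a manifold with both endpoints on a submanifold $N$, if it is path-connected, with $N$ embedded as the constant paths). * A *local system* $\mathscr L$ on $\mathscr P$ is a functor from the fundamental groupoid of $\mathscr P$ to free $\mathbb Z$-modules. It is *free* if $\mathscr L_{\mathrm{pt}}$, with the monodromy action, is isomorphic as a left module to a direct sum $\bigoplus_S\mathbb Z[\pi_1(\mathscr P,\mathrm{pt})]$ over some index set $S$. * $H_*(\mathscr P,N;\mathscr L)$ is relative singular homology with local coefficients: $n$-chains are finite sums of terms $\sigma\otimes\ell$ with $\sigma:\Delta^n\to\mathscr P$ and $\ell\in\mathscr L_{\sigma(e_0)}$, modulo those with $\sigma(\Delta^n)\subset N$, and $\partial(\sigma\otimes\ell)=\sum_i(-1)^i\,(\sigma\circ\delta_i)\otimes\ell_i$, where $\ell_i=\ell$ for $i>0$ and $\ell_0$ is the transport of $\ell$ along the edge $\sigma|_{[e_0,e_1]}$. * $\pi_k(\mathscr P,N,\mathrm{pt})\otimes_{\mathbb Z[\pi_1(N,\mathrm{pt})]}\mathscr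 L_{\mathrm{pt}}$ is the abelian group generated by symbols $a\otimes\ell$ with $a\in\pi_k(\mathscr P,N,\mathrm{pt})$, $\ell\in\mathscr L_{\mathrm{pt}}$, subject to additivity in $a$ and in $\ell$ and to $(g\cdot a)\otimes(g\cdot\ell)=a\otimes\ell$ for $g\in\pi_1(N,\mathrm{pt})$, which acts in the usual way on $\pi_k(\mathscr P,N,\mathrm{pt})$ and by monodromy on $\mathscr L_{\mathrm{pt}}$. (If $k=2$ and $\pi_2(\mathscr P,N,\mathrm{pt})$ is not abelian, this is the tensor product with its abelianization.) **Proposition.** Let $\mathscr L$ be a free local system on $\mathscr P$, and let $k>1$ be such that $\pi_k(\mathscr P,N,\mathrm{pt})\neq0$ and $\pi_j(\mathscr P,N,\mathrm{pt})=0$ for all $1\le j<k$. Then there is a group isomorphism $$\pi_k(\mathscr P,N,\mathrm{pt})\otimes_{\mathbb Z[\pi_1(N,\mathrm{pt})]}\mathscr L_{\mathrm{pt}}\;\xrightarrow{\ \cong\ }\;H_k(\mathscr P,N;\mathscr L),$$ namely the Hurewicz map, which sends $[f]\otimes\ell$, for $f:(I^k,\partial I^k,J)\to(\mathscr P,N,\mathrm{pt})$,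 where $J$ is the closure of $\partial I^k$ minus one face, to the class of the image under $f$ of the standard fundamental chain of $(I^k,\partial I^k)$ (the signed sum of the $k!$ simplices of the standard triangulation), with coefficient $\ell$ at the vertex $0$, where $f(0)=\mathrm{pt}$. -/

import Mathlib

universe u w

noncomputable section

namespace TwistedHurewicz

/-! ### Local systems -/

/-- A local system of coefficients on `X`: a functor from the fundamental groupoid of `X` to
abelian groups, all of whose values are free `ℤ`-modules. -/
structure LocalSystem (X : Type u) [TopologicalSpace X] where
  /-- The underlying functor. -/
  toFunctor : CategoryTheory.Functor (FundamentalGroupoid X) (ModuleCat.{w} ℤ)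
  free_fiber : ∀ x : X, Module.Free ℤ (toFunctor.obj ⟨x⟩)

namespace LocalSystem

variable {X : Type u} [TopologicalSpace X] (L : LocalSystem.{u, w} X)

/-- The fibre `L_x`. -/
abbrev Fiber (x : X) : Type w := L.toFunctor.obj ⟨x⟩

/-- The monodromy `L_x → L_y` along a path from `x` to `y`. -/
def transport {x y : X} (γ : Path x y) : L.Fiber x →ₗ[ℤ] L.Fiber y :=
  (L.toFunctor.map (FundamentalGroupoid.fromPath (Path.Homotopic.Quotient.mk γ))).hom

theorem transport_congr {x y : X} {γ δ : Path x y} (h : γ.Homotopic δ) :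
    L.transport γ = L.transport δ := by
  have : Path.Homotopic.Quotient.mk γ = Path.Homotopic.Quotient.mk δ := Quotient.sound h
  simp only [transport, this]

theorem transport_refl (x : X) (l : L.Fiber x) : L.transport (Path.refl x) l = l := by
  have h : FundamentalGroupoid.fromPath (Path.Homotopic.Quotient.mk (Path.refl x)) =
      CategoryTheory.CategoryStruct.id (FundamentalGroupoid.mk x) := rfl
  simp [transport, h]

theorem transport_trans {x y z : X} (γ : Path x y) (δ : Path y z) (l : L.Fiber x) :
    L.transport (γ.trans δ) l = L.transport δ (L.transport γ l) := by
  have h : FundamentalGroupoid.fromPath (Path.Homotopic.Quotient.mk (γ.trans δ)) =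
      CategoryTheory.CategoryStruct.comp
        (FundamentalGroupoid.fromPath (Path.Homotopic.Quotient.mk γ))
        (FundamentalGroupoid.fromPath (Path.Homotopic.Quotient.mk δ)) := rfl
  simp [transport, h]

/-- The monodromy representation of `π₁(X, x)` on the fibre `L_x`. (The product `g * h` in
Mathlib's `FundamentalGroup` is "first `h`, then `g`", so this is a left action.) -/
def monodromy (x : X) : Representation ℤ (FundamentalGroup X x) (L.Fiber x) where
  toFun g := (L.toFunctor.map (FundamentalGroup.toArrow g)).hom
  map_one' := by
    have h : FundamentalGroup.toArrow (1 : FundamentalGroup X x) =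
      CategoryTheory.CategoryStruct.id (FundamentalGroupoid.mk x) := rfl
    rw [h, CategoryTheory.Functor.map_id]; rfl
  map_mul' g h := by
    have e : FundamentalGroup.toArrow (g * h) =
      CategoryTheory.CategoryStruct.comp (FundamentalGroup.toArrow h)
        (FundamentalGroup.toArrow g) := rfl
    rw [e, CategoryTheory.Functor.map_comp]; rfl

/-- `L` is free (at the base point `x`): the fibre `L_x` is a free left `ℤ[π₁(X, x)]`-module,
that is, a direct sum of copies of `ℤ[π₁(X, x)]`. -/
def IsFree (x : X) : Prop :=
  Module.Free (MonoidAlgebra ℤ (FundamentalGroup X x)) (L.monodromy x).asModule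

end LocalSystem

/-! ### Singular homology of a pair with coefficients in a local system -/

/-- The standard topological `n`-simplex. -/
abbrev Simplex (n : ℕ) : Type := stdSimplex ℝ (Fin (n + 1))

/-- The `i`-th face inclusion `Δⁿ → Δⁿ⁺¹`. -/
def faceMap (n : ℕ) (i : Fin (n + 2)) : C(Simplex n, Simplex (n + 1)) :=
  ⟨stdSimplex.map i.succAbove, stdSimplex.continuous_map _⟩

/-- The initial vertex `e₀` of `Δⁿ`. -/
def e0 (n : ℕ) : Simplex n := stdSimplex.vertex 0

/-- The straight path between two points of a simplex. -/
def segment {n : ℕ} (a b : Simplex n) : Path a b where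
  toFun t := ⟨Path.segment a.1 b.1 t, (convex_stdSimplex ℝ _).segment_subset a.2 b.2
    (Path.range_segment a.1 b.1 ▸ Set.mem_range_self t)⟩
  continuous_toFun := (Path.segment a.1 b.1).continuous.subtype_mk _
  source' := by ext : 1; simp
  target' := by ext : 1; simp

variable {X : Type u} [TopologicalSpace X] (L : LocalSystem.{u, w} X)

open scoped Classical in
/-- Singular `n`-chains of `X` with coefficients in `L`: finite sums of terms `σ ⊗ l` with
`σ : Δⁿ → X` and `l` in the fibre of `L` over the initial vertex of `σ`. -/
abbrev Chains (n : ℕ) : Type (max u w) :=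
  DirectSum C(Simplex n, X) fun σ => L.Fiber (σ (e0 n))

open scoped Classical in
/-- The chain `σ ⊗ l`. -/
def gen {n : ℕ} (σ : C(Simplex n, X)) : L.Fiber (σ (e0 n)) →+ Chains L n :=
  DirectSum.of (fun τ : C(Simplex n, X) => L.Fiber (τ (e0 n))) σ

/-- The chain `σ ⊗ l`, where `l` is given in the fibre over a point `x` equal to `σ (e₀)`. -/
def single {n : ℕ} (σ : C(Simplex n, X)) {x : X} (h : σ (e0 n) = x) :
    L.Fiber x →+ Chains L n :=
  (gen L σ).comp (L.transport ((Path.refl x).cast h rfl).symm).toAddMonoidHom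

/-- The `i`-th face operator, `σ ⊗ l ↦ (σ ∘ δᵢ) ⊗ l'`, where `l'` is the transport of `l`
along the image under `σ` of the straight path from `e₀` to the initial vertex of the `i`-th
face. This path is constant, and so `l' = l`, unless `i = 0`. -/
def face (n : ℕ) (i : Fin (n + 2)) : Chains L (n + 1) →+ Chains L n := by
  classical
  exact DirectSum.toAddMonoid fun σ : C(Simplex (n + 1), X) =>
    (gen L (σ.comp (faceMap n i))).comp
      (L.transport ((segment (e0 (n + 1)) (faceMap n i (e0 n))).map
        σ.continuous)).toAddMonoidHom

/-- The boundary operator `∂ = ∑ (-1)ⁱ ∂ᵢ`. -/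
def boundary (n : ℕ) : Chains L (n + 1) →+ Chains L n :=
  ∑ i : Fin (n + 2), ((-1 : ℤ) ^ (i : ℕ)) • face L n i

instance (n : ℕ) : SimplyConnectedSpace (Simplex n) :=
  have : ContractibleSpace (Simplex n) :=
    (convex_stdSimplex ℝ (Fin (n + 1))).contractibleSpace ⟨_, (e0 n).2⟩
  inferInstance

theorem faceMap_comp (n : ℕ) {i j : Fin (n + 2)} (h : i ≤ j) :
    (faceMap (n + 1) j.succ).comp (faceMap n i) =
      (faceMap (n + 1) i.castSucc).comp (faceMap n j) := by
  have e : j.succ.succAbove ∘ i.succAbove = i.castSucc.succAbove ∘ j.succAbove := by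
    ext m
    simp only [Function.comp_apply, Fin.succAbove, Fin.lt_def, Fin.le_def] at h ⊢
    split_ifs <;> simp_all <;> omega
  ext1 t
  change stdSimplex.map _ (stdSimplex.map _ t) = stdSimplex.map _ (stdSimplex.map _ t)
  rw [stdSimplex.map_comp_apply, stdSimplex.map_comp_apply, e]

theorem gen_transport_congr {n m : ℕ} (σ : C(Simplex m, X)) {f g : C(Simplex n, Simplex m)}
    (h : f = g) {a : Simplex m} (γ : Path a (f (e0 n))) (δ : Path a (g (e0 n)))
    (l : L.Fiber (σ a)) :
    gen L (σ.comp f) (L.transport (γ.map σ.continuous) l) =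
      gen L (σ.comp g) (L.transport (δ.map σ.continuous) l) := by
  subst h
  have e : (γ.map σ.continuous).Homotopic (δ.map σ.continuous) :=
    (SimplyConnectedSpace.paths_homotopic γ δ).map σ
  rw [L.transport_congr e]

theorem face_gen (n : ℕ) (i : Fin (n + 2)) (σ : C(Simplex (n + 1), X))
    (l : L.Fiber (σ (e0 (n + 1)))) :
    face L n i (gen L σ l) = gen L (σ.comp (faceMap n i))
      (L.transport ((segment (e0 (n + 1)) (faceMap n i (e0 n))).map σ.continuous) l) := by
  simp [face, gen]

theorem face_face_gen (n : ℕ) (i : Fin (n + 2)) (j : Fin (n + 3)) (σ : C(Simplex (n + 2), X))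
    (l : L.Fiber (σ (e0 (n + 2)))) :
    face L n i (face L (n + 1) j (gen L σ l)) =
      gen L (σ.comp ((faceMap (n + 1) j).comp (faceMap n i)))
        (L.transport (((segment (e0 (n + 2)) (faceMap (n + 1) j (e0 (n + 1)))).trans
          ((segment (e0 (n + 1)) (faceMap n i (e0 n))).map
            (faceMap (n + 1) j).continuous)).map σ.continuous) l) := by
  rw [face_gen, face_gen, Path.map_trans, L.transport_trans]
  rfl

theorem face_face (n : ℕ) {i j : Fin (n + 2)} (h : i ≤ j) (c : Chains L (n + 2)) :
    face L n i (face L (n + 1) j.succ c) = face L n j (face L (n + 1) i.castSucc c) := by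
  classical
  induction c using DirectSum.induction_on with
  | zero => simp
  | of σ l =>
    exact (face_face_gen L n i j.succ σ l).trans
      ((gen_transport_congr L σ (faceMap_comp n h) _ _ l).trans
        (face_face_gen L n j i.castSucc σ l).symm)
  | add a b ha hb => simp only [map_add, ha, hb]

theorem boundary_apply (n : ℕ) (c : Chains L (n + 1)) :
    boundary L n c = ∑ i : Fin (n + 2), ((-1 : ℤ) ^ (i : ℕ)) • face L n i c := by
  simp [boundary]

/-- The chains form a complex. -/
theorem boundary_boundary (n : ℕ) (c : Chains L (n + 2)) :
    boundary L n (boundary L (n + 1) c) = 0 := by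
  simp only [boundary_apply, map_sum, map_zsmul, Finset.smul_sum, smul_smul]
  rw [Finset.sum_comm, ← Finset.sum_product']
  let S : Finset (Fin (n + 2) × Fin (n + 3)) := {ij | (ij.2 : ℕ) ≤ (ij.1 : ℕ)}
  rw [Finset.univ_product_univ, ← Finset.sum_add_sum_compl S, ← eq_neg_iff_add_eq_zero,
    ← Finset.sum_neg_distrib]
  let φ : ∀ ij : Fin (n + 2) × Fin (n + 3), ij ∈ S → Fin (n + 2) × Fin (n + 3) := fun ij hij =>
    (Fin.castLT ij.2 (lt_of_le_of_lt (Finset.mem_filter.mp hij).right (Fin.is_lt ij.1)),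
      ij.1.succ)
  apply Finset.sum_bij φ
  · intro ij hij
    simp_rw [S, φ, Finset.compl_filter, Finset.mem_filter_univ, Fin.val_succ,
      Fin.val_castLT] at hij ⊢
    lia
  · rintro ⟨i, j⟩ hij ⟨i', j'⟩ hij' h
    rw [Prod.mk_inj]
    exact ⟨by simpa [φ] using! congr_arg Prod.snd h,
      by simpa [φ, Fin.castSucc_castLT] using! congr_arg Fin.castSucc (congr_arg Prod.fst h)⟩
  · rintro ⟨i', j'⟩ hij'
    simp_rw [S, Finset.compl_filter, Finset.mem_filter_univ, not_le] at hij'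
    refine ⟨(j'.pred <| ?_, Fin.castSucc i'), ?_, ?_⟩
    · rintro rfl
      simp only [Fin.val_zero, not_lt_zero] at hij'
    · simpa [S] using! Nat.le_sub_one_of_lt hij'
    · simp only [φ, Fin.castLT_castSucc, Fin.succ_pred]
  · rintro ⟨i, j⟩ hij
    simp only [S, Finset.mem_filter_univ] at hij
    have h := face_face L n (i := j.castLT (by omega)) (j := i) hij c
    simp only [φ, h, Fin.castSucc_castLT, Fin.val_succ, Fin.val_castLT, ← neg_smul]
    congr 1
    ring

variable (A : Set X)

/-- The chains of the subspace `A`: chains supported on simplices with image in `A`. -/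
def chainsIn (n : ℕ) : AddSubgroup (Chains L n) where
  carrier := {c | ∀ σ : C(Simplex n, X), ¬ Set.range σ ⊆ A → c σ = 0}
  zero_mem' := fun _ _ => rfl
  add_mem' := fun ha hb σ hσ => by simp [ha σ hσ, hb σ hσ]
  neg_mem' := fun {c} hc σ hσ => by
    have h : (-c) σ = -(c σ) := DFinsupp.neg_apply c σ
    rw [h, hc σ hσ, neg_zero]

/-- Relative `n`-cycles: `n`-chains of `X` whose boundary is a chain of `A`. -/
def relCycles : (n : ℕ) → AddSubgroup (Chains L n)
  | 0 => ⊤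
  | n + 1 => (chainsIn L A n).comap (boundary L n)

/-- Relative `n`-boundaries: sums of a boundary and a chain of `A`. -/
def relBoundaries (n : ℕ) : AddSubgroup (Chains L n) :=
  (boundary L n).range ⊔ chainsIn L A n

theorem boundary_mem_chainsIn {n : ℕ} {c : Chains L (n + 1)} (hc : c ∈ chainsIn L A (n + 1)) :
    boundary L n c ∈ chainsIn L A n := by
  classical
  rw [← DirectSum.sum_support_of c, map_sum]
  refine sum_mem fun σ hσ => ?_
  have hσA : Set.range σ ⊆ A := by
    by_contra h
    exact (DFinsupp.mem_support_iff.1 hσ) (hc σ h)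
  have e : DirectSum.of (fun τ : C(Simplex (n + 1), X) => L.Fiber (τ (e0 (n + 1)))) σ (c σ) =
      gen L σ (c σ) := by unfold gen; congr!
  rw [e, boundary_apply]
  refine sum_mem fun i _ => zsmul_mem (fun τ hτ => ?_) _
  rw [face_gen]
  refine DirectSum.of_eq_of_ne _ _ _ ?_
  rintro rfl
  exact hτ ((Set.range_comp_subset_range (faceMap n i) σ).trans hσA)

theorem relBoundaries_le_relCycles (n : ℕ) : relBoundaries L A n ≤ relCycles L A n := by
  cases n with
  | zero => exact le_top
  | succ n =>
    refine sup_le ?_ fun c hc => boundary_mem_chainsIn L A hc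
    rintro _ ⟨c, rfl⟩
    change boundary L n (boundary L (n + 1) c) ∈ chainsIn L A n
    rw [boundary_boundary]
    exact zero_mem _

/-- The relative singular homology group `H_n(X, A; L)`. -/
abbrev RelHomology (n : ℕ) : Type (max u w) :=
  relCycles L A n ⧸ (relBoundaries L A n).addSubgroupOf (relCycles L A n)

/-! ### Relative homotopy groups -/

/-- The space of paths in `X` that start in `A` and end at `x` (the homotopy fibre of the
inclusion `A → X`). -/
abbrev PathFiber (x : X) : Type u := {γ : C(unitInterval, X) // γ 0 ∈ A ∧ γ 1 = x}

variable {A} (x : A)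

/-- The constant path as base point. -/
def PathFiber.base : PathFiber A (x : X) := ⟨ContinuousMap.const _ x, x.2, rfl⟩

/-- The relative homotopy set `π_k(X, A, x)`, `k ≥ 1`, as `π_{k-1}` of the space of paths
from `A` to `x`. By currying, an element is represented by a map `(Iᵏ, ∂Iᵏ, J) → (X, A, x)`
where `J` is the closure of `∂Iᵏ` minus the face on which the last coordinate is `0`.
(The value for `k = 0` is not used.) -/
abbrev RelPi (k : ℕ) : Type u := HomotopyGroup.Pi (k - 1) (PathFiber A (x : X)) (PathFiber.base x)

/-- For `k ≥ 2` the group structure is given by concatenation of cubes. -/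
instance (n : ℕ) : Group (RelPi x (n + 2)) :=
  inferInstanceAs (Group (HomotopyGroup.Pi (n + 1) (PathFiber A (x : X)) (PathFiber.base x)))

/-- Representatives of the elements of `π_k(X, A, x)`, `k = n + 2`. -/
abbrev RelLoop (n : ℕ) : Type u := GenLoop (Fin (n + 1)) (PathFiber A (x : X)) (PathFiber.base x)

variable {x}

/-- The class in `π_k(X, A, x)`, `k = n + 2`, of a representative. -/
def RelLoop.toPi {n : ℕ} (p : RelLoop x n) : RelPi x (n + 2) := Quotient.mk _ p

/-- The map of triples `(Iᵏ, ∂Iᵏ, J) → (X, A, x)`, `k = n + 2`, underlying a representative. -/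
def RelLoop.cube {n : ℕ} (p : RelLoop x n) : C(Fin (n + 2) → unitInterval, X) where
  toFun y := (p fun i => y i.castSucc).1 (y (Fin.last _))
  continuous_toFun := by
    have h : Continuous fun y : Fin (n + 2) → unitInterval => (p fun i => y i.castSucc).1 :=
      continuous_subtype_val.comp (p.1.continuous.comp (by fun_prop))
    fun_prop

theorem RelLoop.cube_eq_base {n : ℕ} (p : RelLoop x n) (y : Fin (n + 2) → unitInterval)
    (hy : y (Fin.last _) = 1 ∨ ∃ i : Fin (n + 1), y i.castSucc = 0 ∨ y i.castSucc = 1) :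
    p.cube y = x := by
  rcases hy with hy | hy
  · change (p fun i => y i.castSucc).1 (y (Fin.last _)) = x
    rw [hy]; exact (p fun i => y i.castSucc).2.2
  · change (p fun i => y i.castSucc).1 (y (Fin.last _)) = x
    exact congrArg (fun γ : PathFiber A (x : X) => γ.1 (y (Fin.last _))) (p.2 _ hy)

/-- `p` is carried to `q` along the loop `γ` in `A`: there is a homotopy `H` of maps
`(Iᵏ, ∂Iᵏ) → (X, A)` from `p` to `q` which at time `t` is constant on `J` with value `γ t`.
The classes `a = [p]` and `b = [q]` are then related by the usual action of `π₁(A, x)` on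
`π_k(X, A, x)`: `a = [γ] · b` if products in `π₁` are read as "first left, then right". For
each `a` and `γ` there is exactly one such `b`. -/
def FreelyHomotopicAlong {n : ℕ} (γ : Path x x) (p q : RelLoop x n) : Prop :=
  ∃ H : C(unitInterval × (Fin (n + 2) → unitInterval), X),
    (∀ y, H (0, y) = p.cube y) ∧ (∀ y, H (1, y) = q.cube y) ∧
    (∀ t y, y (Fin.last _) = 0 → H (t, y) ∈ A) ∧
    (∀ t y, (y (Fin.last _) = 1 ∨ ∃ i : Fin (n + 1), y i.castSucc = 0 ∨ y i.castSucc = 1) →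
      H (t, y) = γ t)

variable (x)

/-- Monodromy of `L` along a loop in `A`. -/
def loopTransport (γ : Path x x) : L.Fiber (x : X) →ₗ[ℤ] L.Fiber (x : X) :=
  L.transport (γ.map continuous_subtype_val)

/-- The relations that define `π_k(X, A, x) ⊗_{ℤ[π₁(A, x)]} L_x`, `k = n + 2`, by generators
`(a, l)`, standing for `a ⊗ l`: additivity in each variable, and `(g · a) ⊗ (g · l) = a ⊗ l` for `g` in `π₁(A, x)`. (The last one is the
usual `a g ⊗ l = a ⊗ g l` for the right action `a g = g⁻¹ · a`.) -/
inductive TensorRel (n : ℕ) : FreeAbelianGroup (RelPi x (n + 2) × L.Fiber (x : X)) → Prop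
  | add_left (a b : RelPi x (n + 2)) (l : L.Fiber (x : X)) :
      TensorRel n (.of (a * b, l) - (.of (a, l) + .of (b, l)))
  | add_right (a : RelPi x (n + 2)) (l m : L.Fiber (x : X)) :
      TensorRel n (.of (a, l + m) - (.of (a, l) + .of (a, m)))
  | balanced (γ : Path x x) (p q : RelLoop x n) (h : FreelyHomotopicAlong γ p q)
      (l : L.Fiber (x : X)) :
      TensorRel n (.of (q.toPi, loopTransport L x γ l) - .of (p.toPi, l))

/-- The tensor product `π_k(X, A, x) ⊗_{ℤ[π₁(A, x)]} L_x`, `k = n + 2`. -/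
abbrev RelTensor (n : ℕ) : Type (max u w) :=
  FreeAbelianGroup (RelPi x (n + 2) × L.Fiber (x : X)) ⧸
    AddSubgroup.closure {r | TensorRel L x n r}

/-- The pure tensor `a ⊗ l`. -/
def tmul {n : ℕ} (a : RelPi x (n + 2)) (l : L.Fiber (x : X)) : RelTensor L x n :=
  QuotientAddGroup.mk (FreeAbelianGroup.of (a, l))

/-! ### The Hurewicz map -/

/-- The affine simplex `Δᵏ → Iᵏ` of the standard triangulation of the cube that belongs to a
permutation `s`: its `j`-th vertex has coordinates `s 0, …, s (j - 1)` equal to `1` and the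
others equal to `0`. -/
def cubeSimplex {k : ℕ} (s : Equiv.Perm (Fin k)) : C(Simplex k, Fin k → unitInterval) where
  toFun t i := ⟨∑ j with (s.symm i).castSucc < j, t j,
    Finset.sum_nonneg fun j _ => stdSimplex.zero_le t j,
    (Finset.sum_le_univ_sum_of_nonneg fun j => stdSimplex.zero_le t j).trans_eq
      (stdSimplex.sum_eq_one t)⟩
  continuous_toFun := by
    refine continuous_pi fun i => Continuous.subtype_mk ?_ _
    exact continuous_finsetSum _ fun j _ => (continuous_apply j).comp continuous_subtype_val

theorem cubeSimplex_e0 {k : ℕ} (s : Equiv.Perm (Fin k)) (i : Fin k) :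
    cubeSimplex s (e0 k) i = 0 := by
  ext
  change ∑ j with (s.symm i).castSucc < j, (Pi.single 0 1 : Fin (k + 1) → ℝ) j = 0
  refine Finset.sum_eq_zero fun j hj => Pi.single_eq_of_ne ?_ _
  exact ((Fin.zero_le _).trans_lt (Finset.mem_filter.1 hj).2).ne'

variable {x}

/-- The image under `p` of the fundamental chain of the cube `Iᵏ`, `k = n + 2`, with
coefficient `l`. -/
def hurewiczChain {n : ℕ} (p : RelLoop x n) (l : L.Fiber (x : X)) : Chains L (n + 2) :=
  ∑ s : Equiv.Perm (Fin (n + 2)), (Equiv.Perm.sign s : ℤ) •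
    single L (p.cube.comp (cubeSimplex s))
      (p.cube_eq_base _ (Or.inr ⟨0, Or.inl (cubeSimplex_e0 s _)⟩)) l

end TwistedHurewicz

end

/-! Write `k = n + 2`. Bijectivity is proved by constructing the inverse of the Hurewicz map on
chains. As `π₁(X, A)` is trivial and `X` is path connected, `A` is path connected. As the relative
groups vanish below `k`, all singular simplices can be deformed, compatibly with faces and without
moving the simplices of `A`, until those of dimension less than `k` lie in `A`
(`exists_deformation`). A deformed `k`-simplex then has its boundary in `A`. Composed with the
collapse `cubeToSimplex` it becomes a map `(Iᵏ, ∂Iᵏ) → (X, A)`, with a coefficient over the image of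
the vertex `0`.

Such a map of pairs has a class in the tensor product (`cubeClass`). Path connectedness of `A` lets
it be deformed to a map of triples. Two such deformations differ by the action of a loop in `A`,
which is exactly what the relation `ga ⊗ gl = a ⊗ l` divides out (`tmul_eq_of_pairHomotopy`). This
gives a homomorphism `chainClass` from chains to the tensor product. It kills chains of `A`, because
a cube inside `A` has class zero, and it kills boundaries by the homotopy addition theorem
(`CubeFunctional.sum_simplex_faces`).

The homotopy addition theorem is proved for an arbitrary function of cubes that is homotopy
invariant and additive under halving in one direction (`CubeFunctional`). There are two instances:
`cubeClass`, and the fundamental chain of a cube modulo relative boundaries (`cubeChainClass`). The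
second shows that the Hurewicz map is well defined and additive. Twisted coefficients cause little
trouble because every argument takes place in a simply connected space `Z` mapped to `X`: a
coefficient given at one point of `Z` is carried unambiguously to all others (`along`, `push`).

The two composites are then computed. Hurewicz after `chainClass` replaces a cycle by its
deformation, since modulo relative boundaries a simplex with boundary in `A` is the fundamental
chain of the cube collapsed onto it. The prism operator joins the deformed cycle to the original one
(`Compatible.boundary_prismChain`). Conversely, modulo relative boundaries the fundamental chain of
`p` is a single simplex, `p` composed with `simplexToCube`, and the self map of the cube through the
simplex is invisible to every `CubeFunctional`, so `chainClass` returns `[p] ⊗ l`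
(`chainClass_hurewiczChain`). -/

noncomputable section

namespace TwistedHurewicz

/-! ### Clamping and interpolation in cubes -/

/-- The cube `Iᵏ`. -/
abbrev Cube (k : ℕ) : Type := Fin k → unitInterval

/-- The retraction of the real line onto the unit interval. -/
def clamp (r : ℝ) : unitInterval := Set.projIcc 0 1 zero_le_one r

@[fun_prop]
theorem continuous_clamp : Continuous clamp := continuous_projIcc (h := zero_le_one)

theorem clamp_eq_zero {r : ℝ} (h : r ≤ 0) : clamp r = 0 := Set.projIcc_of_le_left _ h

theorem clamp_eq_one {r : ℝ} (h : 1 ≤ r) : clamp r = 1 := Set.projIcc_of_right_le _ h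

@[simp]
theorem clamp_coe (u : unitInterval) : clamp u = u := Set.projIcc_val _ u

theorem coe_clamp (r : ℝ) : (clamp r : ℝ) = max 0 (min 1 r) := Set.coe_projIcc _ _ _ _

theorem clamp_eq {r : ℝ} {u : unitInterval} (h : r = u) : clamp r = u := by rw [h, clamp_coe]

/-- Linear interpolation in the unit interval. -/
def lerp (s a b : unitInterval) : unitInterval := clamp ((1 - s) * a + s * b)

@[simp]
theorem lerp_self (s a : unitInterval) : lerp s a a = a := clamp_eq (by ring)

@[simp]
theorem lerp_zero (a b : unitInterval) : lerp 0 a b = a := clamp_eq (by simp)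

@[simp]
theorem lerp_one (a b : unitInterval) : lerp 1 a b = b := clamp_eq (by simp)

@[fun_prop]
theorem Continuous.lerp {Y : Type*} [TopologicalSpace Y] {s a b : Y → unitInterval}
    (hs : Continuous s) (ha : Continuous a) (hb : Continuous b) :
    Continuous fun y => lerp (s y) (a y) (b y) := by
  unfold TwistedHurewicz.lerp; fun_prop

/-- Contractibility supplies the simple connectedness that `along` and `push` require of cubes and
of prisms over them. -/
instance instContractibleSpaceCube (k : ℕ) : ContractibleSpace (Cube k) := by
  rw [contractible_iff_id_nullhomotopic]
  exact ⟨fun _ => 0, ⟨{ toFun := fun p i => lerp p.1 (p.2 i) 0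
                        continuous_toFun := by fun_prop
                        map_zero_left := fun y => by ext i : 1; simp
                        map_one_left := fun y => by ext i : 1; simp }⟩⟩

instance : ContractibleSpace unitInterval := by
  rw [contractible_iff_id_nullhomotopic]
  exact ⟨0, ⟨{ toFun := fun p => lerp p.1 p.2 0
               continuous_toFun := by fun_prop
               map_zero_left := fun y => by simp
               map_one_left := fun y => by simp }⟩⟩

/-! ### Parallel transport -/

namespace LocalSystem

variable {X : Type u} [TopologicalSpace X] (L : LocalSystem.{u, w} X)

/-- The identification of the fibres over two equal points. -/
def castFiber {x y : X} (h : x = y) : L.Fiber x →ₗ[ℤ] L.Fiber y :=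
  L.transport ((Path.refl x).cast rfl h.symm)

@[simp]
theorem castFiber_rfl {x : X} (h : x = x) (l : L.Fiber x) : L.castFiber h l = l :=
  L.transport_refl x l

@[simp]
theorem castFiber_castFiber {x y z : X} (h : x = y) (h' : y = z) (l : L.Fiber x) :
    L.castFiber h' (L.castFiber h l) = L.castFiber (h.trans h') l := by
  subst h; subst h'; simp

theorem transport_cast {x y x' y' : X} (γ : Path x y) (hx : x' = x) (hy : y' = y)
    (l : L.Fiber x') : L.transport (γ.cast hx hy) l =
      L.castFiber hy.symm (L.transport γ (L.castFiber hx l)) := by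
  subst hx; subst hy; simp

theorem transport_of_const {x y : X} (γ : Path x y) (hγ : ∀ t, γ t = x) (l : L.Fiber x) :
    L.transport γ l = L.castFiber (by rw [← γ.target, hγ]) l := by
  have h : x = y := by rw [← γ.target, hγ]
  subst h
  have : γ = Path.refl x := by ext t; simp [hγ]
  rw [L.castFiber_rfl, this, L.transport_refl]

theorem transport_symm_transport {x y : X} (γ : Path x y) (l : L.Fiber x) :
    L.transport γ.symm (L.transport γ l) = l := by
  rw [← L.transport_trans, L.transport_congr (δ := Path.refl x), L.transport_refl]
  exact ⟨(Path.Homotopy.reflTransSymm γ).symm⟩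

section Along

variable {Z : Type*} [TopologicalSpace Z] [SimplyConnectedSpace Z]

/-- Transport along the image of any path in a simply connected space. -/
def along (g : C(Z, X)) (a b : Z) : L.Fiber (g a) →ₗ[ℤ] L.Fiber (g b) :=
  L.transport ((PathConnectedSpace.somePath a b).map g.continuous)

/-- In a simply connected space two paths with the same ends are homotopic, so the chosen path may
be replaced by any convenient one. -/
theorem along_eq (g : C(Z, X)) {a b : Z} (γ : Path a b) :
    L.along g a b = L.transport (γ.map g.continuous) :=
  L.transport_congr ((SimplyConnectedSpace.paths_homotopic _ γ).map g)

@[simp]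
theorem along_self (g : C(Z, X)) (a : Z) (l : L.Fiber (g a)) : L.along g a a l = l := by
  rw [L.along_eq g (Path.refl a)]
  exact L.transport_refl _ l

@[simp]
theorem along_along (g : C(Z, X)) (a b c : Z) (l : L.Fiber (g a)) :
    L.along g b c (L.along g a b l) = L.along g a c l := by
  rw [L.along_eq g (PathConnectedSpace.somePath a b), L.along_eq g
    (PathConnectedSpace.somePath b c), ← L.transport_trans, ← Path.map_trans, ← L.along_eq]

theorem along_comp {Z' : Type*} [TopologicalSpace Z'] [SimplyConnectedSpace Z'] (g : C(Z, X))
    (φ : C(Z', Z)) (a b : Z') (l : L.Fiber (g (φ a))) :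
    L.along (g.comp φ) a b l = L.along g (φ a) (φ b) l := by
  rw [L.along_eq (g.comp φ) (PathConnectedSpace.somePath a b),
    L.along_eq g ((PathConnectedSpace.somePath a b).map φ.continuous)]
  rfl

theorem along_of_eq {g g' : C(Z, X)} (h : g = g') (a b : Z) (l : L.Fiber (g a)) :
    L.along g' a b (L.castFiber (by rw [h]) l) = L.castFiber (by rw [h]) (L.along g a b l) := by
  subst h; simp

theorem along_cast_right (g : C(Z, X)) (a : Z) {b b' : Z} (h : b = b') (l : L.Fiber (g a)) :
    L.along g a b' l = L.castFiber (by rw [h]) (L.along g a b l) := by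
  subst h; simp

theorem along_of_const (g : C(Z, X)) {a b : Z} (γ : Path a b) (h : ∀ t, g (γ t) = g a)
    (l : L.Fiber (g a)) : L.along g a b l = L.castFiber (by rw [← h 1, γ.target]) l := by
  rw [L.along_eq g γ, L.transport_of_const _ h]

end Along

section Trace

variable {Z : Type*} [TopologicalSpace Z]

/-- Transport along the trace of a point under a homotopy. -/
def trace {f g : C(Z, X)} (H : f.Homotopy g) (z : Z) : L.Fiber (f z) →ₗ[ℤ] L.Fiber (g z) :=
  L.transport (H.evalAt z)

theorem trace_trans {f g h : C(Z, X)} (H : f.Homotopy g) (K : g.Homotopy h) (z : Z)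
    (l : L.Fiber (f z)) : L.trace (H.trans K) z l = L.trace K z (L.trace H z l) := by
  rw [trace, trace, trace, ← L.transport_trans]
  congr 2

theorem trace_symm {f g : C(Z, X)} (H : f.Homotopy g) (z : Z)
    (l : L.Fiber (f z)) : L.trace H.symm z (L.trace H z l) = l :=
  L.transport_symm_transport (H.evalAt z) l

theorem trace_refl (f : C(Z, X)) (z : Z) (l : L.Fiber (f z)) :
    L.trace (ContinuousMap.Homotopy.refl f) z l = l :=
  L.transport_refl _ l

/-- The homotopy maps a square to `X`, and the two ways around the square are homotopic paths. -/
theorem trace_along [SimplyConnectedSpace Z] {f g : C(Z, X)} (H : f.Homotopy g) (a b : Z)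
    (l : L.Fiber (f a)) : L.trace H b (L.along f a b l) = L.along g a b (L.trace H a l) := by
  let γ := PathConnectedSpace.somePath a b
  rw [L.along_eq f γ, L.along_eq g γ, trace, trace, ← L.transport_trans, ← L.transport_trans,
    L.transport_congr (Path.Homotopic.map_trans_evalAt H γ)]

theorem trace_of_const {f g : C(Z, X)} (H : f.Homotopy g) (z : Z) (h : ∀ t, H (t, z) = f z)
    (l : L.Fiber (f z)) : L.trace H z l = L.castFiber (by rw [← h 1, H.apply_one]) l :=
  L.transport_of_const _ h l

theorem trace_castFiber {f g : C(Z, X)} (H : f.Homotopy g) {z z' : Z} (h : z = z')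
    (l : L.Fiber (f z)) : L.trace H z' (L.castFiber (by rw [h]) l) =
      L.castFiber (by rw [h]) (L.trace H z l) := by
  subst h; simp

/-- The trace of a homotopy that factors through a simply connected space. -/
theorem trace_eq_along {W : Type*} [TopologicalSpace W] [SimplyConnectedSpace W] (G : C(W, X))
    {m m' : C(Z, W)} (K : m.Homotopy m') {f g : C(Z, X)} (H : f.Homotopy g)
    (h : ∀ p, H p = G (K p)) (z : Z) (l : L.Fiber (f z)) :
    L.trace H z l = L.castFiber (by rw [← H.apply_one, h, K.apply_one])
      (L.along G (m z) (m' z) (L.castFiber (by rw [← H.apply_zero, h, K.apply_zero]) l)) := by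
  have hf : f z = G (m z) := by rw [← H.apply_zero, h, K.apply_zero]
  have hg : g z = G (m' z) := by rw [← H.apply_one, h, K.apply_one]
  rw [L.along_eq G (K.evalAt z), ← L.transport_cast _ hf hg, trace]
  congr 2
  ext t
  exact h (t, z)

end Trace

end LocalSystem

/-! ### Pushing simplices of a simply connected space into a local system -/

section Push

variable {X : Type u} [TopologicalSpace X] (L : LocalSystem.{u, w} X)
variable {Z : Type*} [TopologicalSpace Z] [SimplyConnectedSpace Z]

/-- The chain `(g ∘ τ) ⊗ l'`, where `l'` is the transport in `Z` of `l` from `a` to the initial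
vertex of `τ`. -/
def push (g : C(Z, X)) (a : Z) {n : ℕ} (τ : C(Simplex n, Z)) : L.Fiber (g a) →+ Chains L n :=
  (gen L (g.comp τ)).comp (L.along g a (τ (e0 n))).toAddMonoidHom

theorem push_apply (g : C(Z, X)) (a : Z) {n : ℕ} (τ : C(Simplex n, Z)) (l : L.Fiber (g a)) :
    push L g a τ l = gen L (g.comp τ) (L.along g a (τ (e0 n)) l) := rfl

theorem gen_castFiber {n : ℕ} {σ σ' : C(Simplex n, X)} (h : σ = σ') (l : L.Fiber (σ (e0 n))) :
    gen L σ' (L.castFiber (by rw [h]) l) = gen L σ l := by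
  subst h; simp

theorem single_apply {n : ℕ} (σ : C(Simplex n, X)) {x : X} (h : σ (e0 n) = x) (l : L.Fiber x) :
    single L σ h l = gen L σ (L.castFiber h.symm l) := by
  subst h
  change gen L σ (L.transport (Path.refl _).symm l) = _
  rw [Path.refl_symm, L.transport_refl, L.castFiber_rfl]

/-- The twist in the zeroth face is transport along an edge that lies in `Z`, so it is absorbed by
`along`. After this, boundaries of pushed simplices obey the untwisted formula. -/
theorem face_push (g : C(Z, X)) (a : Z) {n : ℕ} (τ : C(Simplex (n + 1), Z)) (i : Fin (n + 2))
    (l : L.Fiber (g a)) :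
    face L n i (push L g a τ l) = push L g a (τ.comp (faceMap n i)) l := by
  have h : L.along g (τ (e0 (n + 1))) ((τ.comp (faceMap n i)) (e0 n)) = _ :=
    L.along_eq g ((segment (e0 (n + 1)) (faceMap n i (e0 n))).map τ.continuous)
  rw [push_apply, face_gen, push_apply, ← L.along_along g a (τ (e0 _))
    ((τ.comp (faceMap n i)) (e0 n)), h]
  rfl

theorem boundary_push (g : C(Z, X)) (a : Z) {n : ℕ} (τ : C(Simplex (n + 1), Z))
    (l : L.Fiber (g a)) :
    boundary L n (push L g a τ l) =
      ∑ i : Fin (n + 2), ((-1 : ℤ) ^ (i : ℕ)) • push L g a (τ.comp (faceMap n i)) l := by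
  simp only [boundary_apply, face_push]

theorem push_along (g : C(Z, X)) (a b : Z) {n : ℕ} (τ : C(Simplex n, Z)) (l : L.Fiber (g a)) :
    push L g b τ (L.along g a b l) = push L g a τ l := by
  rw [push_apply, push_apply, L.along_along]

theorem push_comp {Z' : Type*} [TopologicalSpace Z'] [SimplyConnectedSpace Z'] (g : C(Z, X))
    (φ : C(Z', Z)) (a : Z') {n : ℕ} (τ : C(Simplex n, Z')) (l : L.Fiber (g (φ a))) :
    push L (g.comp φ) a τ l = push L g (φ a) (φ.comp τ) l := by
  rw [push_apply, push_apply, L.along_comp]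
  rfl

theorem push_of_eq {g g' : C(Z, X)} (h : g = g') (a : Z) {n : ℕ} (τ : C(Simplex n, Z))
    (l : L.Fiber (g a)) : push L g' a τ (L.castFiber (by rw [h]) l) = push L g a τ l := by
  subst h; simp

theorem gen_mem_chainsIn (A : Set X) {n : ℕ} (σ : C(Simplex n, X)) (h : Set.range σ ⊆ A)
    (l : L.Fiber (σ (e0 n))) : gen L σ l ∈ chainsIn L A n := by
  classical
  intro τ hτ
  refine DirectSum.of_eq_of_ne _ _ _ ?_
  rintro rfl
  exact hτ h

theorem push_mem_chainsIn (A : Set X) (g : C(Z, X)) (a : Z) {n : ℕ} (τ : C(Simplex n, Z))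
    (h : ∀ t, g (τ t) ∈ A) (l : L.Fiber (g a)) : push L g a τ l ∈ chainsIn L A n :=
  gen_mem_chainsIn L A _ (by rintro _ ⟨t, rfl⟩; exact h t) _

end Push

/-! ### Additive functionals on cubes -/

/-- The reparametrisation of the `i`-th coordinate of a cube. -/
def coordMap {k : ℕ} (i : Fin k) (φ : C(unitInterval, unitInterval)) : C(Cube k, Cube k) where
  toFun y := Function.update y i (φ (y i))
  continuous_toFun := continuous_id.update i (by fun_prop)

/-- The inclusion of the left half of the unit interval. -/
def leftHalf : C(unitInterval, unitInterval) := ⟨fun u => clamp (u / 2), by fun_prop⟩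

/-- The inclusion of the right half of the unit interval. -/
def rightHalf : C(unitInterval, unitInterval) := ⟨fun u => clamp ((1 + u) / 2), by fun_prop⟩

/-- The reflection of the unit interval. -/
def reflection : C(unitInterval, unitInterval) := ⟨unitInterval.symm, unitInterval.continuous_symm⟩

/-- Permutation of the coordinates of a cube. -/
def permMap {k : ℕ} (s : Equiv.Perm (Fin k)) : C(Cube k, Cube k) :=
  ⟨fun y => y ∘ s, by fun_prop⟩

@[simp]
theorem coe_leftHalf (u : unitInterval) : (leftHalf u : ℝ) = u / 2 := by
  change (clamp (u / 2) : ℝ) = _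
  have := u.2.1; have := u.2.2
  rw [coe_clamp, min_eq_right (by linarith), max_eq_right (by linarith)]

@[simp]
theorem coe_rightHalf (u : unitInterval) : (rightHalf u : ℝ) = (1 + u) / 2 := by
  change (clamp ((1 + u) / 2) : ℝ) = _
  have := u.2.1; have := u.2.2
  rw [coe_clamp, min_eq_right (by linarith), max_eq_right (by linarith)]

/-- A function on the `k`-cubes of `Z` that is invariant under homotopies of cubes with boundary
in `B`, and additive for subdivisions of such cubes in the direction `i₀` along a wall in `B`. -/
structure CubeFunctional {k : ℕ} (i₀ : Fin k) {Z : Type*} [TopologicalSpace Z] (B : Set Z)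
    {G : Type*} [AddCommGroup G] (F : C(Cube k, Z) → G) : Prop where
  homotopy : ∀ H : C(unitInterval × Cube k, Z),
    (∀ t, ∀ y ∈ Cube.boundary (Fin k), H (t, y) ∈ B) →
    F (H.comp ⟨fun y => (0, y), by fun_prop⟩) = F (H.comp ⟨fun y => (1, y), by fun_prop⟩)
  split : ∀ m : C(Cube k, Z), (∀ y ∈ Cube.boundary (Fin k), m y ∈ B) →
    (∀ y : Cube k, (y i₀ : ℝ) = 1 / 2 → m y ∈ B) →
    F m = F (m.comp (coordMap i₀ leftHalf)) + F (m.comp (coordMap i₀ rightHalf))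

namespace CubeFunctional

variable {k : ℕ} {i₀ : Fin k} {Z : Type*} [TopologicalSpace Z] {B : Set Z}
  {G : Type*} [AddCommGroup G] {F : C(Cube k, Z) → G}

theorem homotopy_eq (hF : CubeFunctional i₀ B F) (H : C(unitInterval × Cube k, Z))
    (hB : ∀ t, ∀ y ∈ Cube.boundary (Fin k), H (t, y) ∈ B) {m m' : C(Cube k, Z)}
    (h0 : ∀ y, H (0, y) = m y) (h1 : ∀ y, H (1, y) = m' y) : F m = F m' := by
  have e := hF.homotopy H hB
  convert e using 2
  · ext1 y; exact (h0 y).symm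
  · ext1 y; exact (h1 y).symm

/-- Such a cube shrinks to a constant cube inside `B`. A constant cube coincides with both of its
halves, so its value `v` satisfies `v = v + v`. -/
theorem eq_zero (hF : CubeFunctional i₀ B F) (m : C(Cube k, Z)) (hm : ∀ y, m y ∈ B) :
    F m = 0 := by
  have h1 : F m = F (ContinuousMap.const _ (m 0)) := by
    refine hF.homotopy_eq ⟨fun p => m (fun i => lerp p.1 (p.2 i) 0), by fun_prop⟩
      (fun _ _ _ => hm _) (fun y => ?_) (fun y => ?_)
    · simp
    · simp only [ContinuousMap.coe_mk, lerp_one, ContinuousMap.const_apply]; rfl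
  have h2 := hF.split (ContinuousMap.const _ (m 0)) (fun _ _ => hm _) (fun _ _ => hm _)
  simp only [ContinuousMap.const_comp] at h2
  rw [h1]
  simpa using h2

/-- Maps into a cube that take the boundary to common walls are homotopic. -/
theorem eq_of_lerp (hF : CubeFunctional i₀ B F) (m : C(Cube k, Z)) {a b : C(Cube k, Cube k)}
    (h : ∀ y ∈ Cube.boundary (Fin k), ∀ t, m (fun i => lerp t (a y i) (b y i)) ∈ B) :
    F (m.comp a) = F (m.comp b) :=
  hF.homotopy_eq ⟨fun p => m (fun i => lerp p.1 (a p.2 i) (b p.2 i)), by fun_prop⟩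
    (fun t y hy => h y hy t) (fun y => by simp) (fun y => by simp)

/-- A self map of the cube that preserves every wall acts trivially. -/
theorem eq_of_lerp_walls (hF : CubeFunctional i₀ B F) (m : C(Cube k, Z))
    (hm : ∀ y ∈ Cube.boundary (Fin k), m y ∈ B) {a b : C(Cube k, Cube k)}
    (h : ∀ y ∈ Cube.boundary (Fin k), ∃ i, a y i = b y i ∧ (b y i = 0 ∨ b y i = 1)) :
    F (m.comp a) = F (m.comp b) := by
  refine hF.eq_of_lerp m fun y hy t => hm _ ?_
  obtain ⟨i, hab, hi⟩ := h y hy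
  exact ⟨i, by simpa only [hab, lerp_self] using hi⟩

/-- Fold the cube in the direction `i₀`. The left half of the folded cube is the cube itself and the
right half is its reflection. The folded cube has value zero, because on the boundary it shares
walls with the cube squeezed into the wall `y i₀ = 0`. -/
theorem coordMap_reflection₀ (hF : CubeFunctional i₀ B F) (m : C(Cube k, Z))
    (hm : ∀ y ∈ Cube.boundary (Fin k), m y ∈ B) :
    F (m.comp (coordMap i₀ reflection)) = - F m := by
  let fold : C(unitInterval, unitInterval) := ⟨fun u => clamp (1 - |2 * (u : ℝ) - 1|), by fun_prop⟩
  have hl : (coordMap i₀ fold).comp (coordMap i₀ leftHalf) = ContinuousMap.id _ := by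
    ext1 y
    change Function.update (Function.update y i₀ _) i₀ (fold (Function.update y i₀ _ i₀)) = y
    rw [Function.update_self, Function.update_idem]
    have : fold (leftHalf (y i₀)) = y i₀ := by
      refine clamp_eq ?_
      have := (y i₀).2.1; have := (y i₀).2.2
      rw [coe_leftHalf, abs_of_nonpos (by linarith)]; ring
    rw [this, Function.update_eq_self]
  have hr : (coordMap i₀ fold).comp (coordMap i₀ rightHalf) = coordMap i₀ reflection := by
    ext1 y
    change Function.update (Function.update y i₀ _) i₀ (fold (Function.update y i₀ _ i₀)) =
      Function.update y i₀ (unitInterval.symm (y i₀))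
    rw [Function.update_self, Function.update_idem]
    have : fold (rightHalf (y i₀)) = unitInterval.symm (y i₀) := by
      refine clamp_eq ?_
      have := (y i₀).2.1; have := (y i₀).2.2
      rw [coe_rightHalf, abs_of_nonneg (by linarith), unitInterval.coe_symm_eq]; ring
    rw [this]
  have hfb : ∀ y ∈ Cube.boundary (Fin k), ∃ i, coordMap i₀ fold y i =
      coordMap i₀ (ContinuousMap.const _ 0) y i ∧
      (coordMap i₀ (ContinuousMap.const _ 0) y i = 0 ∨
        coordMap i₀ (ContinuousMap.const _ 0) y i = 1) := by
    rintro y ⟨i, hi⟩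
    refine ⟨i, ?_⟩
    rcases eq_or_ne i i₀ with rfl | hne
    · have : fold (y i) = 0 := by
        refine clamp_eq_zero ?_
        rcases hi with hi | hi <;> rw [hi] <;> norm_num
      simp [coordMap, this]
    · simp [coordMap, Function.update_of_ne hne, hi]
  have h0 : F (m.comp (coordMap i₀ fold)) = 0 := by
    rw [hF.eq_of_lerp_walls m hm hfb]
    exact hF.eq_zero _ fun y => hm _ ⟨i₀, Or.inl (by simp [coordMap])⟩
  have hs := hF.split (m.comp (coordMap i₀ fold)) (fun y hy => hm _ (by
      obtain ⟨i, h1, h2⟩ := hfb y hy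
      exact ⟨i, by rwa [h1]⟩)) (fun y hy => hm _ ⟨i₀, Or.inr (by
        simp only [coordMap, ContinuousMap.coe_mk, Function.update_self]
        exact clamp_eq_one (by rw [hy]; norm_num))⟩)
  rw [ContinuousMap.comp_assoc, ContinuousMap.comp_assoc, hl, hr, h0, ContinuousMap.comp_id] at hs
  exact (neg_eq_of_add_eq_zero_right hs.symm).symm

/-- The quarter turn of the cube in the plane of the coordinates `i` and `j`. -/
def turn (i j : Fin k) : C(Cube k, Cube k) where
  toFun y := Function.update (Function.update y i (unitInterval.symm (y j))) j (y i)
  continuous_toFun := (continuous_id.update i (by fun_prop)).update j (by fun_prop)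

/-- Straight-line interpolation from the identity to a quarter turn would leave the boundary of the
square. Two intermediate maps are inserted so that consecutive maps always send a boundary point
into a common edge. -/
theorem comp_turn (hF : CubeFunctional i₀ B F) (m : C(Cube k, Z))
    (hm : ∀ y ∈ Cube.boundary (Fin k), m y ∈ B) {i j : Fin k} (hij : i ≠ j) :
    F (m.comp (turn i j)) = F m := by
  let mk (f g : C(unitInterval × unitInterval, unitInterval)) : C(Cube k, Cube k) :=
    ⟨fun y => Function.update (Function.update y i (f (y i, y j))) j (g (y i, y j)),
      (continuous_id.update i (by fun_prop)).update j (by fun_prop)⟩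
  have mki (f g) (y : Cube k) : mk f g y i = f (y i, y j) := by
    simp [mk, Function.update_of_ne hij]
  have mkj (f g) (y : Cube k) : mk f g y j = g (y i, y j) := by simp [mk]
  have mkl (f g) (y : Cube k) (l : Fin k) (hi : l ≠ i) (hj : l ≠ j) : mk f g y l = y l := by
    simp [mk, Function.update_of_ne hi, Function.update_of_ne hj]
  -- Only the coordinates `i` and `j` are changed, so a boundary point on any other wall stays there
  -- and the condition reduces to the square.
  have key (f g f' g' : C(unitInterval × unitInterval, unitInterval))
      (h : ∀ u v : unitInterval, (u = 0 ∨ u = 1) ∨ (v = 0 ∨ v = 1) →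
        (f (u, v) = f' (u, v) ∧ (f' (u, v) = 0 ∨ f' (u, v) = 1)) ∨
        (g (u, v) = g' (u, v) ∧ (g' (u, v) = 0 ∨ g' (u, v) = 1))) :
      F (m.comp (mk f g)) = F (m.comp (mk f' g')) := by
    refine hF.eq_of_lerp_walls m hm ?_
    rintro y ⟨l, hl⟩
    by_cases hli : (l = i ∨ l = j)
    · have : (y i = 0 ∨ y i = 1) ∨ (y j = 0 ∨ y j = 1) := by
        rcases hli with rfl | rfl
        · exact Or.inl hl
        · exact Or.inr hl
      rcases h _ _ this with h | h
      · exact ⟨i, by rwa [mki, mki]⟩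
      · exact ⟨j, by rwa [mkj, mkj]⟩
    · push Not at hli
      exact ⟨l, by rw [mkl _ _ _ _ hli.1 hli.2, mkl _ _ _ _ hli.1 hli.2]; exact ⟨rfl, hl⟩⟩
  let f0 : C(unitInterval × unitInterval, unitInterval) := ⟨Prod.fst, by fun_prop⟩
  let g0 : C(unitInterval × unitInterval, unitInterval) := ⟨Prod.snd, by fun_prop⟩
  -- `(f1, g1)` keeps every edge and collapses half of it to a corner. That half is then free to
  -- slide along the next edge, which `(f2, g2)` does while the other half is collapsed.
  let f1 : C(unitInterval × unitInterval, unitInterval) :=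
    ⟨fun p => clamp (2 * p.1 - p.2), by fun_prop⟩
  let g1 : C(unitInterval × unitInterval, unitInterval) :=
    ⟨fun p => clamp (2 * p.2 - 1 + p.1), by fun_prop⟩
  let f2 : C(unitInterval × unitInterval, unitInterval) :=
    ⟨fun p => clamp (1 + p.1 - 2 * p.2), by fun_prop⟩
  let g2 : C(unitInterval × unitInterval, unitInterval) :=
    ⟨fun p => clamp (2 * p.1 - 1 + p.2), by fun_prop⟩
  let f3 : C(unitInterval × unitInterval, unitInterval) :=
    ⟨fun p => unitInterval.symm p.2, by fun_prop⟩
  have h0 : m = m.comp (mk f0 g0) := by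
    ext1 y
    change m y = m (mk f0 g0 y)
    congr 1
    simp [mk, f0, g0]
  have h01 : F (m.comp (mk f0 g0)) = F (m.comp (mk f1 g1)) := by
    refine key _ _ _ _ fun u v huv => ?_
    have := u.2.1; have := u.2.2; have := v.2.1; have := v.2.2
    rcases huv with (rfl | rfl) | (rfl | rfl)
    · left
      have : f1 (0, v) = 0 := clamp_eq_zero (by simpa using v.2.1)
      simp [f0, this]
    · left
      have : f1 (1, v) = 1 := clamp_eq_one (by simp; linarith)
      simp [f0, this]
    · right
      have : g1 (u, 0) = 0 := clamp_eq_zero (by simp; linarith)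
      simp [g0, this]
    · right
      have : g1 (u, 1) = 1 := clamp_eq_one (by simp; linarith)
      simp [g0, this]
  have h12 : F (m.comp (mk f1 g1)) = F (m.comp (mk f2 g2)) := by
    refine key _ _ _ _ fun u v huv => ?_
    have := u.2.1; have := u.2.2; have := v.2.1; have := v.2.2
    rcases huv with (rfl | rfl) | (rfl | rfl)
    · rcases le_total (v : ℝ) (1 / 2) with h | h
      · right
        have h1 : g1 (0, v) = 0 := clamp_eq_zero (by simp; linarith)
        have h2 : g2 (0, v) = 0 := clamp_eq_zero (by simp; linarith)
        simp [h1, h2]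
      · left
        have h1 : f1 (0, v) = 0 := clamp_eq_zero (by simpa using v.2.1)
        have h2 : f2 (0, v) = 0 := clamp_eq_zero (by simp; linarith)
        simp [h1, h2]
    · rcases le_total (v : ℝ) (1 / 2) with h | h
      · left
        have h1 : f1 (1, v) = 1 := clamp_eq_one (by simp; linarith)
        have h2 : f2 (1, v) = 1 := clamp_eq_one (by simp; linarith)
        simp [h1, h2]
      · right
        have h1 : g1 (1, v) = 1 := clamp_eq_one (by simp; linarith)
        have h2 : g2 (1, v) = 1 := clamp_eq_one (by simp; linarith)
        simp [h1, h2]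
    · rcases le_total (u : ℝ) (1 / 2) with h | h
      · right
        have h1 : g1 (u, 0) = 0 := clamp_eq_zero (by simp; linarith)
        have h2 : g2 (u, 0) = 0 := clamp_eq_zero (by simp; linarith)
        simp [h1, h2]
      · left
        have h1 : f1 (u, 0) = 1 := clamp_eq_one (by simp; linarith)
        have h2 : f2 (u, 0) = 1 := clamp_eq_one (by simp; linarith)
        simp [h1, h2]
    · rcases le_total (u : ℝ) (1 / 2) with h | h
      · left
        have h1 : f1 (u, 1) = 0 := clamp_eq_zero (by simp; linarith)
        have h2 : f2 (u, 1) = 0 := clamp_eq_zero (by simp; linarith)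
        simp [h1, h2]
      · right
        have h1 : g1 (u, 1) = 1 := clamp_eq_one (by simp; linarith)
        have h2 : g2 (u, 1) = 1 := clamp_eq_one (by simp; linarith)
        simp [h1, h2]
  have h23 : F (m.comp (mk f2 g2)) = F (m.comp (mk f3 f0)) := by
    refine key _ _ _ _ fun u v huv => ?_
    have := u.2.1; have := u.2.2; have := v.2.1; have := v.2.2
    rcases huv with (rfl | rfl) | (rfl | rfl)
    · right
      have : g2 (0, v) = 0 := clamp_eq_zero (by simp; linarith)
      simp [f0, this]
    · right
      have : g2 (1, v) = 1 := clamp_eq_one (by simp; linarith)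
      simp [f0, this]
    · left
      have : f2 (u, 0) = 1 := clamp_eq_one (by simp; linarith)
      simp [f3, this]
    · left
      have : f2 (u, 1) = 0 := clamp_eq_zero (by simp; linarith)
      simp [f3, this]
  have h3 : turn i j = mk f3 f0 := rfl
  rw [h3, ← h23, ← h12, ← h01, ← h0]

theorem permMap_mem_boundary (s : Equiv.Perm (Fin k)) {y : Cube k}
    (hy : y ∈ Cube.boundary (Fin k)) : permMap s y ∈ Cube.boundary (Fin k) := by
  obtain ⟨i, hi⟩ := hy
  exact ⟨s.symm i, by simpa [permMap] using hi⟩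

/-- In the plane of two coordinates a transposition is a quarter turn followed by a reflection. The
turn is invisible and the reflection gives the sign. -/
theorem comp_swap₀ (hF : CubeFunctional i₀ B F) (m : C(Cube k, Z))
    (hm : ∀ y ∈ Cube.boundary (Fin k), m y ∈ B) {j : Fin k} (hj : i₀ ≠ j) :
    F (m.comp (permMap (Equiv.swap i₀ j))) = - F m := by
  have e : permMap (Equiv.swap i₀ j) = (coordMap i₀ reflection).comp (turn i₀ j) := by
    ext1 y
    funext l
    simp only [permMap, coordMap, turn, reflection, ContinuousMap.coe_mk, ContinuousMap.comp_apply,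
      Function.comp_apply]
    rcases eq_or_ne l i₀ with rfl | h1
    · simp [Function.update_of_ne hj]
    · rcases eq_or_ne l j with rfl | h2
      · simp [h1]
      · simp [h1, h2, Equiv.swap_apply_of_ne_of_ne]
  rw [e, ← ContinuousMap.comp_assoc, hF.comp_turn _ _ hj, hF.coordMap_reflection₀ m hm]
  rintro y ⟨i, hi⟩
  refine hm _ ⟨i, ?_⟩
  rcases eq_or_ne i i₀ with rfl | h
  · simp only [coordMap, reflection, ContinuousMap.coe_mk, Function.update_self]
    rcases hi with hi | hi <;> simp [hi]
  · simpa [coordMap, Function.update_of_ne h] using hi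

theorem permMap_mul (s t : Equiv.Perm (Fin k)) :
    permMap (s * t) = (permMap t).comp (permMap s) := by
  ext1 y; rfl

/-- Transpositions involving `i₀` are already known to change the sign. Any other transposition is a
product of three of these, so it changes the sign as well. -/
theorem comp_permMap (hF : CubeFunctional i₀ B F) (m : C(Cube k, Z))
    (hm : ∀ y ∈ Cube.boundary (Fin k), m y ∈ B) (s : Equiv.Perm (Fin k)) :
    F (m.comp (permMap s)) = (Equiv.Perm.sign s : ℤ) • F m := by
  have hswap (m : C(Cube k, Z)) (hm : ∀ y ∈ Cube.boundary (Fin k), m y ∈ B) {i j : Fin k}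
      (hij : i ≠ j) : F (m.comp (permMap (Equiv.swap i j))) = - F m := by
    rcases eq_or_ne i₀ i with rfl | hi
    · exact hF.comp_swap₀ m hm hij
    rcases eq_or_ne i₀ j with rfl | hj
    · rw [Equiv.swap_comm]; exact hF.comp_swap₀ m hm hij.symm
    have e : Equiv.swap i j = Equiv.swap i₀ i * Equiv.swap i₀ j * Equiv.swap i₀ i := by
      rw [Equiv.swap_comm i₀ j, Equiv.swap_mul_swap_mul_swap hj.symm hij.symm]
    rw [e, permMap_mul, permMap_mul, ← ContinuousMap.comp_assoc, ← ContinuousMap.comp_assoc,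
      hF.comp_swap₀ _ _ hi, hF.comp_swap₀ _ _ hj, hF.comp_swap₀ _ hm hi, neg_neg]
    · exact fun y hy => hm _ (permMap_mem_boundary _ hy)
    · exact fun y hy => hm _ (permMap_mem_boundary _ (permMap_mem_boundary _ hy))
  induction s using Equiv.Perm.swap_induction_on generalizing m with
  | one => simp only [map_one, Units.val_one, one_smul]; rfl
  | swap_mul s i j hij ih =>
    rw [permMap_mul, ← ContinuousMap.comp_assoc, hswap _ _ hij, ih m hm, Equiv.Perm.sign_mul,
      Equiv.Perm.sign_swap hij]
    · simp
    · exact fun y hy => hm _ (permMap_mem_boundary _ hy)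

theorem coordMap_comp_swap (i j : Fin k) (φ : C(unitInterval, unitInterval)) :
    (permMap (Equiv.swap i j)).comp (coordMap i φ) =
      (coordMap j φ).comp (permMap (Equiv.swap i j)) := by
  ext1 y
  funext l
  simp only [permMap, coordMap, ContinuousMap.coe_mk, ContinuousMap.comp_apply,
      Function.comp_apply]
  by_cases h : l = j
  · subst h; simp
  · rw [Function.update_of_ne h, Function.update_of_ne]
    · rfl
    · intro h'
      rw [Equiv.swap_apply_eq_iff, Equiv.swap_apply_left] at h'
      exact h h'

/-- Exchange `i` with the distinguished direction `i₀`, split there, and exchange back: the sign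
appears in all three terms and cancels. -/
theorem split_at (hF : CubeFunctional i₀ B F) (i : Fin k) (m : C(Cube k, Z))
    (hm : ∀ y ∈ Cube.boundary (Fin k), m y ∈ B)
    (hw : ∀ y : Cube k, (y i : ℝ) = 1 / 2 → m y ∈ B) :
    F m = F (m.comp (coordMap i leftHalf)) + F (m.comp (coordMap i rightHalf)) := by
  rcases eq_or_ne i₀ i with rfl | hi
  · exact hF.split m hm hw
  -- In the direction `i` a half cube is bounded by one old wall and by the middle wall. The two
  -- conditions on `φ` cover both halves at once.
  have hw' (φ : C(unitInterval, unitInterval)) (h0 : φ 0 = 0 ∨ (φ 0 : ℝ) = 1 / 2)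
      (h1 : φ 1 = 1 ∨ (φ 1 : ℝ) = 1 / 2) :
      ∀ y ∈ Cube.boundary (Fin k), m.comp (coordMap i φ) y ∈ B := by
    rintro y ⟨l, hl⟩
    rcases eq_or_ne l i with rfl | h
    · have : (φ (y l) = 0 ∨ φ (y l) = 1) ∨ (φ (y l) : ℝ) = 1 / 2 := by
        rcases hl with hl | hl <;> rw [hl] <;> tauto
      rcases this with h | h
      · exact hm _ ⟨l, by simpa [coordMap] using h⟩
      · exact hw _ (by simpa [coordMap] using h)
    · exact hm _ ⟨l, by simpa [coordMap, Function.update_of_ne h] using hl⟩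
  have h := hF.split (m.comp (permMap (Equiv.swap i₀ i)))
    (fun y hy => hm _ (permMap_mem_boundary _ hy)) (fun y hy => hw _ (by simpa [permMap] using hy))
  rw [ContinuousMap.comp_assoc, ContinuousMap.comp_assoc, coordMap_comp_swap, coordMap_comp_swap,
    ← ContinuousMap.comp_assoc, ← ContinuousMap.comp_assoc,
    hF.comp_swap₀ (m.comp (coordMap i leftHalf)) _ hi,
    hF.comp_swap₀ (m.comp (coordMap i rightHalf)) _ hi, hF.comp_swap₀ m hm hi, ← neg_add,
    neg_inj] at h
  · exact h
  · exact hw' _ (Or.inr (by simp)) (Or.inl (by ext; simp))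
  · exact hw' _ (Or.inl (by ext; simp)) (Or.inr (by simp))

end CubeFunctional

/-! ### The homotopy addition theorem for cubes -/

namespace CubeFunctional

variable {k : ℕ} {i₀ : Fin k} {Z : Type*} [TopologicalSpace Z] {B : Set Z}
  {G : Type*} [AddCommGroup G] {F : C(Cube k, Z) → G}

theorem coordMap_reflection (hF : CubeFunctional i₀ B F) (i : Fin k) (m : C(Cube k, Z))
    (hm : ∀ y ∈ Cube.boundary (Fin k), m y ∈ B) :
    F (m.comp (coordMap i reflection)) = - F m := by
  rcases eq_or_ne i₀ i with rfl | hi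
  · exact hF.coordMap_reflection₀ m hm
  have hr : ∀ y ∈ Cube.boundary (Fin k), coordMap i reflection y ∈ Cube.boundary (Fin k) := by
    rintro y ⟨j, hj⟩
    refine ⟨j, ?_⟩
    rcases eq_or_ne j i with rfl | h
    · simp only [coordMap, reflection, ContinuousMap.coe_mk, Function.update_self]
      rcases hj with hj | hj <;> simp [hj]
    · simpa [coordMap, Function.update_of_ne h] using hj
  have h := hF.coordMap_reflection₀ (m.comp (permMap (Equiv.swap i₀ i)))
    (fun y hy => hm _ (permMap_mem_boundary _ hy))
  rw [ContinuousMap.comp_assoc, coordMap_comp_swap, ← ContinuousMap.comp_assoc,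
    hF.comp_swap₀ (m.comp (coordMap i reflection)) (fun y hy => hm _ (hr y hy)) hi,
    hF.comp_swap₀ m hm hi, neg_inj] at h
  exact h

/-- The face of `I × Iᵏ` on which the `j`-th coordinate of `Iᵏ` is `ε`, parametrised by `Iᵏ`
in such a way that the `j`-th coordinate becomes the coordinate of the factor `I`. -/
def sideMap (j : Fin k) (ε : unitInterval) : C(Cube k, unitInterval × Cube k) :=
  ⟨fun z => (z j, Function.update z j ε), by
    have := (continuous_id (X := Cube k)).update j (continuous_const (y := ε))
    exact (continuous_apply j).prodMk this⟩

/-- The face of `I × Iᵏ` on which the coordinate of the factor `I` is `ε`. -/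
def endMap (k : ℕ) (ε : unitInterval) : C(Cube k, unitInterval × Cube k) :=
  ⟨fun z => (ε, z), by fun_prop⟩

/-! ### Wrapping a cube around the sides of the prism `I × Iᵏ` -/

/-- A tent-like function that vanishes at the end points of the unit interval and equals `1` on
`[1/2, 3/4]`. -/
def tent : C(unitInterval, unitInterval) :=
  ⟨fun u => clamp (min (2 * u) (4 - 4 * u)), by fun_prop⟩

/-- A function on the unit interval that expands `[1/2, 3/4]`. -/
def expand : C(unitInterval, unitInterval) := ⟨fun u => clamp (4 * u - 2), by fun_prop⟩

/-- The curve `(expand, tent)` runs around three sides of a square: up one side on `[0, 1/2]`, along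
the top on `[1/2, 3/4]`, down the other side on `[3/4, 1]`. -/
theorem tent_eq_one_or (u : unitInterval) : tent u = 1 ∨ (expand u = 0 ∨ expand u = 1) := by
  rcases le_total (u : ℝ) (1 / 2) with h | h
  · exact Or.inr (Or.inl (clamp_eq_zero (by linarith)))
  · rcases le_total (3 / 4) (u : ℝ) with h' | h'
    · exact Or.inr (Or.inr (clamp_eq_one (by linarith)))
    · exact Or.inl (clamp_eq_one (le_min (by linarith) (by linarith)))

@[simp] theorem tent_zero : tent 0 = 0 := clamp_eq_zero (min_le_of_left_le (by simp))
@[simp] theorem tent_one : tent 1 = 0 := clamp_eq_zero (min_le_of_right_le (by simp))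
@[simp] theorem expand_zero : expand 0 = 0 := clamp_eq_zero (by simp)
@[simp] theorem expand_one : expand 1 = 1 := clamp_eq_one (by norm_num)

theorem tent_leftHalf (u : unitInterval) : tent (leftHalf u) = u := by
  have := u.2.1; have := u.2.2
  refine clamp_eq ?_
  rw [coe_leftHalf, min_eq_left (by linarith)]; ring

theorem expand_leftHalf (u : unitInterval) : expand (leftHalf u) = 0 := by
  have := u.2.1; have := u.2.2
  exact clamp_eq_zero (by rw [coe_leftHalf]; linarith)

theorem tent_middle (u : unitInterval) : tent (rightHalf (leftHalf u)) = 1 := by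
  have := u.2.1; have := u.2.2
  refine clamp_eq_one ?_
  rw [coe_rightHalf, coe_leftHalf]
  exact le_min (by linarith) (by linarith)

theorem expand_middle (u : unitInterval) : expand (rightHalf (leftHalf u)) = u := by
  refine clamp_eq ?_
  rw [coe_rightHalf, coe_leftHalf]; ring

theorem tent_right (u : unitInterval) :
    tent (rightHalf (rightHalf u)) = unitInterval.symm u := by
  have := u.2.1; have := u.2.2
  refine clamp_eq ?_
  rw [coe_rightHalf, coe_rightHalf, min_eq_right (by linarith), unitInterval.coe_symm_eq]; ring

theorem expand_right (u : unitInterval) : expand (rightHalf (rightHalf u)) = 1 := by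
  have := u.2.1; have := u.2.2
  refine clamp_eq_one ?_
  rw [coe_rightHalf, coe_rightHalf]; linarith

/-- The height of the map that wraps the cube around the sides in `S`. -/
def height (S : Finset (Fin k)) : C(Cube k, unitInterval) :=
  ⟨fun z => ∏ i ∈ S, tent (z i), by fun_prop⟩

/-- The horizontal component of the map that wraps the cube around the sides in `S`. -/
def expandOn (S : Finset (Fin k)) : C(Cube k, Cube k) :=
  ⟨fun z i => if i ∈ S then expand (z i) else z i, by
    refine continuous_pi fun i => ?_
    split_ifs <;> fun_prop⟩

theorem expandOn_of_boundary (S : Finset (Fin k)) {z : Cube k} {i : Fin k}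
    (h : z i = 0 ∨ z i = 1) : expandOn S z i = z i := by
  change (if i ∈ S then expand (z i) else z i) = z i
  split_ifs
  · rcases h with h | h <;> rw [h] <;> simp
  · rfl

theorem height_eq_zero {S : Finset (Fin k)} {z : Cube k} {i : Fin k} (hi : i ∈ S)
    (h : z i = 0 ∨ z i = 1) : height S z = 0 :=
  Finset.prod_eq_zero hi (by rcases h with h | h <;> rw [h] <;> simp)

theorem height_eq_one_or (S : Finset (Fin k)) (z : Cube k) :
    height S z = 1 ∨ ∃ i ∈ S, expandOn S z i = 0 ∨ expandOn S z i = 1 := by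
  by_cases h : ∀ i ∈ S, tent (z i) = 1
  · exact Or.inl (Finset.prod_eq_one h)
  · push Not at h
    obtain ⟨i, hi, h⟩ := h
    refine Or.inr ⟨i, hi, ?_⟩
    change (if i ∈ S then expand (z i) else z i) = 0 ∨ (if i ∈ S then expand (z i) else z i) = 1
    rw [if_pos hi]
    exact (tent_eq_one_or (z i)).resolve_left h

theorem height_update {S : Finset (Fin k)} {j : Fin k} (hj : j ∉ S) (z : Cube k)
    (u : unitInterval) : height S (Function.update z j u) = height S z :=
  Finset.prod_congr rfl fun i hi => by
    rw [Function.update_of_ne (by rintro rfl; exact hj hi)]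

theorem expandOn_insert_update {S : Finset (Fin k)} {j : Fin k} (hj : j ∉ S) (z : Cube k)
    (u : unitInterval) : expandOn (insert j S) (Function.update z j u) =
      Function.update (expandOn S z) j (expand u) := by
  funext i
  change (if i ∈ insert j S then expand (Function.update z j u i) else Function.update z j u i) = _
  rcases eq_or_ne i j with rfl | h
  · simp
  · simp only [Function.update_of_ne h, Finset.mem_insert, h, false_or]; rfl

theorem height_insert_update {S : Finset (Fin k)} {j : Fin k} (hj : j ∉ S) (z : Cube k)
    (u : unitInterval) : height (insert j S) (Function.update z j u) = tent u * height S z := by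
  change ∏ i ∈ insert j S, _ = _
  rw [Finset.prod_insert hj, Function.update_self]
  exact congrArg (tent u * ·) (height_update hj z u)

/-- The map that wraps the cube around the sides in `S`. -/
def wrap (S : Finset (Fin k)) : C(Cube k, unitInterval × Cube k) :=
  ⟨fun z => (height S z, expandOn S z), by fun_prop⟩

/-- The boundary is wrapped into faces of codimension two. If `z i` is an end point and `i ∈ S`, the
height is zero and the point lies on the edge of the bottom. If `i ∉ S`, the point lies on the side
`i` and also on the top or on another side. -/
theorem wrap_boundary {M : C(unitInterval × Cube k, Z)}
    (h1 : ∀ t, (t = 0 ∨ t = 1) → ∀ y ∈ Cube.boundary (Fin k), M (t, y) ∈ B)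
    (h2 : ∀ t y i j, i ≠ j → (y i = 0 ∨ y i = 1) → (y j = 0 ∨ y j = 1) → M (t, y) ∈ B)
    (S : Finset (Fin k)) {z : Cube k} (hz : z ∈ Cube.boundary (Fin k)) : M (wrap S z) ∈ B := by
  obtain ⟨i, hi⟩ := hz
  have hi' : expandOn S z i = 0 ∨ expandOn S z i = 1 := by rwa [expandOn_of_boundary S hi]
  by_cases hS : i ∈ S
  · exact h1 _ (Or.inl (height_eq_zero hS hi)) _ ⟨i, hi'⟩
  · rcases height_eq_one_or S z with h | ⟨l, hl, h⟩
    · exact h1 _ (Or.inr h) _ ⟨i, hi'⟩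
    · exact h2 _ _ i l (by rintro rfl; exact hS hl) hi' h

/-- The wrapped cube meets the side `j` in a distorted parametrisation. The distortion is undone in
two stages, through `K`: first the horizontal coordinates are expanded, then the height is scaled.
Boundary points remain in faces of codimension two in both stages. -/
theorem comp_sideMap_eq (hF : CubeFunctional i₀ B F) {M : C(unitInterval × Cube k, Z)}
    (h1 : ∀ t, (t = 0 ∨ t = 1) → ∀ y ∈ Cube.boundary (Fin k), M (t, y) ∈ B)
    (h2 : ∀ t y i j, i ≠ j → (y i = 0 ∨ y i = 1) → (y j = 0 ∨ y j = 1) → M (t, y) ∈ B)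
    {j : Fin k} {ε : unitInterval} (hε : ε = 0 ∨ ε = 1) {S : Finset (Fin k)}
    (hj : j ∉ S) (m : C(Cube k, Z))
    (hm : ∀ z, m z = M (z j * height S z, Function.update (expandOn S z) j ε)) :
    F (M.comp (sideMap j ε)) = F m := by
  let K : C(Cube k, Z) := ⟨fun z => M (z j, Function.update (expandOn S z) j ε), by
    have := (expandOn S).continuous.update j (continuous_const (y := ε))
    fun_prop⟩
  trans F K
  · refine hF.homotopy_eq ⟨fun p => M (p.2 j, Function.update
      (fun i => lerp p.1 (p.2 i) (expandOn S p.2 i)) j ε), ?_⟩ ?_ (fun y => ?_) (fun y => ?_)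
    · have : Continuous fun p : unitInterval × Cube k =>
          fun i => lerp p.1 (p.2 i) (expandOn S p.2 i) := by fun_prop
      have := this.update j (continuous_const (y := ε))
      fun_prop
    · rintro t y ⟨i, hi⟩
      rcases eq_or_ne i j with rfl | h
      · exact h1 _ hi _ ⟨i, by simpa using hε⟩
      · refine h2 _ _ i j h ?_ (by simpa using hε)
        rwa [Function.update_of_ne h, expandOn_of_boundary S hi, lerp_self]
    · simp [sideMap]
    · simp [K]
  · refine hF.homotopy_eq ⟨fun p => M (lerp p.1 (p.2 j) (p.2 j * height S p.2), Function.update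
      (expandOn S p.2) j ε), ?_⟩ ?_ (fun y => ?_) (fun y => ?_)
    · have : Continuous fun p : unitInterval × Cube k => expandOn S p.2 := by fun_prop
      have := this.update j (continuous_const (y := ε))
      fun_prop
    · rintro t y ⟨i, hi⟩
      rcases eq_or_ne i j with rfl | h
      · rcases hi with hi | hi
        · exact h1 _ (Or.inl (by simp [hi])) _ ⟨i, by simpa using hε⟩
        · rcases height_eq_one_or S y with h | ⟨l, hlS, h⟩
          · exact h1 _ (Or.inr (by simp [hi, h])) _ ⟨i, by simpa using hε⟩
          · have hli : l ≠ i := by rintro rfl; exact hj hlS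
            exact h2 _ _ l i hli (by rwa [Function.update_of_ne hli]) (by simpa using hε)
      · refine h2 _ _ i j h ?_ (by simpa using hε)
        rwa [Function.update_of_ne h, expandOn_of_boundary S hi]
    · simp [K]
    · simp [hm]

/-- The opposite side is run through downwards, so a reflection and hence a sign intervene. -/
theorem comp_sideMap_one (hF : CubeFunctional i₀ B F) {M : C(unitInterval × Cube k, Z)}
    (h1 : ∀ t, (t = 0 ∨ t = 1) → ∀ y ∈ Cube.boundary (Fin k), M (t, y) ∈ B)
    (h2 : ∀ t y i j, i ≠ j → (y i = 0 ∨ y i = 1) → (y j = 0 ∨ y j = 1) → M (t, y) ∈ B)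
    {j : Fin k} {S : Finset (Fin k)} (hj : j ∉ S) (m : C(Cube k, Z))
    (hm : ∀ z, m z =
      M (unitInterval.symm (z j) * height S z, Function.update (expandOn S z) j 1)) :
    F m = - F (M.comp (sideMap j 1)) := by
  have hr (z : Cube k) : coordMap j reflection z = Function.update z j (unitInterval.symm (z j)) :=
    rfl
  rw [hF.comp_sideMap_eq h1 h2 (Or.inr rfl) hj (m.comp (coordMap j reflection)),
    hF.coordMap_reflection, neg_neg]
  · rintro z ⟨i, hi⟩
    rw [hm]
    rcases eq_or_ne i j with rfl | h
    · rcases hi with hi | hi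
      · rcases height_eq_one_or S z with h | ⟨l, hlS, h⟩
        · exact h1 _ (Or.inr (by simp [hi, h])) _ ⟨i, by simp⟩
        · have hli : l ≠ i := by rintro rfl; exact hj hlS
          exact h2 _ _ l i hli (by rwa [Function.update_of_ne hli]) (by simp)
      · exact h1 _ (Or.inl (by simp [hi])) _ ⟨i, by simp⟩
    · refine h2 _ _ i j h ?_ (by simp)
      rwa [Function.update_of_ne h, expandOn_of_boundary S hi]
  · intro z
    rw [ContinuousMap.comp_apply, hm, hr, height_update hj, Function.update_self,
      unitInterval.symm_symm]
    congr 2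
    funext i
    rcases eq_or_ne i j with rfl | h
    · simp
    · simp [expandOn, h]

/-- Cutting in the direction `j` at `1/2` and at `3/4` leaves three pieces: the side `0` traversed
upwards, the cube wrapped around `S` only, and the side `1` traversed downwards, which counts
negatively. -/
theorem wrap_insert (hF : CubeFunctional i₀ B F) {M : C(unitInterval × Cube k, Z)}
    (h1 : ∀ t, (t = 0 ∨ t = 1) → ∀ y ∈ Cube.boundary (Fin k), M (t, y) ∈ B)
    (h2 : ∀ t y i j, i ≠ j → (y i = 0 ∨ y i = 1) → (y j = 0 ∨ y j = 1) → M (t, y) ∈ B)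
    {j : Fin k} {S : Finset (Fin k)} (hj : j ∉ S) :
    F (M.comp (wrap (insert j S))) = F (M.comp (wrap S)) +
      (F (M.comp (sideMap j 0)) - F (M.comp (sideMap j 1))) := by
  have hwrap (z : Cube k) (u : unitInterval) : wrap (insert j S) (Function.update z j u) =
      (tent u * height S z, Function.update (expandOn S z) j (expand u)) :=
    Prod.ext (height_insert_update hj z u) (expandOn_insert_update hj z u)
  -- The two cuts lie in faces of codimension two: on the side `j`, and in addition on the top or on
  -- a side in `S`.
  have hwall (z : Cube k) (u : unitInterval) (ht : tent u = 1) (hu : expand u = 0 ∨ expand u = 1) :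
      M (wrap (insert j S) (Function.update z j u)) ∈ B := by
    rw [hwrap, ht, one_mul]
    rcases height_eq_one_or S z with h | ⟨l, hl, h⟩
    · exact h1 _ (Or.inr h) _ ⟨j, by simpa using hu⟩
    · have hlj : l ≠ j := by rintro rfl; exact hj hl
      exact h2 _ _ l j hlj (by rwa [Function.update_of_ne hlj]) (by simpa using hu)
  have hc (φ : C(unitInterval, unitInterval)) (z : Cube k) :
      coordMap j φ z = Function.update z j (φ (z j)) := rfl
  have hbd : ∀ y ∈ Cube.boundary (Fin k), M.comp (wrap (insert j S)) y ∈ B :=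
    fun y hy => wrap_boundary h1 h2 _ hy
  have ht2 (u : unitInterval) (hu : (u : ℝ) = 1 / 2) : tent u = 1 ∧ expand u = 0 :=
    ⟨clamp_eq_one (by rw [hu]; norm_num), clamp_eq_zero (by rw [hu]; norm_num)⟩
  have hright0 : ((rightHalf 0 : unitInterval) : ℝ) = 1 / 2 := by simp
  have hright1 : rightHalf 1 = 1 := by ext; simp
  rw [hF.split_at j _ hbd, hF.split_at j ((M.comp (wrap (insert j S))).comp (coordMap j rightHalf)),
    ← hF.comp_sideMap_eq h1 h2 (Or.inl rfl) hj
      ((M.comp (wrap (insert j S))).comp (coordMap j leftHalf)),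
    hF.comp_sideMap_one h1 h2 hj
      (((M.comp (wrap (insert j S))).comp (coordMap j rightHalf)).comp (coordMap j rightHalf))]
  · have e : ((M.comp (wrap (insert j S))).comp (coordMap j rightHalf)).comp
        (coordMap j leftHalf) = M.comp (wrap S) := by
      ext1 z
      simp only [ContinuousMap.comp_apply, hc, Function.update_self, Function.update_idem, hwrap,
        tent_middle, expand_middle, one_mul]
      congr 2
      refine Function.update_eq_iff.2 ⟨?_, fun i _ => rfl⟩
      simp [expandOn, hj]
    rw [e]; abel
  · intro z
    simp only [ContinuousMap.comp_apply, hc, Function.update_self, Function.update_idem, hwrap,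
        tent_right, expand_right]
  · intro z
    simp only [ContinuousMap.comp_apply, hc, hwrap, tent_leftHalf, expand_leftHalf]
  · rintro z ⟨i, hi⟩
    rw [ContinuousMap.comp_apply, hc]
    rcases eq_or_ne i j with rfl | h
    · rcases hi with hi | hi
      · rw [hi]
        exact hwall _ _ (ht2 _ hright0).1 (Or.inl (ht2 _ hright0).2)
      · rw [hi, hright1]
        exact hbd _ ⟨i, by simp⟩
    · exact hbd _ ⟨i, by simpa [h] using hi⟩
  · intro z hz
    rw [ContinuousMap.comp_apply, hc]
    refine hwall _ _ (clamp_eq_one ?_) (Or.inr (clamp_eq_one ?_)) <;> rw [coe_rightHalf, hz] <;>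
      norm_num
  · intro z hz
    rw [← Function.update_eq_self j z]
    exact hwall _ _ (ht2 _ hz).1 (Or.inl (ht2 _ hz).2)

/-- The homotopy addition theorem for cubes: if the faces of codimension two of `I × Iᵏ` are
mapped to `B`, then the alternating sum of the faces of codimension one vanishes. -/
theorem sum_faces (hF : CubeFunctional i₀ B F) {M : C(unitInterval × Cube k, Z)}
    (h1 : ∀ t, (t = 0 ∨ t = 1) → ∀ y ∈ Cube.boundary (Fin k), M (t, y) ∈ B)
    (h2 : ∀ t y i j, i ≠ j → (y i = 0 ∨ y i = 1) → (y j = 0 ∨ y j = 1) → M (t, y) ∈ B) :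
    F (M.comp (endMap k 0)) = F (M.comp (endMap k 1)) +
      ∑ j, (F (M.comp (sideMap j 0)) - F (M.comp (sideMap j 1))) := by
  -- Wrapping around no side gives the top face, and each further side contributes its two opposite
  -- faces.
  have key (S : Finset (Fin k)) : F (M.comp (wrap S)) = F (M.comp (endMap k 1)) +
      ∑ j ∈ S, (F (M.comp (sideMap j 0)) - F (M.comp (sideMap j 1))) := by
    induction S using Finset.induction_on with
    | empty =>
      have : wrap ∅ = endMap k 1 := by
        ext1 z
        exact Prod.ext (Finset.prod_empty (f := fun i => tent (z i))) rfl
      rw [this, Finset.sum_empty, add_zero]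
    | insert j S hj ih =>
      rw [hF.wrap_insert h1 h2 hj, ih, Finset.sum_insert hj]; abel
  rw [← key]
  -- Once all sides are wrapped, the height vanishes on the whole boundary and can be scaled down to
  -- `0`. What is left is the bottom face, up to stretching its coordinates.
  trans F (M.comp ⟨fun z => (0, expandOn Finset.univ z), by fun_prop⟩)
  · refine hF.homotopy_eq ⟨fun p => M (0, fun i => lerp p.1 (p.2 i) (expandOn Finset.univ p.2 i)),
      by fun_prop⟩ ?_ (fun y => ?_) (fun y => ?_)
    · rintro t y ⟨i, hi⟩
      exact h1 _ (Or.inl rfl) _ ⟨i, by simpa only [expandOn_of_boundary _ hi, lerp_self] using hi⟩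
    · simp [endMap]
    · simp
  · refine hF.homotopy_eq ⟨fun p => M (p.1 * height Finset.univ p.2, expandOn Finset.univ p.2),
      by fun_prop⟩ ?_ (fun y => ?_) (fun y => ?_)
    · rintro t y ⟨i, hi⟩
      refine h1 _ (Or.inl ?_) _ ⟨i, by rwa [expandOn_of_boundary _ hi]⟩
      rw [height_eq_zero (Finset.mem_univ i) hi, mul_zero]
    · simp
    · simp [wrap]

end CubeFunctional

/-! ### The collapse of a cube onto a simplex -/

theorem faceMap_apply_succAbove {n : ℕ} (i : Fin (n + 2)) (t : Simplex n) (l : Fin (n + 1)) :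
    faceMap n i t (i.succAbove l) = t l := by
  change FunOnFinite.linearMap ℝ ℝ i.succAbove t _ = _
  rw [FunOnFinite.linearMap_apply_apply, Finset.sum_eq_single l]
  · intro b hb hbl
    exact (hbl (Fin.succAbove_right_injective (Finset.mem_filter.1 hb).2)).elim
  · simp

theorem faceMap_apply_self {n : ℕ} (i : Fin (n + 2)) (t : Simplex n) :
    faceMap n i t i = 0 := by
  change FunOnFinite.linearMap ℝ ℝ i.succAbove t _ = _
  rw [FunOnFinite.linearMap_apply_apply]
  exact Finset.sum_eq_zero fun b hb => (Fin.succAbove_ne _ _ (Finset.mem_filter.1 hb).2).elim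

/-- The minimum of `1` and the first `j` coordinates of a point of the cube, where the coordinates
beyond the last one are `0` by convention. -/
def prefixMin {k : ℕ} (y : Cube k) : ℕ → ℝ
  | 0 => 1
  | j + 1 => min (prefixMin y j) (if h : j < k then y ⟨j, h⟩ else 0)

section prefixMin

variable {k : ℕ}

theorem prefixMin_zero (y : Cube k) : prefixMin y 0 = 1 := rfl

theorem prefixMin_succ_of_lt (y : Cube k) {j : ℕ} (h : j < k) :
    prefixMin y (j + 1) = min (prefixMin y j) (y ⟨j, h⟩) := by simp [prefixMin, h]

theorem prefixMin_succ (y : Cube k) (j : Fin k) :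
    prefixMin y (j + 1) = min (prefixMin y j) (y j) := prefixMin_succ_of_lt y j.2

theorem prefixMin_nonneg (y : Cube k) (j : ℕ) : 0 ≤ prefixMin y j := by
  induction j with
  | zero => exact zero_le_one
  | succ j ih =>
    refine le_min ih ?_
    split_ifs with h
    · exact (y _).2.1
    · exact le_rfl

theorem prefixMin_succ_le (y : Cube k) (j : ℕ) : prefixMin y (j + 1) ≤ prefixMin y j :=
  min_le_left _ _

theorem prefixMin_antitone (y : Cube k) : Antitone (prefixMin y) :=
  antitone_nat_of_succ_le (prefixMin_succ_le y)

theorem prefixMin_le_one (y : Cube k) (j : ℕ) : prefixMin y j ≤ 1 :=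
  prefixMin_antitone y (Nat.zero_le j)

theorem prefixMin_last (y : Cube k) : prefixMin y (k + 1) = 0 := by
  simp [prefixMin, prefixMin_nonneg]

@[fun_prop]
theorem continuous_prefixMin (j : ℕ) : Continuous fun y : Cube k => prefixMin y j := by
  induction j with
  | zero => exact continuous_const
  | succ j ih =>
    by_cases h : j < k
    · simp only [prefixMin_succ_of_lt _ h]; fun_prop
    · simp only [prefixMin, h, dite_false]; fun_prop

theorem prefixMin_eq_zero {y : Cube k} {i : Fin k} (h : y i = 0) {j : ℕ} (hj : (i : ℕ) < j) :
    prefixMin y j = 0 := by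
  refine le_antisymm ((prefixMin_antitone y hj).trans ?_) (prefixMin_nonneg _ _)
  rw [Nat.succ_eq_add_one, prefixMin_succ, h]
  exact min_le_right _ _

end prefixMin

/-- The collapse of the cube onto the simplex which is the identity on the simplex
`y₀ ≥ y₁ ≥ … ≥ yₖ₋₁` of the standard triangulation. -/
def cubeToSimplex (k : ℕ) : C(Cube k, Simplex k) where
  toFun y := ⟨fun j => prefixMin y j - prefixMin y (j + 1),
    fun j => sub_nonneg.2 (prefixMin_succ_le y j), by
      rw [Fin.sum_univ_eq_sum_range (fun j => prefixMin y j - prefixMin y (j + 1)),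
        Finset.sum_range_sub', prefixMin_last, prefixMin_zero, sub_zero]⟩
  continuous_toFun := by fun_prop

theorem cubeToSimplex_apply {k : ℕ} (y : Cube k) (j : Fin (k + 1)) :
    cubeToSimplex k y j = prefixMin y j - prefixMin y (j + 1) := rfl

theorem cubeToSimplex_of_eq_one {k : ℕ} {y : Cube k} {i : Fin k} (h : y i = 1) :
    cubeToSimplex k y i.castSucc = 0 := by
  rw [cubeToSimplex_apply, Fin.val_castSucc, prefixMin_succ, h, min_eq_left, sub_self]
  exact prefixMin_le_one _ _

theorem cubeToSimplex_of_eq_zero {k : ℕ} {y : Cube k} {i : Fin k} (h : y i = 0)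
    {j : Fin (k + 1)} (hj : i.castSucc < j) : cubeToSimplex k y j = 0 := by
  have hj' : (i : ℕ) < j := hj
  rw [cubeToSimplex_apply, prefixMin_eq_zero h hj',
    prefixMin_eq_zero h (hj'.trans (Nat.lt_succ_self _)), sub_self]

theorem cubeToSimplex_boundary {k : ℕ} {y : Cube k} (hy : y ∈ Cube.boundary (Fin k)) :
    ∃ j, cubeToSimplex k y j = 0 := by
  obtain ⟨i, hi | hi⟩ := hy
  · exact ⟨Fin.last k, cubeToSimplex_of_eq_zero hi (Fin.castSucc_lt_last i)⟩
  · exact ⟨_, cubeToSimplex_of_eq_one hi⟩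

theorem cubeToSimplex_zero (k : ℕ) : cubeToSimplex k 0 = e0 k := by
  ext j
  rw [cubeToSimplex_apply]
  change _ = (Pi.single 0 1 : Fin (k + 1) → ℝ) j
  have hz (l : ℕ) : prefixMin (0 : Cube k) (l + 1) = 0 := by
    cases k with
    | zero => simp [prefixMin, prefixMin_nonneg]
    | succ k => exact prefixMin_eq_zero (i := 0) rfl (Nat.succ_pos _)
  induction j using Fin.cases with
  | zero => simp [hz, prefixMin_zero]
  | succ j => simp [hz]

/-- A coordinate equal to `1` never lowers a minimum, so inserting it only shifts the later indices.
-/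
theorem prefixMin_insertNth_one {k : ℕ} (y : Cube k) (i : Fin (k + 1)) (j : ℕ) :
    prefixMin (i.insertNth (α := fun _ => unitInterval) 1 y) j =
      if j ≤ i then prefixMin y j else prefixMin y (j - 1) := by
  induction j with
  | zero => simp [prefixMin_zero]
  | succ j ih =>
    rcases lt_trichotomy j i with h | h | h
    · have hk : j < k := by omega
      have hj : (⟨j, by omega⟩ : Fin (k + 1)) = i.succAbove ⟨j, hk⟩ := by
        rw [Fin.succAbove_of_castSucc_lt]
        · rfl
        · exact h
      rw [prefixMin_succ_of_lt _ (by omega : j < k + 1), ih, if_pos h.le, if_pos (Nat.succ_le_of_lt h),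
        prefixMin_succ_of_lt _ hk, hj, Fin.insertNth_apply_succAbove]
    · subst h
      rw [prefixMin_succ, ih, if_pos le_rfl, if_neg (by omega), Fin.insertNth_apply_same]
      exact min_eq_left (prefixMin_le_one _ _)
    · rw [if_neg (by omega)] at ih
      rw [if_neg (by omega), Nat.add_sub_cancel]
      obtain ⟨j, rfl⟩ : ∃ l, j = l + 1 := ⟨j - 1, by omega⟩
      rw [Nat.add_sub_cancel] at ih
      by_cases hk : j < k
      · have hj : (⟨j + 1, by omega⟩ : Fin (k + 1)) = i.succAbove ⟨j, hk⟩ := by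
          rw [Fin.succAbove_of_le_castSucc]
          · rfl
          · exact Nat.lt_succ_iff.1 h
        rw [prefixMin_succ_of_lt _ (by omega : j + 1 < k + 1), ih, prefixMin_succ_of_lt _ hk, hj,
          Fin.insertNth_apply_succAbove]
      · simp only [prefixMin] at ih ⊢
        rw [ih]
        simp [hk]

theorem prefixMin_insertNth_zero {k : ℕ} (y : Cube k) {j : ℕ} (hj : j ≤ k) :
    prefixMin ((Fin.last k).insertNth (α := fun _ => unitInterval) 0 y) j = prefixMin y j := by
  induction j with
  | zero => rfl
  | succ j ih =>
    have hj' : (⟨j, by omega⟩ : Fin (k + 1)) = (Fin.last k).succAbove ⟨j, hj⟩ := by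
      rw [Fin.succAbove_last]; rfl
    rw [prefixMin_succ_of_lt _ (by omega : j < k + 1), ih (by omega), prefixMin_succ_of_lt _ hj,
      hj', Fin.insertNth_apply_succAbove]

/-- Each face on which some coordinate is `1` collapses onto a facet, and so does the face on which
the last coordinate is `0`. The other faces drop into codimension two, so every facet of the simplex
comes from exactly one face of the cube. -/
theorem cubeToSimplex_insertNth_one {k : ℕ} (y : Cube k) (i : Fin (k + 1)) :
    cubeToSimplex (k + 1) (i.insertNth (α := fun _ => unitInterval) 1 y) =
      faceMap k i.castSucc (cubeToSimplex k y) := by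
  ext l
  rcases Fin.eq_self_or_eq_succAbove i.castSucc l with rfl | ⟨l, rfl⟩
  · rw [faceMap_apply_self]
    exact cubeToSimplex_of_eq_one (Fin.insertNth_apply_same _ _ _)
  · rw [faceMap_apply_succAbove, cubeToSimplex_apply, cubeToSimplex_apply, prefixMin_insertNth_one,
      prefixMin_insertNth_one]
    rcases lt_or_ge l.castSucc i.castSucc with h | h
    · have h' : (l : ℕ) < i := h
      rw [Fin.succAbove_of_castSucc_lt _ _ h, Fin.val_castSucc, if_pos h'.le,
        if_pos (Nat.succ_le_of_lt h')]
    · have h' : (i : ℕ) ≤ l := h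
      rw [Fin.succAbove_of_le_castSucc _ _ h, Fin.val_succ, if_neg (by omega), if_neg (by omega)]
      rfl

theorem cubeToSimplex_insertNth_zero {k : ℕ} (y : Cube k) :
    cubeToSimplex (k + 1) ((Fin.last k).insertNth (α := fun _ => unitInterval) 0 y) =
      faceMap k (Fin.last (k + 1)) (cubeToSimplex k y) := by
  ext l
  rcases Fin.eq_self_or_eq_succAbove (Fin.last (k + 1)) l with rfl | ⟨l, rfl⟩
  · rw [faceMap_apply_self]
    exact cubeToSimplex_of_eq_zero (i := Fin.last k) (Fin.insertNth_apply_same _ _ _)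
      (Fin.castSucc_lt_last _)
  · rw [faceMap_apply_succAbove, cubeToSimplex_apply, cubeToSimplex_apply, Fin.succAbove_last,
      Fin.val_castSucc, prefixMin_insertNth_zero y (by omega)]
    rcases Nat.lt_succ_iff_lt_or_eq.1 l.2 with h | h
    · rw [prefixMin_insertNth_zero y (by omega)]
    · rw [h, prefixMin_last, prefixMin_eq_zero (i := Fin.last k) (Fin.insertNth_apply_same _ _ _)
        (by simp)]

/-- The set of points of a simplex with at least two vanishing coordinates. -/
def codimTwo (n : ℕ) : Set (Simplex n) := {t | ∃ i j, i ≠ j ∧ t i = 0 ∧ t j = 0}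

theorem cubeToSimplex_mem_codimTwo {k : ℕ} {y : Cube k} {i j : Fin k} (hij : i ≠ j)
    (hi : y i = 0 ∨ y i = 1) (hj : y j = 0 ∨ y j = 1) : cubeToSimplex k y ∈ codimTwo k := by
  wlog h : i < j generalizing i j
  · exact this hij.symm hj hi (lt_of_le_of_ne (not_lt.1 h) hij.symm)
  rcases hi with hi | hi
  · exact ⟨j.castSucc, Fin.last k, (Fin.castSucc_lt_last j).ne,
      cubeToSimplex_of_eq_zero hi (Fin.castSucc_lt_castSucc_iff.2 h),
      cubeToSimplex_of_eq_zero hi (Fin.castSucc_lt_last i)⟩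
  · rcases hj with hj | hj
    · exact ⟨i.castSucc, Fin.last k, (Fin.castSucc_lt_last i).ne, cubeToSimplex_of_eq_one hi,
        cubeToSimplex_of_eq_zero hj (Fin.castSucc_lt_last j)⟩
    · exact ⟨i.castSucc, j.castSucc, (Fin.castSucc_lt_castSucc_iff.2 h).ne,
        cubeToSimplex_of_eq_one hi, cubeToSimplex_of_eq_one hj⟩

theorem faceMap_mem_codimTwo {n : ℕ} (i : Fin (n + 2)) {t : Simplex n} (ht : ∃ j, t j = 0) :
    faceMap n i t ∈ codimTwo (n + 1) := by
  obtain ⟨j, hj⟩ := ht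
  exact ⟨i, i.succAbove j, (Fin.succAbove_ne i j).symm, faceMap_apply_self i t,
    by rw [faceMap_apply_succAbove, hj]⟩

/-- `sideMap` moves the `j`-th coordinate to the front. Comparison with the standard face inclusion
costs a cycle, whose sign supplies the alternating signs in the boundary of a simplex. -/
theorem cons_update_eq_insertNth {k : ℕ} (z : Cube (k + 1)) (j : Fin (k + 1)) (ε : unitInterval) :
    (Fin.cons (z j) (Function.update z j ε) : Cube (k + 2)) =
      j.succ.insertNth (α := fun _ => unitInterval) ε (permMap j.cycleRange.symm z) := by
  rw [Fin.eq_insertNth_iff]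
  refine ⟨by simp, ?_⟩
  funext l
  change (Fin.cons (z j) (Function.update z j ε) : Cube (k + 2)) (j.succ.succAbove l) =
    z (j.cycleRange.symm l)
  induction l using Fin.cases with
  | zero => simp
  | succ l => simp

namespace CubeFunctional

variable {k : ℕ} {i₀ : Fin (k + 1)} {G : Type*} [AddCommGroup G]
  {F : C(Cube (k + 1), Simplex (k + 2)) → G}

/-- The homotopy addition theorem for simplices. -/
theorem sum_simplex_faces (hF : CubeFunctional i₀ (codimTwo (k + 2)) F) :
    ∑ i : Fin (k + 3), ((-1 : ℤ) ^ (i : ℕ)) •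
      F ((faceMap (k + 1) i).comp (cubeToSimplex (k + 1))) = 0 := by
  let M : C(unitInterval × Cube (k + 1), Simplex (k + 2)) :=
    ⟨fun p => cubeToSimplex (k + 2) (Fin.cons p.1 p.2), by fun_prop⟩
  have hface (i : Fin (k + 3)) : ∀ y ∈ Cube.boundary (Fin (k + 1)),
      (faceMap (k + 1) i).comp (cubeToSimplex (k + 1)) y ∈ codimTwo (k + 2) :=
    fun y hy => faceMap_mem_codimTwo i (cubeToSimplex_boundary hy)
  have h := hF.sum_faces (M := M)
    (by
      rintro t ht y ⟨i, hi⟩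
      exact cubeToSimplex_mem_codimTwo (i := 0) (j := i.succ) (Fin.succ_ne_zero i).symm
        (by simpa using ht) (by simpa using hi))
    (by
      intro t y i j hij hi hj
      exact cubeToSimplex_mem_codimTwo (i := i.succ) (j := j.succ) (by simpa using hij)
        (by simpa using hi) (by simpa using hj))
  have e0 : F (M.comp (endMap (k + 1) 0)) = 0 := by
    refine hF.eq_zero _ fun y => ⟨1, Fin.last _, ?_, cubeToSimplex_of_eq_zero (i := 0) ?_ ?_,
      cubeToSimplex_of_eq_zero (i := 0) ?_ ?_⟩
    · simp [Fin.ext_iff]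
    · simp [endMap]
    · simp
    · simp [endMap]
    · simp [Fin.lt_def]
  have e1 : M.comp (endMap (k + 1) 1) = (faceMap (k + 1) 0).comp (cubeToSimplex (k + 1)) := by
    ext1 y
    change cubeToSimplex (k + 2) (Fin.cons 1 y) = _
    have := cubeToSimplex_insertNth_one y 0
    rwa [Fin.insertNth_zero'] at this
  have hs (j : Fin (k + 1)) (ε : unitInterval) (z : Cube (k + 1)) : M (sideMap j ε z) =
      cubeToSimplex (k + 2) (j.succ.insertNth (α := fun _ => unitInterval) ε
        (permMap j.cycleRange.symm z)) := by
    rw [← cons_update_eq_insertNth]; rfl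
  have es1 (j : Fin (k + 1)) : F (M.comp (sideMap j 1)) = ((-1 : ℤ) ^ (j : ℕ)) •
      F ((faceMap (k + 1) j.succ.castSucc).comp (cubeToSimplex (k + 1))) := by
    have : M.comp (sideMap j 1) = ((faceMap (k + 1) j.succ.castSucc).comp
        (cubeToSimplex (k + 1))).comp (permMap j.cycleRange.symm) := by
      ext1 z
      rw [ContinuousMap.comp_apply, hs, cubeToSimplex_insertNth_one]; rfl
    rw [this, hF.comp_permMap _ (hface _), Equiv.Perm.sign_symm, Fin.sign_cycleRange]
    simp
  -- A vanishing coordinate before the last one kills at least the last two barycentric coordinates.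
  have es0 (j : Fin (k + 1)) (hj : j ≠ Fin.last k) : F (M.comp (sideMap j 0)) = 0 := by
    have hj' := Fin.val_lt_last hj
    refine hF.eq_zero _ fun y => ⟨(Fin.last _).castSucc, Fin.last _, ?_,
      cubeToSimplex_of_eq_zero (i := j.succ) ?_ ?_, cubeToSimplex_of_eq_zero (i := j.succ) ?_ ?_⟩
    · exact (Fin.castSucc_lt_last _).ne
    · simp [sideMap]
    · rw [Fin.lt_def]; simp; omega
    · simp [sideMap]
    · rw [Fin.lt_def]; simp; omega
  have es0' : F (M.comp (sideMap (Fin.last k) 0)) = ((-1 : ℤ) ^ k) •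
      F ((faceMap (k + 1) (Fin.last _)).comp (cubeToSimplex (k + 1))) := by
    have : M.comp (sideMap (Fin.last k) 0) = ((faceMap (k + 1) (Fin.last _)).comp
        (cubeToSimplex (k + 1))).comp (permMap (Fin.last k).cycleRange.symm) := by
      ext1 z
      rw [ContinuousMap.comp_apply, hs, Fin.succ_last, cubeToSimplex_insertNth_zero]; rfl
    rw [this, hF.comp_permMap _ (hface _), Equiv.Perm.sign_symm, Fin.sign_cycleRange]
    simp
  rw [e0, e1, Finset.sum_sub_distrib, Finset.sum_eq_single_of_mem (Fin.last k) (Finset.mem_univ _)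
    (fun j _ hj => es0 j hj), es0'] at h
  simp only [es1] at h
  rw [Fin.sum_univ_castSucc, Fin.sum_univ_succ, h]
  simp only [Fin.val_castSucc, Fin.val_succ, Fin.val_last, pow_succ, mul_neg, mul_one, neg_smul,
    Finset.sum_neg_distrib, neg_neg]
  simp
  abel

end CubeFunctional

/-! ### Normalisation of cubes along a system of walls -/

/-- A closed set of walls in the unit interval, together with a self map `stair` of the interval
that fixes the walls and takes a neighbourhood of the walls, on which `bump ≠ 1`, to the walls. -/
structure Walls where
  /-- The set of walls. -/
  carrier : Set unitInterval
  /-- A staircase function. -/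
  stair : C(unitInterval, unitInterval)
  /-- A function that vanishes on the walls and is `1` outside a neighbourhood of the walls. -/
  bump : C(unitInterval, unitInterval)
  zero_mem : 0 ∈ carrier
  one_mem : 1 ∈ carrier
  stair_eq : ∀ u ∈ carrier, stair u = u
  bump_eq : ∀ u ∈ carrier, bump u = 0
  stair_mem : ∀ u, bump u ≠ 1 → stair u ∈ carrier

/-- The walls at the end points of the interval. -/
def Walls.ends : Walls where
  carrier := {0, 1}
  -- Thirds: `stair` is constant on the two outer thirds and `bump` is `1` precisely on the middle
  -- one.
  stair := ⟨fun u => clamp (3 * u - 1), by fun_prop⟩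
  bump := ⟨fun u => clamp (min (3 * u) (3 - 3 * u)), by fun_prop⟩
  zero_mem := by simp
  one_mem := by simp
  stair_eq := by
    rintro u (rfl | rfl)
    · exact clamp_eq_zero (by simp)
    · exact clamp_eq_one (by norm_num)
  bump_eq := by
    rintro u (rfl | rfl) <;> exact clamp_eq_zero (by simp)
  stair_mem u hu := by
    by_contra h
    refine hu (clamp_eq_one ?_)
    simp only [ContinuousMap.coe_mk, Set.mem_insert_iff, Set.mem_singleton_iff, not_or] at h
    have h0 : 1 < 3 * (u : ℝ) := by
      by_contra h'; exact h.1 (clamp_eq_zero (by linarith))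
    have h1 : 3 * (u : ℝ) < 2 := by
      by_contra h'; exact h.2 (clamp_eq_one (by linarith))
    exact le_min (by linarith) (by linarith)

/-- The walls at the end points and the mid point of the interval. -/
def Walls.middle : Walls where
  carrier := {u | u = 0 ∨ u = 1 ∨ (u : ℝ) = 1 / 2}
  -- Sixths: `stair` rises only on `[1/6, 1/3]` and `[2/3, 5/6]`, and there alone `bump` is `1`.
  stair := ⟨fun u => clamp ((clamp (6 * u - 1) + clamp (6 * u - 4)) / 2), by fun_prop⟩
  bump := ⟨fun u => clamp (min (6 * u) (min (6 - 6 * u) |6 * u - 3|)), by fun_prop⟩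
  zero_mem := by simp
  one_mem := by simp
  stair_eq := by
    rintro u (rfl | rfl | h)
    · refine clamp_eq_zero ?_
      rw [clamp_eq_zero (by simp), clamp_eq_zero (by simp)]; simp
    · refine clamp_eq_one ?_
      rw [clamp_eq_one (by norm_num), clamp_eq_one (by norm_num)]; simp
    · refine clamp_eq ?_
      rw [clamp_eq_one (by rw [h]; norm_num), clamp_eq_zero (by rw [h]; norm_num), h]; simp
  bump_eq := by
    rintro u (rfl | rfl | h)
    · exact clamp_eq_zero (min_le_of_left_le (by simp))
    · exact clamp_eq_zero (min_le_of_right_le (min_le_of_left_le (by simp)))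
    · refine clamp_eq_zero (min_le_of_right_le (min_le_of_right_le ?_))
      rw [h]; norm_num
  stair_mem u hu := by
    by_contra h
    refine hu (clamp_eq_one ?_)
    simp only [ContinuousMap.coe_mk, Set.mem_ofPred_eq, not_or] at h
    have h0 : 1 < 6 * (u : ℝ) := by
      by_contra h'
      refine h.1 (clamp_eq_zero ?_)
      rw [clamp_eq_zero (by linarith), clamp_eq_zero (by linarith)]; simp
    have h1 : 6 * (u : ℝ) < 5 := by
      by_contra h'
      refine h.2.1 (clamp_eq_one ?_)
      rw [clamp_eq_one (by linarith), clamp_eq_one (by linarith)]; simp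
    have h2 : 1 ≤ |6 * (u : ℝ) - 3| := by
      by_contra h'
      rw [not_le, abs_lt] at h'
      refine h.2.2 ?_
      rw [clamp_eq_one (by linarith : 1 ≤ 6 * (u : ℝ) - 1),
        clamp_eq_zero (by linarith : 6 * (u : ℝ) - 4 ≤ 0)]
      norm_num [coe_clamp]
    exact le_min (by linarith) (le_min (by linarith) h2)

section Normalise

variable {m : ℕ} (w : Fin m → Walls)

/-- The union of the walls and the top face of a cube. -/
def wallSet : Set (Cube (m + 1)) :=
  {y | y (Fin.last m) = 1 ∨ ∃ i : Fin m, y i.castSucc ∈ (w i).carrier}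

/-- The predicate on self maps of the cube which preserve the walls together with the top face,
and take the bottom face to its union with the walls and the top face. -/
def PreservesWalls (h : C(Cube (m + 1), Cube (m + 1))) : Prop :=
  (∀ y ∈ wallSet w, h y ∈ wallSet w) ∧
    ∀ y, y (Fin.last m) = 0 → h y (Fin.last m) = 0 ∨ h y ∈ wallSet w

/-- Two points lie on a common wall. -/
def OnCommonWall (y z : Cube (m + 1)) : Prop :=
  (y (Fin.last m) = 1 ∧ z (Fin.last m) = 1) ∨
    ∃ i : Fin m, y i.castSucc = z i.castSucc ∧ z i.castSucc ∈ (w i).carrier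

theorem OnCommonWall.lerp_mem {w : Fin m → Walls} {y z : Cube (m + 1)} (h : OnCommonWall w y z)
    (t : unitInterval) : (fun i => lerp t (y i) (z i)) ∈ wallSet w := by
  rcases h with ⟨h1, h2⟩ | ⟨i, h1, h2⟩
  · left; simp [h1, h2]
  · right; exact ⟨i, by simpa [h1] using h2⟩

theorem homotopicWith_of_onCommonWall {a b : C(Cube (m + 1), Cube (m + 1))}
    (h1 : ∀ y ∈ wallSet w, OnCommonWall w (a y) (b y))
    (h2 : ∀ y, y (Fin.last m) = 0 →
      (a y (Fin.last m) = 0 ∧ b y (Fin.last m) = 0) ∨ OnCommonWall w (a y) (b y)) :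
    ContinuousMap.HomotopicWith a b (PreservesWalls w) :=
  ⟨{  toFun := fun p i => lerp p.1 (a p.2 i) (b p.2 i)
      continuous_toFun := by fun_prop
      map_zero_left := fun y => by simp
      map_one_left := fun y => by simp
      prop' := fun t => ⟨fun y hy => (h1 y hy).lerp_mem t, fun y hy => by
        rcases h2 y hy with ⟨h, h'⟩ | h
        · left; simp [h, h']
        · right; exact h.lerp_mem t⟩ }⟩

/-- The product of the bump functions of the first `m` coordinates. -/
def sideBump : C(Cube (m + 1), unitInterval) :=
  ⟨fun y => ∏ i : Fin m, (w i).bump (y i.castSucc), by fun_prop⟩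

theorem sideBump_eq_zero {y : Cube (m + 1)} {i : Fin m} (h : y i.castSucc ∈ (w i).carrier) :
    sideBump w y = 0 :=
  Finset.prod_eq_zero (Finset.mem_univ i) ((w i).bump_eq _ h)

theorem sideBump_eq_one_or (y : Cube (m + 1)) :
    sideBump w y = 1 ∨ ∃ i, (w i).stair (y i.castSucc) ∈ (w i).carrier := by
  by_cases h : ∀ i, (w i).bump (y i.castSucc) = 1
  · left
    change ∏ i : Fin m, (w i).bump (y i.castSucc) = 1
    exact Finset.prod_eq_one fun i _ => h i
  · push Not at h
    obtain ⟨i, hi⟩ := h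
    exact Or.inr ⟨i, (w i).stair_mem _ hi⟩

/-- The last coordinate of the collapsing map. -/
def lastCoord : C(Cube (m + 1), unitInterval) :=
  -- Equal to `1` once the last coordinate is at least `1/2` or the bump is at most `1/2`, and `0`
  -- on the bottom where the bump is `1`.
  ⟨fun y => clamp (max (2 * y (Fin.last m)) (2 - 2 * sideBump w y)), by fun_prop⟩

/-- The factor by which the collapsing map shrinks the first `m` coordinates. -/
def shrink : C(Cube (m + 1), unitInterval) :=
  -- Equal to `0` when the bump is at most `1/4` or the last coordinate at least `3/4`. It falls
  -- below `1` only where `lastCoord` has already reached `1`, so shrinking happens within the top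
  -- face.
  ⟨fun y => clamp (min (4 * sideBump w y - 1) (3 - 4 * y (Fin.last m))), by fun_prop⟩

/-- Apply the staircase functions to the first `m` coordinates. -/
def stairMap (s r : C(Cube (m + 1), unitInterval)) : C(Cube (m + 1), Cube (m + 1)) :=
  ⟨fun y => Fin.snoc (α := fun _ => unitInterval) (fun i => s y * (w i).stair (y i.castSucc)) (r y),
    Continuous.finSnoc (by fun_prop) (by fun_prop)⟩

@[simp]
theorem stairMap_last (s r : C(Cube (m + 1), unitInterval)) (y : Cube (m + 1)) :
    stairMap w s r y (Fin.last m) = r y := by simp [stairMap]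

@[simp]
theorem stairMap_castSucc (s r : C(Cube (m + 1), unitInterval)) (y : Cube (m + 1)) (i : Fin m) :
    stairMap w s r y i.castSucc = s y * (w i).stair (y i.castSucc) := by simp [stairMap]

/-- The self map of the cube which collapses the walls and the top face to a vertex. -/
def collapse : C(Cube (m + 1), Cube (m + 1)) := stairMap w (shrink w) (lastCoord w)

/-- The vertex `(0, …, 0, 1)` of the cube. -/
def topVertex (m : ℕ) : Cube (m + 1) := Fin.snoc (α := fun _ => unitInterval) 0 1

theorem topVertex_mem : topVertex m ∈ wallSet w := Or.inl (by simp [topVertex])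

/-- A function that vanishes on the walls and the top face. -/
def depth : C(Cube (m + 1), ℝ) := ⟨fun y => min (sideBump w y) (1 - y (Fin.last m)), by fun_prop⟩

theorem depth_eq_zero {y : Cube (m + 1)} (hy : y ∈ wallSet w) : depth w y = 0 := by
  change min _ _ = (0 : ℝ)
  have h := (sideBump w y).2.1
  have h' := (y (Fin.last m)).2.2
  rcases hy with hy | ⟨i, hi⟩
  · rw [hy, Set.Icc.coe_one, sub_self, min_eq_right h]
  · rw [sideBump_eq_zero w hi, Set.Icc.coe_zero, min_eq_left (by linarith)]

/-- Not just the walls but a whole collar of them goes to the vertex. The collar leaves room to drag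
the image of the vertex along a path to the base point. -/
theorem collapse_of_depth_le {y : Cube (m + 1)} (hy : depth w y ≤ 1 / 4) :
    collapse w y = topVertex m := by
  have hy' : (sideBump w y : ℝ) ≤ 1 / 4 ∨ 1 - (y (Fin.last m) : ℝ) ≤ 1 / 4 := min_le_iff.1 hy
  have h1 : shrink w y = 0 := by
    refine clamp_eq_zero (min_le_iff.2 ?_)
    rcases hy' with h | h
    · left; linarith
    · right; linarith
  have h2 : lastCoord w y = 1 := by
    refine clamp_eq_one (le_max_iff.2 ?_)
    rcases hy' with h | h
    · right; linarith
    · left; linarith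
  funext l
  induction l using Fin.lastCases with
  | last => simp [collapse, topVertex, h2]
  | cast l => simp [collapse, topVertex, h1]

theorem lastCoord_eq_one {y : Cube (m + 1)} (hy : y ∈ wallSet w) : lastCoord w y = 1 := by
  refine clamp_eq_one (le_max_iff.2 ?_)
  rcases hy with h | ⟨i, h⟩
  · left; rw [h]; norm_num
  · right; rw [sideBump_eq_zero w h]; norm_num

/-- Three straight-line homotopies suffice: apply the stairs, raise the last coordinate, shrink the
others. On the bottom face a point either has bump `1`, and keeps height `0`, or some stair has put
it on a wall, where it may rise. -/
theorem homotopicWith_collapse :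
    ContinuousMap.HomotopicWith (ContinuousMap.id _) (collapse w) (PreservesWalls w) := by
  let ev : C(Cube (m + 1), unitInterval) := ⟨fun y => y (Fin.last m), by fun_prop⟩
  have hlast {y : Cube (m + 1)} (hy : y (Fin.last m) = 0) (h : sideBump w y = 1) :
      lastCoord w y = 0 := by
    refine clamp_eq_zero (max_le ?_ ?_)
    · rw [hy]; simp
    · rw [h]; simp
  have h1 : ContinuousMap.HomotopicWith (ContinuousMap.id _)
      (stairMap w (ContinuousMap.const _ 1) ev) (PreservesWalls w) := by
    refine homotopicWith_of_onCommonWall w ?_ ?_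
    · rintro y (hy | ⟨i, hi⟩)
      · left; simp [ev, hy]
      · right; exact ⟨i, by simp [(w i).stair_eq _ hi], by simpa [(w i).stair_eq _ hi] using hi⟩
    · intro y hy
      left; simp [ev, hy]
  have h2 : ContinuousMap.HomotopicWith (stairMap w (ContinuousMap.const _ 1) ev)
      (stairMap w (ContinuousMap.const _ 1) (lastCoord w)) (PreservesWalls w) := by
    refine homotopicWith_of_onCommonWall w ?_ ?_
    · rintro y (hy | ⟨i, hi⟩)
      · left; simp [ev, hy, lastCoord_eq_one w (Or.inl hy)]
      · right; exact ⟨i, by simp, by simpa [(w i).stair_eq _ hi] using hi⟩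
    · intro y hy
      rcases sideBump_eq_one_or w y with h | ⟨i, hi⟩
      · left; simp [ev, hy, hlast hy h]
      · right; right; exact ⟨i, by simp, by simpa using hi⟩
  have h3 : ContinuousMap.HomotopicWith (stairMap w (ContinuousMap.const _ 1) (lastCoord w))
      (collapse w) (PreservesWalls w) := by
    refine homotopicWith_of_onCommonWall w ?_ ?_
    · intro y hy
      left; simp [collapse, lastCoord_eq_one w hy]
    · intro y hy
      rcases sideBump_eq_one_or w y with h | ⟨i, hi⟩
      · left; simp [collapse, hlast hy h]
      · right
        rcases le_total (sideBump w y : ℝ) (1 / 2) with h | h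
        · left
          have : lastCoord w y = 1 := clamp_eq_one (le_max_iff.2 (Or.inr (by linarith)))
          simp [collapse, this]
        · right
          have : shrink w y = 1 := by
            refine clamp_eq_one (le_min (by linarith) ?_)
            rw [hy]; norm_num
          exact ⟨i, by simp [collapse, this], by simpa [collapse, this] using hi⟩
  exact (h1.trans h2).trans h3

variable {X : Type u} [TopologicalSpace X] {A : Set X}

/-- A map that takes the walls and the bottom face to `A` can be deformed so that the walls and
the top face are taken to a given point in the path component of the image of the top vertex. -/
theorem exists_homotopy_normalised (f : C(Cube (m + 1), X))
    (hf : ∀ y, y (Fin.last m) = 0 ∨ y ∈ wallSet w → f y ∈ A) {x : A}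
    (hx : Joined (⟨f (topVertex m), hf _ (Or.inr (topVertex_mem w))⟩ : A) x) :
    ∃ f' : C(Cube (m + 1), X), (∀ y ∈ wallSet w, f' y = x) ∧
      Nonempty (f.HomotopyWith f' fun h => ∀ y, y (Fin.last m) = 0 ∨ y ∈ wallSet w → h y ∈ A) := by
  obtain ⟨δ⟩ := hx
  obtain ⟨K⟩ := homotopicWith_collapse w
  have hK : ∀ t y, y (Fin.last m) = 0 ∨ y ∈ wallSet w →
      K (t, y) (Fin.last m) = 0 ∨ K (t, y) ∈ wallSet w := by
    rintro t y (hy | hy)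
    · exact (K.prop t).2 y hy
    · exact Or.inr ((K.prop t).1 y hy)
  have hc : ∀ y, y (Fin.last m) = 0 ∨ y ∈ wallSet w → f (collapse w y) ∈ A := by
    intro y hy
    have := hK 1 y hy
    rw [K.apply_one] at this
    exact hf _ this
  let H1 : f.HomotopyWith (f.comp (collapse w))
      fun h => ∀ y, y (Fin.last m) = 0 ∨ y ∈ wallSet w → h y ∈ A :=
    { toFun := fun p => f (K p)
      continuous_toFun := by fun_prop
      map_zero_left := fun y => by simp
      map_one_left := fun y => by simp
      prop' := fun t y hy => hf _ (hK t y hy) }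
  -- On the collar `f ∘ collapse` is constant. There the value travels along `δ`, by a fraction that
  -- is full on the walls and zero at depth `1/4`, where the two formulas meet.
  let D : C(unitInterval × Cube (m + 1), X) :=
    { toFun := fun p => if depth w p.2 ≤ 1 / 4 then (δ (clamp (p.1 * (1 - 4 * depth w p.2))) : X)
        else f (collapse w p.2)
      continuous_toFun := by
        refine Continuous.if_le (by fun_prop) (by fun_prop) (by fun_prop) (by fun_prop) ?_
        intro p hp
        have hp' : depth w p.2 = 1 / 4 := hp
        rw [collapse_of_depth_le w hp'.le, hp']
        rw [clamp_eq_zero (by norm_num), δ.source] }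
  have hD (t y) : D (t, y) = if depth w y ≤ 1 / 4 then (δ (clamp (t * (1 - 4 * depth w y))) : X)
        else f (collapse w y) := rfl
  let f' : C(Cube (m + 1), X) := D.comp ⟨fun y => (1, y), by fun_prop⟩
  let H2 : (f.comp (collapse w)).HomotopyWith f'
      fun h => ∀ y, y (Fin.last m) = 0 ∨ y ∈ wallSet w → h y ∈ A :=
    { toFun := D
      continuous_toFun := D.continuous
      map_zero_left := fun y => by
        rw [hD]
        split_ifs with h
        · rw [clamp_eq_zero (by simp), δ.source, ContinuousMap.comp_apply,
            collapse_of_depth_le w h]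
        · rfl
      map_one_left := fun y => rfl
      prop' := fun t y hy => by
        change D (t, y) ∈ A
        rw [hD]
        split_ifs with h
        · exact (δ _).2
        · exact hc y hy }
  refine ⟨f', fun y hy => ?_, ⟨H1.trans H2⟩⟩
  change D (1, y) = x
  rw [hD, depth_eq_zero w hy, if_pos (by norm_num), clamp_eq_one (by norm_num), δ.target]

end Normalise

/-! ### Cubes and relative homotopy groups -/

/-- The closure of the boundary of the cube minus the face on which the last coordinate is `0`. -/
def boxSet (m : ℕ) : Set (Cube (m + 1)) :=
  {y | y (Fin.last m) = 1 ∨ ∃ i : Fin m, y i.castSucc = 0 ∨ y i.castSucc = 1}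

theorem mem_boundary_iff {m : ℕ} {y : Cube (m + 1)} :
    y ∈ Cube.boundary (Fin (m + 1)) ↔ y (Fin.last m) = 0 ∨ y ∈ boxSet m := by
  constructor
  · rintro ⟨i, hi⟩
    induction i using Fin.lastCases with
    | last => exact hi.imp id Or.inl
    | cast i => exact Or.inr (Or.inr ⟨i, hi⟩)
  · rintro (h | h | ⟨i, h⟩)
    · exact ⟨_, Or.inl h⟩
    · exact ⟨_, Or.inr h⟩
    · exact ⟨_, h⟩

section RelLoops

variable {X : Type u} [TopologicalSpace X] {A : Set X}

/-- A map of cubes that takes the boundary to `A`. -/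
def PairMap (A : Set X) {k : ℕ} (f : C(Cube k, X)) : Prop := ∀ y ∈ Cube.boundary (Fin k), f y ∈ A

/-- A map of cubes that takes the boundary to `A` and all faces but one to a base point. -/
def TripleMap {A : Set X} (x : A) {m : ℕ} (f : C(Cube (m + 1), X)) : Prop :=
  (∀ y, y (Fin.last m) = 0 → f y ∈ A) ∧ ∀ y ∈ boxSet m, f y = x

theorem TripleMap.pairMap {x : A} {m : ℕ} {f : C(Cube (m + 1), X)} (h : TripleMap x f) :
    PairMap A f := fun y hy => by
  rcases mem_boundary_iff.1 hy with hy | hy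
  · exact h.1 y hy
  · rw [h.2 y hy]; exact x.2

/-- Currying a family of maps of cubes with respect to the last coordinate. -/
def curryLast (x : A) {Y : Type*} [TopologicalSpace Y] {m : ℕ} (H : C(Y × Cube (m + 1), X))
    (h0 : ∀ s y, y (Fin.last m) = 0 → H (s, y) ∈ A)
    (h1 : ∀ s y, y (Fin.last m) = 1 → H (s, y) = x) : C(Y × Cube m, PathFiber A (x : X)) where
  toFun p := ⟨(H.comp (⟨fun q : (Y × Cube m) × unitInterval =>
      (q.1.1, Fin.snoc (α := fun _ => unitInterval) q.1.2 q.2),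
        Continuous.prodMk (by fun_prop) (Continuous.finSnoc (by fun_prop) (by fun_prop))⟩ :
      C((Y × Cube m) × unitInterval, Y × Cube (m + 1)))).curry p, by
    exact h0 _ _ (by simp), h1 _ _ (by simp)⟩
  continuous_toFun := (ContinuousMap.continuous _).subtype_mk _

theorem snoc_mem_boxSet {m : ℕ} {y : Cube m} (hy : y ∈ Cube.boundary (Fin m)) (t : unitInterval) :
    (Fin.snoc (α := fun _ => unitInterval) y t : Cube (m + 1)) ∈ boxSet m := by
  obtain ⟨i, hi⟩ := hy
  exact Or.inr ⟨i, by simpa using hi⟩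

theorem curryLast_boundary (x : A) {Y : Type*} [TopologicalSpace Y] {m : ℕ}
    (H : C(Y × Cube (m + 1), X)) (h0) (h1 : ∀ s, ∀ y ∈ boxSet m, H (s, y) = x) (s : Y)
    (y : Cube m) (hy : y ∈ Cube.boundary (Fin m)) :
    curryLast x H h0 (fun s y h => h1 s y (Or.inl h)) (s, y) = PathFiber.base x := by
  refine Subtype.ext (ContinuousMap.ext fun t => ?_)
  exact h1 s _ (snoc_mem_boxSet hy t)

/-- The loop in the space of paths that corresponds to a map of triples. -/
def ofCube (x : A) {m : ℕ} (f : C(Cube (m + 1), X)) (hf : TripleMap x f) :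
    GenLoop (Fin m) (PathFiber A (x : X)) (PathFiber.base x) :=
  ⟨(curryLast x (Y := Unit) ⟨fun p => f p.2, by fun_prop⟩ (fun _ => hf.1)
      (fun _ y h => hf.2 y (Or.inl h))).comp ⟨fun y => ((), y), by fun_prop⟩,
    fun y hy => curryLast_boundary x (Y := Unit) _ (fun _ => hf.1) (fun _ => hf.2) () y hy⟩

theorem ofCube_apply (x : A) {m : ℕ} (f : C(Cube (m + 1), X)) (hf : TripleMap x f) (y : Cube m)
    (t : unitInterval) :
    (ofCube x f hf y).1 t = f (Fin.snoc (α := fun _ => unitInterval) y t) := rfl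

theorem ofCube_homotopic (x : A) {m : ℕ} {f g : C(Cube (m + 1), X)} (hf : TripleMap x f)
    (hg : TripleMap x g) (H : f.HomotopyWith g (TripleMap x)) :
    GenLoop.Homotopic (ofCube x f hf) (ofCube x g hg) := by
  refine ⟨{ toContinuousMap := curryLast x H.toContinuousMap (fun t => (H.prop t).1)
              (fun t y h => (H.prop t).2 y (Or.inl h))
            map_zero_left := fun y => ?_
            map_one_left := fun y => ?_
            prop' := fun t y hy => ?_ }⟩
  · refine Subtype.ext (ContinuousMap.ext fun t => ?_)
    exact H.apply_zero _
  · refine Subtype.ext (ContinuousMap.ext fun t => ?_)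
    exact H.apply_one _
  · refine (curryLast_boundary x H.toContinuousMap (fun t => (H.prop t).1)
      (fun t => (H.prop t).2) t y hy).trans ?_
    exact ((ofCube x f hf).2 y hy).symm

theorem RelLoop.ofCube_cube {x : A} {n : ℕ} (f : C(Cube (n + 2), X)) (hf : TripleMap x f) :
    RelLoop.cube (ofCube x f hf : RelLoop x n) = f := by
  ext1 y
  change f (Fin.snoc (α := fun _ => unitInterval) (fun i => y i.castSucc) (y (Fin.last _))) = f y
  congr 1
  exact Fin.snoc_init_self y

theorem RelLoop.tripleMap_cube {x : A} {n : ℕ} (p : RelLoop x n) : TripleMap x p.cube := by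
  refine ⟨fun y hy => ?_, fun y hy => p.cube_eq_base y hy⟩
  change (p fun i => y i.castSucc).1 (y (Fin.last _)) ∈ A
  rw [hy]
  exact (p fun i => y i.castSucc).2.1

theorem RelLoop.ofCube_of_cube {x : A} {n : ℕ} (p : RelLoop x n) :
    ofCube x p.cube p.tripleMap_cube = p := by
  refine GenLoop.ext _ _ fun y => Subtype.ext (ContinuousMap.ext fun t => ?_)
  rw [ofCube_apply]
  change (p fun i => (Fin.snoc (α := fun _ => unitInterval) y t : Cube (n + 2)) i.castSucc).1
    ((Fin.snoc (α := fun _ => unitInterval) y t : Cube (n + 2)) (Fin.last _)) = (p y).1 t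
  simp

theorem RelLoop.toPi_eq_of_homotopy {x : A} {n : ℕ} {p q : RelLoop x n}
    (H : p.cube.HomotopyWith q.cube (TripleMap x)) : p.toPi = q.toPi := by
  refine Quotient.sound ?_
  have := ofCube_homotopic x p.tripleMap_cube q.tripleMap_cube H
  rwa [p.ofCube_of_cube, q.ofCube_of_cube] at this

/-- Homotopic loops in the space of paths correspond to homotopic maps of triples. -/
theorem homotopicWith_of_genLoop {x : A} {m : ℕ}
    {p q : GenLoop (Fin m) (PathFiber A (x : X)) (PathFiber.base x)} (h : GenLoop.Homotopic p q)
    {f g : C(Cube (m + 1), X)}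
    (hf : ∀ y, f y = (p fun i => y i.castSucc).1 (y (Fin.last m)))
    (hg : ∀ y, g y = (q fun i => y i.castSucc).1 (y (Fin.last m))) :
    f.HomotopicWith g (TripleMap x) := by
  obtain ⟨H⟩ := h
  refine ⟨{ toFun := fun p => (H (p.1, fun i => p.2 i.castSucc)).1 (p.2 (Fin.last m))
            continuous_toFun := ?_
            map_zero_left := fun y => by rw [H.apply_zero]; exact (hf y).symm
            map_one_left := fun y => by rw [H.apply_one]; exact (hg y).symm
            prop' := fun t => ⟨fun y hy => ?_, fun y hy => ?_⟩ }⟩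
  · have : Continuous fun p : unitInterval × Cube (m + 1) =>
        (H (p.1, fun i => p.2 i.castSucc)).1 := by fun_prop
    fun_prop
  · simp only [ContinuousMap.coe_mk, hy]
    exact (H _).2.1
  · rcases hy with hy | ⟨i, hi⟩
    · simp only [ContinuousMap.coe_mk, hy]
      exact (H _).2.2
    · simp only [ContinuousMap.coe_mk]
      rw [H.eq_fst t (x := fun i => y i.castSucc) ⟨i, hi⟩]
      exact congrArg (fun γ : PathFiber A (x : X) => γ.1 (y (Fin.last m))) (p.2 _ ⟨i, hi⟩)

/-- If the relative homotopy set is trivial, then every map of triples is homotopic to the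
constant map. -/
theorem TripleMap.homotopic_const {x : A} {m : ℕ} {f : C(Cube (m + 1), X)} (hf : TripleMap x f)
    (h : Subsingleton (RelPi x (m + 1))) :
    f.HomotopicWith (ContinuousMap.const _ (x : X)) (PairMap A) := by
  have e : (Quotient.mk _ (ofCube x f hf) : HomotopyGroup (Fin m) (PathFiber A (x : X))
      (PathFiber.base x)) = Quotient.mk _ GenLoop.const :=
    @Subsingleton.elim (RelPi x (m + 1)) h _ _
  have hy (y) : f y = (ofCube x f hf fun i => y i.castSucc).1 (y (Fin.last m)) := by
    rw [ofCube_apply]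
    exact congrArg f (Fin.snoc_init_self y).symm
  obtain ⟨H⟩ := homotopicWith_of_genLoop (Quotient.exact e) (f := f)
    (g := ContinuousMap.const _ (x : X)) hy fun y => rfl
  exact ⟨{ H with prop' := fun t => (H.prop t).pairMap }⟩

/-- If the set `π₁(X, A, x)` is trivial and `X` is path connected, then so is `A`. -/
theorem joined_of_subsingleton [PathConnectedSpace X] (x : A) (h : Subsingleton (RelPi x 1))
    (a : A) : Joined a x := by
  let γ : Path (a : X) x := PathConnectedSpace.somePath _ _
  let f : C(Cube 1, X) := ⟨fun y => γ (y 0), by fun_prop⟩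
  have hf : TripleMap x f := by
    refine ⟨fun y hy => ?_, ?_⟩
    · change γ (y 0) ∈ A
      rw [show y 0 = 0 from hy, γ.source]; exact a.2
    · rintro y (hy | ⟨i, _⟩)
      · change γ (y 0) = x
        rw [show y 0 = 1 from hy, γ.target]
      · exact i.elim0
  obtain ⟨H⟩ := hf.homotopic_const h
  -- The contraction of the path keeps its initial point in `A`, so the trace of that point joins
  -- `a` to `x` inside `A`.
  refine ⟨⟨⟨fun t => ⟨H (t, 0), H.prop t 0 ⟨0, Or.inl rfl⟩⟩, by fun_prop⟩, ?_, ?_⟩⟩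
  · refine Subtype.ext ?_
    change H (0, 0) = a
    rw [H.apply_zero]
    exact γ.source
  · refine Subtype.ext ?_
    change H (1, 0) = x
    rw [H.apply_one]; rfl

/-- Every map of pairs can be deformed into a map of triples. -/
theorem PairMap.exists_tripleMap {x : A} (hA : ∀ a : A, Joined a x) {m : ℕ}
    {f : C(Cube (m + 1), X)} (hf : PairMap A f) :
    ∃ g : C(Cube (m + 1), X), TripleMap x g ∧ f.HomotopicWith g (PairMap A) := by
  obtain ⟨g, hg, ⟨H⟩⟩ := exists_homotopy_normalised (fun _ : Fin m => Walls.ends) f (A := A)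
    (fun y hy => hf y (mem_boundary_iff.2 hy)) (hA _)
  refine ⟨g, ⟨fun y hy => ?_, hg⟩, ⟨{ H.toHomotopy with prop' := fun t y hy => ?_ }⟩⟩
  · rw [← H.apply_one]
    exact H.prop 1 y (Or.inl hy)
  · exact H.prop t y (mem_boundary_iff.1 hy)

end RelLoops

/-! ### The class of a map of pairs in the tensor product -/

section CubeClass

variable {X : Type u} [TopologicalSpace X] (L : LocalSystem.{u, w} X) {A : Set X} (x : A) {n : ℕ}

theorem tensor_eq_of_rel {a b : FreeAbelianGroup (RelPi x (n + 2) × L.Fiber (x : X))}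
    (h : TensorRel L x n (a - b)) :
    (QuotientAddGroup.mk a : RelTensor L x n) = QuotientAddGroup.mk b := by
  rw [QuotientAddGroup.eq_iff_sub_mem]
  exact AddSubgroup.subset_closure h

theorem tmul_add (a : RelPi x (n + 2)) (l m : L.Fiber (x : X)) :
    tmul L x a (l + m) = tmul L x a l + tmul L x a m :=
  tensor_eq_of_rel L x (TensorRel.add_right a l m)

theorem mul_tmul (a b : RelPi x (n + 2)) (l : L.Fiber (x : X)) :
    tmul L x (a * b) l = tmul L x a l + tmul L x b l :=
  tensor_eq_of_rel L x (TensorRel.add_left a b l)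

theorem tmul_loopTransport {γ : Path x x} {p q : RelLoop x n} (h : FreelyHomotopicAlong γ p q)
    (l : L.Fiber (x : X)) : tmul L x q.toPi (loopTransport L x γ l) = tmul L x p.toPi l :=
  tensor_eq_of_rel L x (TensorRel.balanced γ p q h l)

/-- The pure tensor as a homomorphism in its second variable. -/
def tmulHom (a : RelPi x (n + 2)) : L.Fiber (x : X) →+ RelTensor L x n :=
  AddMonoidHom.mk' (tmul L x a) (tmul_add L x a)

variable {x}

theorem RelLoop.cube_zero (p : RelLoop x n) : p.cube 0 = x :=
  p.cube_eq_base 0 (Or.inr ⟨0, Or.inl rfl⟩)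

/-- The path in the cube from the vertex `0` to the top vertex. -/
def verticalPath (m : ℕ) : Path (0 : Cube (m + 1)) (topVertex m) where
  toFun t := Fin.snoc (α := fun _ => unitInterval) 0 t
  continuous_toFun := Continuous.finSnoc (by fun_prop) (by fun_prop)
  source' := by
    funext i
    induction i using Fin.lastCases <;> simp
  target' := rfl

theorem verticalPath_mem (n : ℕ) (t : unitInterval) : verticalPath (n + 1) t ∈ boxSet (n + 1) :=
  Or.inr ⟨0, Or.inl (by
    change (Fin.snoc (α := fun _ => unitInterval) (0 : Cube (n + 1)) t : Cube (n + 2))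
      (Fin.castSucc 0) = 0
    rw [Fin.snoc_castSucc]; rfl)⟩

/-- Two representatives which are homotopic as maps of pairs have the same class in the tensor
product. -/
theorem tmul_eq_of_pairHomotopy {p q : RelLoop x n} (H : p.cube.HomotopyWith q.cube (PairMap A))
    (l : L.Fiber (p.cube 0)) : tmul L x p.toPi (L.castFiber p.cube_zero l) =
      tmul L x q.toPi (L.castFiber q.cube_zero (L.trace H.toHomotopy 0 l)) := by
  let w : Fin (n + 1) → Walls := fun _ => Walls.ends
  have hw : wallSet w = boxSet (n + 1) := rfl
  obtain ⟨K⟩ := homotopicWith_collapse w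
  have hbox : ∀ y ∈ boxSet (n + 1), collapse w y = topVertex (n + 1) := fun y hy =>
    collapse_of_depth_le w (by rw [depth_eq_zero w (hw ▸ hy)]; norm_num)
  have htop : topVertex (n + 1) ∈ boxSet (n + 1) := topVertex_mem w
  have hcbd : ∀ y, y (Fin.last _) = 0 → collapse w y ∈ Cube.boundary (Fin (n + 2)) := by
    intro y hy
    have := (K.prop 1).2 y hy
    simp only [ContinuousMap.Homotopy.curry_one] at this
    exact mem_boundary_iff.2 this
  have tri (p : RelLoop x n) : TripleMap x (p.cube.comp (collapse w)) :=
    ⟨fun y hy => p.tripleMap_cube.pairMap _ (hcbd y hy), fun y hy => by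
      rw [ContinuousMap.comp_apply, hbox y hy]; exact p.tripleMap_cube.2 _ htop⟩
  let c (p : RelLoop x n) : RelLoop x n := ofCube x (p.cube.comp (collapse w)) (tri p)
  have hcc (p : RelLoop x n) : (c p).cube = p.cube.comp (collapse w) :=
    RelLoop.ofCube_cube _ (tri p)
  have hc (p : RelLoop x n) : p.toPi = (c p).toPi := by
    refine RelLoop.toPi_eq_of_homotopy
      { toFun := fun z => p.cube (K z)
        continuous_toFun := by fun_prop
        map_zero_left := fun y => by simp
        map_one_left := fun y => by simp [hcc]
        prop' := fun t => ⟨fun y hy => ?_, fun y hy => ?_⟩ }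
    · exact p.tripleMap_cube.pairMap _ (mem_boundary_iff.2 ((K.prop t).2 y hy))
    · exact p.tripleMap_cube.2 _ ((K.prop t).1 y hy)
  let γ : Path x x :=
    { toFun := fun t => ⟨H (t, topVertex (n + 1)), H.prop t _ (mem_boundary_iff.2 (Or.inr htop))⟩
      continuous_toFun := by fun_prop
      source' := Subtype.ext (by
        change H (0, _) = _; rw [H.apply_zero]; exact p.tripleMap_cube.2 _ htop)
      target' := Subtype.ext (by
        change H (1, _) = _; rw [H.apply_one]; exact q.tripleMap_cube.2 _ htop) }
  -- `collapse` is constant on the box `J`. Composed with it, a mere homotopy of pairs is constant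
  -- on `J` at each time, with value the trace `γ` of the top vertex.
  have hfree : FreelyHomotopicAlong γ (c p) (c q) := by
    refine ⟨⟨fun z => H (z.1, collapse w z.2), by fun_prop⟩, fun y => ?_, fun y => ?_,
      fun t y hy => ?_, fun t y hy => ?_⟩
    · rw [hcc]; exact H.apply_zero _
    · rw [hcc]; exact H.apply_one _
    · exact H.prop t _ (hcbd y hy)
    · change H (t, collapse w y) = H (t, topVertex (n + 1))
      rw [hbox y hy]
  rw [hc p, hc q, ← tmul_loopTransport L x hfree]
  congr 1
  have hp : p.cube (topVertex (n + 1)) = x := p.tripleMap_cube.2 _ htop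
  have hq : q.cube (topVertex (n + 1)) = x := q.tripleMap_cube.2 _ htop
  have hγ : γ.map continuous_subtype_val =
      (H.toHomotopy.evalAt (topVertex (n + 1))).cast hp.symm hq.symm := by
    ext t; rfl
  -- The coefficient sits over the vertex `0`, but `γ` is the trace of the top vertex. The edge
  -- between the two lies in `J`, where the cube is constant, so the transport along it is trivial.
  have halong (p : RelLoop x n) (l : L.Fiber (p.cube 0)) :
      L.along p.cube 0 (topVertex (n + 1)) l = L.castFiber
        (p.cube_zero.trans (p.tripleMap_cube.2 _ htop).symm) l :=
    L.along_of_const _ (verticalPath (n + 1)) (fun t => by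
      rw [p.tripleMap_cube.2 _ (verticalPath_mem n t), p.cube_zero]) l
  have h1 := L.trace_along H.toHomotopy 0 (topVertex (n + 1)) l
  rw [halong, halong] at h1
  rw [loopTransport, hγ, L.transport_cast]
  change L.castFiber _ (L.trace H.toHomotopy (topVertex (n + 1)) _) = _
  rw [L.castFiber_castFiber, h1, L.castFiber_castFiber]

open scoped Classical in
/-- The class in the tensor product of a map of pairs `(Iᵏ, ∂Iᵏ) → (X, A)` and an element of the
fibre over the image of the vertex `0`. -/
def cubeClass (x : A) {n : ℕ} (f : C(Cube (n + 2), X)) : L.Fiber (f 0) →+ RelTensor L x n :=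
  if h : ∃ p : RelLoop x n, f.HomotopicWith p.cube (PairMap A) then
    (tmulHom L x h.choose.toPi).comp
      (L.castFiber h.choose.cube_zero ∘ₗ
        L.trace (Classical.choice h.choose_spec).toHomotopy 0).toAddMonoidHom
  -- A default value. It is never reached for a map of pairs if all points of `A` are joined to `x`,
  -- by `PairMap.exists_relLoop`.
  else 0

/-- The chosen normalisation run backwards, followed by `H`, is a homotopy of pairs between two maps
of triples, so `tmul_eq_of_pairHomotopy` shows that the choice is immaterial. -/
theorem cubeClass_eq {f : C(Cube (n + 2), X)} (p : RelLoop x n)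
    (H : f.HomotopyWith p.cube (PairMap A)) (l : L.Fiber (f 0)) :
    cubeClass L x f l = tmul L x p.toPi (L.castFiber p.cube_zero (L.trace H.toHomotopy 0 l)) := by
  have h : ∃ p : RelLoop x n, f.HomotopicWith p.cube (PairMap A) := ⟨p, ⟨H⟩⟩
  rw [cubeClass, dif_pos h]
  change tmul L x h.choose.toPi (L.castFiber _
    (L.trace (Classical.choice h.choose_spec).toHomotopy 0 l)) = _
  set K := Classical.choice h.choose_spec
  rw [tmul_eq_of_pairHomotopy L (K.symm.trans H)]
  congr 2
  change L.trace (K.toHomotopy.symm.trans H.toHomotopy) 0 _ = _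
  rw [L.trace_trans, L.trace_symm]

theorem cubeClass_cube (p : RelLoop x n) (l : L.Fiber (p.cube 0)) :
    cubeClass L x p.cube l = tmul L x p.toPi (L.castFiber p.cube_zero l) := by
  rw [cubeClass_eq L p (ContinuousMap.HomotopyWith.refl _ p.tripleMap_cube.pairMap)]
  congr 2
  exact L.trace_refl _ _ _

theorem PairMap.exists_relLoop (hA : ∀ a : A, Joined a x) {f : C(Cube (n + 2), X)}
    (hf : PairMap A f) : ∃ p : RelLoop x n, f.HomotopicWith p.cube (PairMap A) := by
  obtain ⟨g, hg, H⟩ := hf.exists_tripleMap hA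
  exact ⟨ofCube x g hg, by rwa [RelLoop.ofCube_cube]⟩

theorem cubeClass_of_homotopy (hA : ∀ a : A, Joined a x) {f g : C(Cube (n + 2), X)}
    (H : f.HomotopyWith g (PairMap A)) (l : L.Fiber (f 0)) :
    cubeClass L x g (L.trace H.toHomotopy 0 l) = cubeClass L x f l := by
  have hg : PairMap A g := by
    have := H.prop 1
    rwa [ContinuousMap.Homotopy.curry_one] at this
  obtain ⟨p, ⟨K⟩⟩ := hg.exists_relLoop hA
  rw [cubeClass_eq L p K, cubeClass_eq L p (H.trans K)]
  congr 2
  exact (L.trace_trans H.toHomotopy K.toHomotopy 0 l).symm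

theorem cubeClass_castFiber {f g : C(Cube (n + 2), X)} (h : f = g) (l : L.Fiber (f 0)) :
    cubeClass L x g (L.castFiber (by rw [h]) l) = cubeClass L x f l := by
  subst h; simp

theorem coordMap_leftHalf_zero {k : ℕ} (i : Fin k) : coordMap i leftHalf 0 = 0 := by
  have : leftHalf 0 = 0 := by ext; simp
  change Function.update (0 : Cube k) i (leftHalf 0) = _
  rw [this]
  exact Function.update_eq_self i (0 : Cube k)

/-- A path in the walls of the cube and in the middle wall. -/
theorem exists_path_rightHalf (n : ℕ) : ∃ γ : Path (0 : Cube (n + 2)) (coordMap 0 rightHalf 0),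
    ∀ t, γ t ∈ boxSet (n + 1) ∨ (γ t 0 : ℝ) = 1 / 2 := by
  have hz : (0 : Fin (n + 2)) = (0 : Fin (n + 1)).castSucc := rfl
  let γ₂ : Path (topVertex (n + 1)) (coordMap 0 rightHalf (topVertex (n + 1))) :=
    { toFun := fun t => Function.update (topVertex (n + 1)) 0 (clamp (t / 2))
      continuous_toFun := continuous_const.update 0 (by fun_prop)
      source' := by
        rw [clamp_eq_zero (by simp)]
        refine Function.update_eq_self_iff.2 ?_
        rw [hz, topVertex, Fin.snoc_castSucc]; rfl
      target' := by
        simp only [coordMap, ContinuousMap.coe_mk]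
        congr 1
        refine clamp_eq ?_
        rw [coe_rightHalf, hz, topVertex, Fin.snoc_castSucc]; simp }
  let γ := ((verticalPath (n + 1)).trans γ₂).trans
    ((verticalPath (n + 1)).map (coordMap 0 rightHalf).continuous).symm
  have hγ : ∀ z ∈ Set.range γ, z ∈ boxSet (n + 1) ∨ (z 0 : ℝ) = 1 / 2 := by
    rw [Path.trans_range, Path.trans_range, Path.symm_range]
    rintro z ((⟨t, rfl⟩ | ⟨t, rfl⟩) | ⟨t, rfl⟩)
    · exact Or.inl (verticalPath_mem n t)
    · refine Or.inl (Or.inl ?_)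
      have h2 : γ₂ t = Function.update (topVertex (n + 1)) 0 (clamp (t / 2)) := rfl
      rw [h2, Function.update_of_ne Fin.last_pos.ne', topVertex, Fin.snoc_last]
    · right
      have h0 : verticalPath (n + 1) t 0 = 0 := by
        change (Fin.snoc (α := fun _ => unitInterval) (0 : Cube (n + 1)) t : Cube (n + 2))
          (Fin.castSucc 0) = 0
        rw [Fin.snoc_castSucc]; rfl
      change (Function.update (verticalPath (n + 1) t) 0 (rightHalf (verticalPath (n + 1) t 0)) 0 :
        ℝ) = _
      rw [Function.update_self, coe_rightHalf, h0]
      simp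
  exact ⟨γ, fun t => hγ _ (Set.mem_range_self t)⟩

/-- Concatenation is expressed through the two half cubes, the form in which `CubeFunctional.split`
sees it. -/
theorem RelLoop.cube_transAt (q r : RelLoop x n) :
    (RelLoop.cube (GenLoop.transAt 0 q r : RelLoop x n)).comp (coordMap 0 leftHalf) = q.cube ∧
      (RelLoop.cube (GenLoop.transAt 0 q r : RelLoop x n)).comp (coordMap 0 rightHalf) =
        r.cube := by
  have hne : Fin.last (n + 1) ≠ 0 := Fin.last_pos.ne'
  have hz : (0 : Fin (n + 2)) = (0 : Fin (n + 1)).castSucc := rfl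
  have hlast (φ : C(unitInterval, unitInterval)) (y : Cube (n + 2)) :
      coordMap 0 φ y (Fin.last _) = y (Fin.last _) := by simp [coordMap, hne]
  have hinit (φ : C(unitInterval, unitInterval)) (y : Cube (n + 2)) :
      (fun i : Fin (n + 1) => coordMap 0 φ y i.castSucc) =
        Function.update (fun i => y i.castSucc) 0 (φ (y 0)) := by
    funext i
    rcases eq_or_ne i 0 with rfl | h
    · simp [coordMap]
    · have : i.castSucc ≠ 0 := fun h' => h (Fin.castSucc_injective _ h')
      simp [coordMap, this, h]
  have key (φ : C(unitInterval, unitInterval)) (y : Cube (n + 2)) :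
      (RelLoop.cube (GenLoop.transAt 0 q r : RelLoop x n)) (coordMap 0 φ y) =
        (if (φ (y 0) : ℝ) ≤ 1 / 2
          then q (Function.update (fun i => y i.castSucc) 0
            (Set.projIcc 0 1 zero_le_one (2 * (φ (y 0) : ℝ))))
          else r (Function.update (fun i => y i.castSucc) 0
            (Set.projIcc 0 1 zero_le_one (2 * (φ (y 0) : ℝ) - 1)))).1 (y (Fin.last _)) := by
    rw [RelLoop.cube, ContinuousMap.coe_mk, hlast, hinit, GenLoop.transAt, GenLoop.coe_copy]
    simp only [Function.update_self, Function.update_idem]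
  constructor
  · refine ContinuousMap.ext fun y => ?_
    have h1 := (y 0).2.2
    rw [ContinuousMap.comp_apply, key, coe_leftHalf, if_pos (by linarith),
      mul_div_cancel₀ _ two_ne_zero, Set.projIcc_val, hz, Function.update_eq_self]
    rfl
  · refine ContinuousMap.ext fun y => ?_
    have h0 := (y 0).2.1
    rw [ContinuousMap.comp_apply, key, coe_rightHalf]
    split_ifs with h
    -- The right half meets the branch for `≤ 1/2` only on the middle wall, where both factors take
    -- the base value.
    · have hy : y 0 = 0 := Subtype.ext (le_antisymm (by rw [Set.Icc.coe_zero]; linarith) h0)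
      rw [r.cube_eq_base y (Or.inr ⟨0, Or.inl hy⟩)]
      exact congrArg (fun γ : PathFiber A (x : X) => γ.1 (y (Fin.last _))) (q.2 _ ⟨0, Or.inr (by
        rw [Function.update_self]
        exact clamp_eq_one (by rw [hy]; norm_num))⟩)
    · rw [mul_div_cancel₀ _ two_ne_zero, add_sub_cancel_left, Set.projIcc_val, hz,
        Function.update_eq_self]
      rfl

theorem RelLoop.transAt_eq {p q r : RelLoop x n}
    (hp : p.cube.comp (coordMap 0 leftHalf) = q.cube)
    (hq : p.cube.comp (coordMap 0 rightHalf) = r.cube) : GenLoop.transAt 0 q r = p := by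
  have key (φ : C(unitInterval, unitInterval)) (q : RelLoop x n)
      (h : p.cube.comp (coordMap 0 φ) = q.cube) (y : Cube (n + 1)) (u : unitInterval)
      (hu : φ u = y 0) : q (Function.update y 0 u) = p y := by
    rw [← p.ofCube_of_cube, ← q.ofCube_of_cube]
    refine Subtype.ext (ContinuousMap.ext fun t => ?_)
    rw [ofCube_apply, ofCube_apply, ← h, ContinuousMap.comp_apply]
    congr 1
    have h0 : (0 : Fin (n + 2)) = (0 : Fin (n + 1)).castSucc := rfl
    simp only [coordMap, ContinuousMap.coe_mk]
    rw [h0, Fin.snoc_castSucc, Function.update_self, hu, ← Fin.snoc_update,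
      Function.update_idem, Function.update_eq_self]
  refine GenLoop.ext _ _ fun y => ?_
  rw [GenLoop.transAt, GenLoop.coe_copy]
  have := (y 0).2.1; have := (y 0).2.2
  split_ifs with h
  · refine key leftHalf q hp y _ (Subtype.ext ?_)
    rw [coe_leftHalf]
    change (clamp (2 * y 0) : ℝ) / 2 = _
    rw [coe_clamp, min_eq_right (by linarith), max_eq_right (by linarith)]; ring
  · refine key rightHalf r hq y _ (Subtype.ext ?_)
    rw [coe_rightHalf]
    change (1 + (clamp (2 * y 0 - 1) : ℝ)) / 2 = _
    rw [coe_clamp, min_eq_right (by linarith), max_eq_right (by linarith)]; ring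

/-- Normalise `f` on the box and on the middle wall at the same time. Both halves are then maps of
triples and the whole is their concatenation, so additivity becomes the relation `(ab) ⊗ l = a ⊗ l +
b ⊗ l`. -/
theorem cubeClass_split (hA : ∀ a : A, Joined a x) {f : C(Cube (n + 2), X)} (hf : PairMap A f)
    (hw : ∀ y : Cube (n + 2), (y 0 : ℝ) = 1 / 2 → f y ∈ A) (l : L.Fiber (f 0)) :
    cubeClass L x f l =
      cubeClass L x (f.comp (coordMap 0 leftHalf))
        (L.castFiber (by rw [ContinuousMap.comp_apply, coordMap_leftHalf_zero]) l) +
      cubeClass L x (f.comp (coordMap 0 rightHalf)) (L.along f 0 (coordMap 0 rightHalf 0) l) := by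
  let w : Fin (n + 1) → Walls := fun i => if i = 0 then Walls.middle else Walls.ends
  have hz : (0 : Fin (n + 2)) = (0 : Fin (n + 1)).castSucc := rfl
  have hmem {y : Cube (n + 2)} : y ∈ wallSet w ↔ y ∈ boxSet (n + 1) ∨ (y 0 : ℝ) = 1 / 2 := by
    constructor
    · rintro (h | ⟨i, hi⟩)
      · exact Or.inl (Or.inl h)
      · by_cases h : i = 0
        · subst h
          simp only [w, if_pos] at hi
          rcases hi with hi | hi | hi
          · exact Or.inl (Or.inr ⟨0, Or.inl hi⟩)
          · exact Or.inl (Or.inr ⟨0, Or.inr hi⟩)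
          · exact Or.inr hi
        · simp only [w, if_neg h] at hi
          exact Or.inl (Or.inr ⟨i, hi⟩)
    · rintro ((h | ⟨i, hi⟩) | h)
      · exact Or.inl h
      · refine Or.inr ⟨i, ?_⟩
        by_cases h : i = 0
        · subst h
          simp only [w, if_pos]
          exact hi.elim Or.inl (fun h => Or.inr (Or.inl h))
        · simp only [w, if_neg h]
          exact hi
      · refine Or.inr ⟨0, ?_⟩
        simp only [w, if_pos]
        exact Or.inr (Or.inr h)
  obtain ⟨g, hg, ⟨H⟩⟩ := exists_homotopy_normalised w f (A := A) (fun y hy => by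
    rcases hy with hy | hy
    · exact hf y (mem_boundary_iff.2 (Or.inl hy))
    · rcases hmem.1 hy with hy | hy
      · exact hf y (mem_boundary_iff.2 (Or.inr hy))
      · exact hw y hy) (hA _)
  have hcoord (φ : C(unitInterval, unitInterval)) (h0 : φ 0 = 0 ∨ (φ 0 : ℝ) = 1 / 2)
      (h1 : φ 1 = 1 ∨ (φ 1 : ℝ) = 1 / 2) (y : Cube (n + 2)) :
      (y (Fin.last _) = 0 → coordMap 0 φ y (Fin.last _) = 0) ∧
        (y ∈ boxSet (n + 1) → coordMap 0 φ y ∈ wallSet w) := by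
    have hne : Fin.last (n + 1) ≠ 0 := Fin.last_pos.ne'
    have hl : coordMap 0 φ y (Fin.last _) = y (Fin.last _) := by simp [coordMap, hne]
    refine ⟨fun h => hl.trans h, ?_⟩
    rintro (h | ⟨i, hi⟩)
    · exact Or.inl (hl.trans h)
    · rw [hmem]
      by_cases h : i = 0
      · subst h
        have e : coordMap 0 φ y 0 = φ (y 0) := by simp [coordMap]
        have : (φ (y 0) = 0 ∨ φ (y 0) = 1) ∨ (φ (y 0) : ℝ) = 1 / 2 := by
          rcases hi with hi | hi <;> rw [← hz] at hi <;> rw [hi] <;> tauto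
        rw [← e] at this
        exact this.imp (fun h => Or.inr ⟨0, h⟩) id
      · have hi0 : i.castSucc ≠ 0 := fun h' => h (Fin.castSucc_injective _ h')
        left; right
        exact ⟨i, by simpa [coordMap, hi0] using hi⟩
  have hgA : ∀ y, y (Fin.last _) = 0 ∨ y ∈ wallSet w → g y ∈ A := by
    intro y hy
    have := H.prop 1 y hy
    rwa [ContinuousMap.Homotopy.curry_one] at this
  have hleft := hcoord leftHalf (Or.inl (by ext; simp)) (Or.inr (by simp))
  have hright := hcoord rightHalf (Or.inr (by simp)) (Or.inl (by ext; simp))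
  have htri (φ : C(unitInterval, unitInterval)) (hφ : ∀ y : Cube (n + 2),
      (y (Fin.last _) = 0 → coordMap 0 φ y (Fin.last _) = 0) ∧
        (y ∈ boxSet (n + 1) → coordMap 0 φ y ∈ wallSet w)) :
      TripleMap x (g.comp (coordMap 0 φ)) :=
    ⟨fun y hy => hgA _ (Or.inl ((hφ y).1 hy)), fun y hy => hg _ ((hφ y).2 hy)⟩
  have hgt : TripleMap x g := ⟨fun y hy => hgA _ (Or.inl hy), fun y hy => hg _ (hmem.2 (Or.inl hy))⟩
  let p : RelLoop x n := ofCube x g hgt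
  let q : RelLoop x n := ofCube x _ (htri _ hleft)
  let r : RelLoop x n := ofCube x _ (htri _ hright)
  have hp : p.cube = g := RelLoop.ofCube_cube _ _
  have hq : q.cube = g.comp (coordMap 0 leftHalf) := RelLoop.ofCube_cube _ _
  have hr : r.cube = g.comp (coordMap 0 rightHalf) := RelLoop.ofCube_cube _ _
  -- By `mul_spec` the concatenation with `q` on the left half and `r` on the right represents `r *
  -- q`, so the summands have to be exchanged afterwards.
  have hmul : p.toPi = r.toPi * q.toPi := by
    have h1 : GenLoop.transAt 0 q r = p := RelLoop.transAt_eq (by rw [hp, hq]) (by rw [hp, hr])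
    exact (congrArg (Quotient.mk _) h1).symm.trans 
      (HomotopyGroup.mul_spec (N := Fin (n + 1)) (i := 0)).symm
  let Hp : f.HomotopyWith p.cube (PairMap A) :=
    { H.toHomotopy.cast rfl hp.symm with
      prop' := fun t y hy => H.prop t y ((mem_boundary_iff.1 hy).imp id (fun h => hmem.2 (Or.inl h))) }
  let Hφ (φ : C(unitInterval, unitInterval)) (hφ : ∀ y : Cube (n + 2),
      (y (Fin.last _) = 0 → coordMap 0 φ y (Fin.last _) = 0) ∧
        (y ∈ boxSet (n + 1) → coordMap 0 φ y ∈ wallSet w)) (s : RelLoop x n)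
      (hs : s.cube = g.comp (coordMap 0 φ)) :
      (f.comp (coordMap 0 φ)).HomotopyWith s.cube (PairMap A) :=
    { toFun := fun z => H (z.1, coordMap 0 φ z.2)
      continuous_toFun := by fun_prop
      map_zero_left := fun y => by simp
      map_one_left := fun y => by simp [hs]
      prop' := fun t y hy => H.prop t _
        ((mem_boundary_iff.1 hy).imp (hφ y).1 (hφ y).2) }
  have htr (φ) (hφ) (s : RelLoop x n) (hs : s.cube = g.comp (coordMap 0 φ))
      (l : L.Fiber (f (coordMap 0 φ 0))) :
      L.castFiber s.cube_zero (L.trace (Hφ φ hφ s hs).toHomotopy 0 l) =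
        L.castFiber (by rw [← s.cube_zero, hs]; rfl) (L.trace H.toHomotopy (coordMap 0 φ 0) l) := by
    rw [← L.castFiber_castFiber (congrArg (fun h : C(Cube (n + 2), X) => h 0) hs.symm) s.cube_zero]
    congr 1
    exact (L.transport_cast (H.toHomotopy.evalAt (coordMap 0 φ 0)) rfl
      (congrArg (fun h : C(Cube (n + 2), X) => h 0) hs) l).trans (by rw [L.castFiber_rfl]; rfl)
  rw [cubeClass_eq L p Hp, hmul, mul_tmul, add_comm,
    cubeClass_eq L q (Hφ _ hleft q hq), cubeClass_eq L r (Hφ _ hright r hr),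
    htr _ hleft q hq, htr _ hright r hr]
  have hpt : L.castFiber p.cube_zero (L.trace Hp.toHomotopy 0 l) =
      L.castFiber (by rw [← p.cube_zero, hp]) (L.trace H.toHomotopy 0 l) := by
    rw [← L.castFiber_castFiber (congrArg (fun h : C(Cube (n + 2), X) => h 0) hp.symm) p.cube_zero]
    congr 1
    exact (L.transport_cast (H.toHomotopy.evalAt 0) rfl
      (congrArg (fun h : C(Cube (n + 2), X) => h 0) hp) l).trans (by rw [L.castFiber_rfl]; rfl)
  rw [hpt]
  congr 2
  · rw [L.trace_castFiber _ (coordMap_leftHalf_zero 0).symm, L.castFiber_castFiber]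
  · rw [L.trace_along]
    -- The vertex of the right half is reached from `0` within the box and the middle wall. There
    -- `g` is constant, so the coefficient arrives unchanged.
    obtain ⟨γ, hγ⟩ := exists_path_rightHalf n
    have hγ (t) : g (γ t) = x := hg _ (hmem.2 (hγ t))
    rw [L.along_of_const g γ (fun t => by rw [hγ, ← hγ 0, γ.source]), L.castFiber_castFiber]

end CubeClass

/-! ### Dilations and facets of the simplex -/

section Simplex

variable {d : ℕ}

theorem Simplex.ext_apply {y z : Simplex d} (h : ∀ i, y i = z i) : y = z :=
  stdSimplex.ext (funext h)

@[fun_prop]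
theorem continuous_simplex_apply (i : Fin (d + 1)) : Continuous fun y : Simplex d => y i :=
  (continuous_apply i).comp continuous_subtype_val

/-- The affine function on the simplex that is `1` on the `i`-th facet and `0` at the
barycenter. -/
def height (y : Simplex d) (i : Fin (d + 1)) : ℝ := 1 - (d + 1) * y i

@[fun_prop]
theorem continuous_height (i : Fin (d + 1)) : Continuous fun y : Simplex d => height y i := by
  unfold height; fun_prop

theorem height_le_one (y : Simplex d) (i : Fin (d + 1)) : height y i ≤ 1 := by
  have := mul_nonneg (by positivity : (0 : ℝ) ≤ d + 1) (stdSimplex.zero_le y i)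
  unfold height; linarith

theorem height_eq_one {y : Simplex d} {i : Fin (d + 1)} : height y i = 1 ↔ y i = 0 := by
  have : (d + 1 : ℝ) ≠ 0 := by positivity
  simp [height, this]

theorem ext_height {y z : Simplex d} (h : ∀ i, height y i = height z i) : y = z :=
  Simplex.ext_apply fun i => by
    have h1 := h i
    have : (d + 1 : ℝ) ≠ 0 := by positivity
    simpa [height, this] using h1

theorem sum_height (y : Simplex d) : ∑ i, height y i = 0 := by
  simp [height, Finset.sum_sub_distrib, ← Finset.mul_sum, stdSimplex.sum_eq_one]

/-- The gauge of the simplex, centred at the barycenter. -/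
def gauge (y : Simplex d) : ℝ := Finset.univ.sup' Finset.univ_nonempty (height y)

@[fun_prop]
theorem continuous_gauge : Continuous (gauge : Simplex d → ℝ) :=
  Continuous.finset_sup'_apply _ fun i _ => continuous_height i

theorem height_le_gauge (y : Simplex d) (i : Fin (d + 1)) : height y i ≤ gauge y :=
  Finset.le_sup' _ (Finset.mem_univ i)

theorem exists_height_eq_gauge (y : Simplex d) : ∃ i, height y i = gauge y :=
  let ⟨i, _, hi⟩ := Finset.exists_mem_eq_sup' Finset.univ_nonempty (height y)
  ⟨i, hi.symm⟩

theorem gauge_le_one (y : Simplex d) : gauge y ≤ 1 :=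
  Finset.sup'_le _ _ fun i _ => height_le_one y i

theorem gauge_eq_one {y : Simplex d} {i : Fin (d + 1)} (h : y i = 0) : gauge y = 1 :=
  (gauge_le_one y).antisymm ((height_eq_one.2 h).symm.le.trans (height_le_gauge y i))

/-- The factor of the dilation `dilate`. -/
def dilateFactor (c : ℝ) (y : Simplex d) : ℝ := max (gauge y) (max c (1 / 2))

@[fun_prop]
theorem continuous_dilateFactor :
    Continuous fun p : ℝ × Simplex d => dilateFactor p.1 p.2 := by
  unfold dilateFactor; fun_prop

theorem dilateFactor_pos (c : ℝ) (y : Simplex d) : 0 < dilateFactor c y :=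
  one_half_pos.trans_le ((le_max_right _ _).trans (le_max_right _ _))

/-- The dilation by the inverse of `c`, centred at the barycenter, where `c` is increased to
`gauge y`, if necessary, to stay in the simplex, and to `1 / 2`. -/
def dilate (c : ℝ) (y : Simplex d) : Simplex d :=
  ⟨fun i => (1 - height y i / dilateFactor c y) / (d + 1), by
    have h0 := dilateFactor_pos c y
    refine ⟨fun i => div_nonneg (sub_nonneg.2 ?_) (by positivity), ?_⟩
    · exact (div_le_one h0).2 ((height_le_gauge y i).trans (le_max_left _ _))
    · rw [← Finset.sum_div, Finset.sum_sub_distrib, ← Finset.sum_div, sum_height]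
      have : (d + 1 : ℝ) ≠ 0 := by positivity
      simp [this]⟩

theorem height_dilate (c : ℝ) (y : Simplex d) (i : Fin (d + 1)) :
    height (dilate c y) i = height y i / dilateFactor c y := by
  change 1 - (d + 1) * ((1 - height y i / dilateFactor c y) / (d + 1)) = _
  field_simp
  ring

theorem continuous_dilate : Continuous fun p : ℝ × Simplex d => dilate p.1 p.2 := by
  refine Continuous.subtype_mk (continuous_pi fun i => Continuous.div_const ?_ _) _
  refine continuous_const.sub (Continuous.div (by fun_prop) (by fun_prop) fun p => ?_)
  exact (dilateFactor_pos _ _).ne'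

@[fun_prop]
theorem Continuous.dilate {Y : Type*} [TopologicalSpace Y] {c : Y → ℝ} {f : Y → Simplex d}
    (hc : Continuous c) (hf : Continuous f) : Continuous fun y => dilate (c y) (f y) :=
  continuous_dilate.comp (hc.prodMk hf)

theorem gauge_dilate (c : ℝ) (y : Simplex d) :
    gauge (dilate c y) = gauge y / dilateFactor c y := by
  have h0 := dilateFactor_pos c y
  refine le_antisymm (Finset.sup'_le _ _ fun i _ => ?_) ?_
  · rw [height_dilate]
    exact div_le_div_of_nonneg_right (height_le_gauge y i) h0.le
  · obtain ⟨i, hi⟩ := exists_height_eq_gauge y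
    rw [← hi, ← height_dilate]
    exact height_le_gauge _ _

theorem dilate_dilate {c c' : ℝ} {y : Simplex d}
    (h : dilateFactor c y * dilateFactor c' (dilate c y) = 1) :
    dilate c' (dilate c y) = y :=
  ext_height fun i => by rw [height_dilate, height_dilate, div_div, h, div_one]

/-- The affine path between two points of the simplex. -/
def simplexLerp (s : unitInterval) (y z : Simplex d) : Simplex d :=
  ⟨fun i => (1 - s) * y i + s * z i, by
    have := s.2.1; have := s.2.2
    refine ⟨fun i => ?_, ?_⟩
    · have := mul_nonneg (sub_nonneg.2 s.2.2) (stdSimplex.zero_le y i)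
      have := mul_nonneg s.2.1 (stdSimplex.zero_le z i)
      linarith
    · rw [Finset.sum_add_distrib, ← Finset.mul_sum, ← Finset.mul_sum, stdSimplex.sum_eq_one,
        stdSimplex.sum_eq_one]
      ring⟩

theorem simplexLerp_apply (s : unitInterval) (y z : Simplex d) (i : Fin (d + 1)) :
    simplexLerp s y z i = (1 - s) * y i + s * z i := rfl

@[fun_prop]
theorem Continuous.simplexLerp {Y : Type*} [TopologicalSpace Y] {s : Y → unitInterval}
    {f g : Y → Simplex d} (hs : Continuous s) (hf : Continuous f) (hg : Continuous g) :
    Continuous fun y => simplexLerp (s y) (f y) (g y) := by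
  refine Continuous.subtype_mk (continuous_pi fun i => ?_) _
  exact ((continuous_const.sub (continuous_subtype_val.comp hs)).mul
    ((continuous_simplex_apply i).comp hf)).add
    ((continuous_subtype_val.comp hs).mul ((continuous_simplex_apply i).comp hg))

theorem faceMap_injective (i : Fin (d + 2)) : Function.Injective (faceMap d i) := fun y z h =>
  Simplex.ext_apply fun l => by
    rw [← faceMap_apply_succAbove i y, h, faceMap_apply_succAbove]

theorem exists_faceMap_eq {y : Simplex (d + 1)} {i : Fin (d + 2)} (h : y i = 0) :
    ∃ z, faceMap d i z = y := by
  refine ⟨⟨fun l => y (i.succAbove l), fun l => stdSimplex.zero_le y _, ?_⟩,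
    Simplex.ext_apply fun j => ?_⟩
  · have := stdSimplex.sum_eq_one y
    rwa [Fin.sum_univ_succAbove _ i, h, zero_add] at this
  · rcases Fin.eq_self_or_eq_succAbove i j with rfl | ⟨l, rfl⟩
    · rw [faceMap_apply_self, h]
    · rw [faceMap_apply_succAbove]; rfl

/-- The affine retraction of the simplex onto its `i`-th facet that takes the vertex `i` to the
vertex `0` of the facet or to the next one. -/
def facetRetraction (d : ℕ) (i : Fin (d + 2)) : C(Simplex (d + 1), Simplex d) :=
  ⟨stdSimplex.map (Function.invFun i.succAbove), stdSimplex.continuous_map _⟩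

theorem facetRetraction_faceMap (i : Fin (d + 2)) (z : Simplex d) :
    facetRetraction d i (faceMap d i z) = z := by
  change stdSimplex.map _ (stdSimplex.map _ z) = z
  rw [stdSimplex.map_comp_apply, (Function.leftInverse_invFun
    Fin.succAbove_right_injective).comp_eq_id, stdSimplex.map_id_apply]

theorem faceMap_facetRetraction {y : Simplex (d + 1)} {i : Fin (d + 2)} (h : y i = 0) :
    faceMap d i (facetRetraction d i y) = y := by
  obtain ⟨z, rfl⟩ := exists_faceMap_eq h
  rw [facetRetraction_faceMap]

/-- Two distinct facets of a simplex meet in a common facet. -/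
theorem exists_common_facet {i j : Fin (d + 3)} (hij : i < j) {y z : Simplex (d + 1)}
    (h : faceMap (d + 1) i y = faceMap (d + 1) j z) : ∃ (i' j' : Fin (d + 2)) (v : Simplex d),
      y = faceMap d j' v ∧ z = faceMap d i' v ∧
      (faceMap (d + 1) i).comp (faceMap d j') = (faceMap (d + 1) j).comp (faceMap d i') := by
  obtain ⟨j', rfl⟩ : ∃ j' : Fin (d + 2), j = j'.succ :=
    ⟨j.pred (Fin.ne_zero_of_lt hij), (Fin.succ_pred _ _).symm⟩
  obtain ⟨i', rfl⟩ : ∃ i' : Fin (d + 2), i = i'.castSucc :=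
    ⟨i.castPred (Fin.ne_last_of_lt hij), (Fin.castSucc_castPred _ _).symm⟩
  have hle : i' ≤ j' := Fin.castSucc_lt_succ_iff.1 hij
  have hz : z i' = 0 := by
    rw [← faceMap_apply_succAbove j'.succ z i', ← h, Fin.succAbove_of_castSucc_lt _ _ hij,
      faceMap_apply_self]
  obtain ⟨v, rfl⟩ := exists_faceMap_eq hz
  have hc := faceMap_comp d hle
  refine ⟨i', j', v, faceMap_injective i'.castSucc ?_, rfl, hc.symm⟩
  rw [h]
  exact DFunLike.congr_fun hc v

end Simplex

/-! ### Maps of a simplex with boundary in a subspace -/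

/-- A section, up to homotopy, of the map from the cube to the simplex. -/
def simplexToCube (d : ℕ) : C(Simplex d, Cube d) :=
  -- The factor `d` makes the last facet go to the boundary too: when the last coordinate vanishes,
  -- one of the other `d` is at least `1 / d`.
  ⟨fun t i => clamp (1 - d * t i.castSucc), by fun_prop⟩

theorem simplexToCube_of_eq_zero {d : ℕ} {t : Simplex d} {i : Fin d} (h : t i.castSucc = 0) :
    simplexToCube d t i = 1 := clamp_eq_one (by simp [h])

theorem exists_simplexToCube_eq_zero {d : ℕ} (hd : d ≠ 0) {t : Simplex d} (h : t (Fin.last d) = 0) :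
    ∃ i, simplexToCube d t i = 0 := by
  by_contra! hne
  have hlt (i : Fin d) : d * t i.castSucc < 1 := by
    by_contra! hi
    exact hne i (clamp_eq_zero (by linarith))
  have : NeZero d := ⟨hd⟩
  have h1 := stdSimplex.sum_eq_one t
  rw [Fin.sum_univ_castSucc, h, add_zero] at h1
  have h2 := Finset.sum_lt_sum_of_nonempty (Finset.univ_nonempty (α := Fin d)) fun i _ => hlt i
  rw [← Finset.mul_sum, h1] at h2
  simp at h2

theorem simplexToCube_boundary {d : ℕ} (hd : d ≠ 0) {t : Simplex d} {j : Fin (d + 1)}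
    (h : t j = 0) : simplexToCube d t ∈ Cube.boundary (Fin d) := by
  induction j using Fin.lastCases with
  | last =>
    obtain ⟨i, hi⟩ := exists_simplexToCube_eq_zero hd h
    exact ⟨i, Or.inl hi⟩
  | cast i => exact ⟨i, Or.inr (simplexToCube_of_eq_zero h)⟩

/-- The composite self map of the simplex preserves each facet. Hence its straight-line homotopy to
the identity keeps the boundary in the boundary. -/
theorem cubeToSimplex_simplexToCube_eq_zero {d : ℕ} (hd : d ≠ 0) {t : Simplex d} {j : Fin (d + 1)}
    (h : t j = 0) : cubeToSimplex d (simplexToCube d t) j = 0 := by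
  induction j using Fin.lastCases with
  | last =>
    obtain ⟨i, hi⟩ := exists_simplexToCube_eq_zero hd h
    exact cubeToSimplex_of_eq_zero hi (Fin.castSucc_lt_last i)
  | cast i => exact cubeToSimplex_of_eq_one (simplexToCube_of_eq_zero h)

section Deformation

variable {X : Type u} [TopologicalSpace X] {A : Set X}

/-- A map of a simplex that takes the boundary to `A` can be deformed to `A` if the relative
homotopy set is trivial. -/
theorem exists_homotopy_into {x : A} (hA : ∀ a : A, Joined a x) {d : ℕ}
    (h : Subsingleton (RelPi x (d + 1))) {f : C(Simplex (d + 1), X)}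
    (hf : ∀ y, (∃ j, y j = 0) → f y ∈ A) :
    ∃ H : C(unitInterval × Simplex (d + 1), X), (∀ y, H (0, y) = f y) ∧
      (∀ t y, (∃ j, y j = 0) → H (t, y) ∈ A) ∧ ∀ y, H (1, y) ∈ A := by
  have hp : PairMap A (f.comp (cubeToSimplex (d + 1))) := fun y hy =>
    hf _ (cubeToSimplex_boundary hy)
  obtain ⟨g, hg, ⟨K⟩⟩ := hp.exists_tripleMap hA
  obtain ⟨K'⟩ := hg.homotopic_const h
  let N := K.trans K'
  -- First `f` is replaced, through maps of pairs, by a map factoring through the cube; then the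
  -- contraction `N` of the cube is pulled back.
  let H₀ : f.Homotopy ((f.comp (cubeToSimplex (d + 1))).comp (simplexToCube (d + 1))) :=
    { toFun := fun p => f (simplexLerp p.1 p.2 (cubeToSimplex _ (simplexToCube _ p.2)))
      continuous_toFun := by fun_prop
      map_zero_left := fun y => by
        congr 1; exact Simplex.ext_apply fun i => by simp [simplexLerp_apply]
      map_one_left := fun y => by
        simp only [ContinuousMap.comp_apply]
        congr 1; exact Simplex.ext_apply fun i => by simp [simplexLerp_apply] }
  let H₁ : ((f.comp (cubeToSimplex (d + 1))).comp (simplexToCube (d + 1))).Homotopy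
      ((ContinuousMap.const _ (x : X)).comp (simplexToCube (d + 1))) :=
    { toFun := fun p => N (p.1, simplexToCube _ p.2)
      continuous_toFun := by fun_prop
      map_zero_left := fun y => by simp
      map_one_left := fun y => by simp }
  refine ⟨(H₀.trans H₁).toContinuousMap, fun y => (H₀.trans H₁).apply_zero y, fun t y hy => ?_,
    fun y => ?_⟩
  · change (H₀.trans H₁) (t, y) ∈ A
    obtain ⟨j, hj⟩ := hy
    rw [ContinuousMap.Homotopy.trans_apply]
    split_ifs with ht
    · refine hf _ ⟨j, ?_⟩
      rw [simplexLerp_apply, hj, cubeToSimplex_simplexToCube_eq_zero (Nat.succ_ne_zero d) hj]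
      ring
    · exact N.prop _ _ (simplexToCube_boundary (Nat.succ_ne_zero d) hj)
  · change (H₀.trans H₁) (1, y) ∈ A
    rw [ContinuousMap.Homotopy.apply_one]
    exact x.2

/-- Gluing of continuous maps along a finite closed cover. -/
theorem exists_glue {Z ι : Type*} [TopologicalSpace Z] [Finite ι] (C : ι → Set Z)
    (hC : ∀ i, IsClosed (C i)) (hcov : ∀ z, ∃ i, z ∈ C i) (p : ι → C(Z, X))
    (hp : ∀ i j z, z ∈ C i → z ∈ C j → p i z = p j z) :
    ∃ f : C(Z, X), ∀ i, ∀ z ∈ C i, f z = p i z := by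
  choose c hc using hcov
  have key : ∀ i, ∀ z ∈ C i, p (c z) z = p i z := fun i z hz => hp _ _ z (hc z) hz
  refine ⟨⟨fun z => p (c z) z, (locallyFinite_of_finite C).continuous ?_ hC fun i => ?_⟩, key⟩
  · exact Set.eq_univ_of_forall fun z => Set.mem_iUnion.2 ⟨_, hc z⟩
  · exact (p i).continuous.continuousOn.congr (key i)

/-- A system of deformations of the singular simplices of a fixed dimension. -/
structure Deformation (A : Set X) (k m : ℕ) where
  /-- The deformation of a simplex. -/
  map : C(Simplex m, X) → C(unitInterval × Simplex m, X)
  map_zero : ∀ (σ : C(Simplex m, X)) (y : Simplex m), map σ (0, y) = σ y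
  map_const : ∀ σ : C(Simplex m, X), Set.range σ ⊆ A → ∀ t y, map σ (t, y) = σ y
  map_one : m < k → ∀ σ y, map σ (1, y) ∈ A
  -- Wherever two facets of a simplex meet, their deformations agree, so they glue to a deformation
  -- of the boundary.
  map_face : ∀ (τ : C(Simplex (m + 1), X)) (i j : Fin (m + 2)) (y z : Simplex m) (t : unitInterval),
    faceMap m i y = faceMap m j z →
      map (τ.comp (faceMap m i)) (t, y) = map (τ.comp (faceMap m j)) (t, z)

open scoped Classical in
/-- The deformation of points along paths to the base point. -/
def deformationZero [PathConnectedSpace X] (x : A) (k : ℕ) : Deformation A k 0 where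
  map σ := if Set.range σ ⊆ A then ⟨fun p => σ p.2, by fun_prop⟩ else
    ⟨fun p => PathConnectedSpace.somePath (σ (e0 0)) x p.1, by fun_prop⟩
  map_zero σ y := by
    split_ifs
    · rfl
    · exact (Path.source _).trans (congrArg σ (Subsingleton.elim _ _))
  map_const σ h t y := by rw [if_pos h]; rfl
  map_one _ σ y := by
    split_ifs with h
    · exact h (Set.mem_range_self y)
    · change PathConnectedSpace.somePath (σ (e0 0)) x 1 ∈ A
      rw [Path.target]; exact x.2
  map_face τ i j y z t h := by
    -- Distinct facets of the 1-simplex are disjoint points.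
    have hij : i = j := by
      by_contra hne
      obtain ⟨l, rfl⟩ := Fin.exists_succAbove_eq hne
      have h1 := faceMap_apply_succAbove j z l
      rw [← h, faceMap_apply_self] at h1
      have h2 := stdSimplex.sum_eq_one z
      rw [Fin.sum_univ_one, ← Subsingleton.elim l 0, ← h1] at h2
      exact zero_ne_one h2
    subst hij
    rw [faceMap_injective i h]

/-- The extension of a deformation of the boundary of a simplex to the whole simplex. -/
theorem Deformation.exists_extension {x : A} (hA : ∀ a : A, Joined a x) {k m : ℕ}
    (hlow : m + 1 < k → Subsingleton (RelPi x (m + 1))) (D : Deformation A k m)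
    (σ : C(Simplex (m + 1), X)) : ∃ P : C(unitInterval × Simplex (m + 1), X),
      (∀ y, P (0, y) = σ y) ∧ (m + 1 < k → ∀ y, P (1, y) ∈ A) ∧
      ∀ i t y, P (t, faceMap m i y) = D.map (σ.comp (faceMap m i)) (t, y) := by
  have hface {i : Fin (m + 2)} {y : Simplex (m + 1)} (h : y i = 0) (t : unitInterval)
      {j : Fin (m + 2)} (h' : y j = 0) :
      D.map (σ.comp (faceMap m i)) (t, facetRetraction m i y) =
        D.map (σ.comp (faceMap m j)) (t, facetRetraction m j y) :=
    D.map_face σ i j _ _ t (by rw [faceMap_facetRetraction h, faceMap_facetRetraction h'])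
  -- The glued map `f` is `σ`, scaled down, on the inner simplex `gauge ≤ 1/2`. On the surrounding
  -- collar it is the deformation of the boundary, with the radius in the role of time. One piece of
  -- the cover is the inner simplex, and one lies over each facet.
  let C : Option (Fin (m + 2)) → Set (Simplex (m + 1)) := fun o => o.elim {z | gauge z ≤ 1 / 2}
    fun i => {z | 1 / 2 ≤ gauge z ∧ height z i = gauge z}
  -- Chosen so that radius `1/2` has time `0`, radius `1` has time `1`, and radius `1 / (2 - t)` has
  -- time `t`.
  let time (z : Simplex (m + 1)) : unitInterval := clamp (2 - 1 / max (gauge z) (1 / 2))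
  have htime : Continuous time := by
    refine continuous_clamp.comp (continuous_const.sub (continuous_const.div (by fun_prop) ?_))
    exact fun z => (one_half_pos.trans_le (le_max_right _ _)).ne'
  let p : Option (Fin (m + 2)) → C(Simplex (m + 1), X) := fun o =>
    o.elim (σ.comp ⟨dilate (1 / 2), by fun_prop⟩) fun i =>
      (D.map (σ.comp (faceMap m i))).comp
        ⟨fun z => (time z, facetRetraction m i (dilate (1 / 2) z)), by fun_prop⟩
  have hdil {z : Simplex (m + 1)} {i : Fin (m + 2)} (hz : 1 / 2 ≤ gauge z)
      (hi : height z i = gauge z) : dilate (1 / 2) z i = 0 := by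
    rw [← height_eq_one, height_dilate, hi, dilateFactor, max_self, max_eq_left hz, div_self]
    linarith
  have hnone (z : Simplex (m + 1)) (i) (hz : gauge z ≤ 1 / 2)
      (hz' : 1 / 2 ≤ gauge z ∧ height z i = gauge z) : p none z = p (some i) z := by
    have ht : time z = 0 := clamp_eq_zero (by rw [max_eq_right hz]; norm_num)
    change σ (dilate (1 / 2) z) = D.map (σ.comp (faceMap m i)) (time z, _)
    rw [ht, D.map_zero, ContinuousMap.comp_apply, faceMap_facetRetraction (hdil hz'.1 hz'.2)]
  obtain ⟨f, hf⟩ := exists_glue C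
    (by
      rintro (_ | i)
      · exact isClosed_le continuous_gauge continuous_const
      · exact (isClosed_le continuous_const continuous_gauge).inter
          (isClosed_eq (continuous_height i) continuous_gauge))
    (fun z => by
      rcases le_total (gauge z) (1 / 2) with h | h
      · exact ⟨none, h⟩
      · obtain ⟨i, hi⟩ := exists_height_eq_gauge z
        exact ⟨some i, h, hi⟩) p
    (by
      rintro (_ | i) (_ | j) z hi hj
      · rfl
      · exact hnone z j hi hj
      · exact (hnone z i hj hi).symm
      · exact hface (hdil hi.1 hi.2) _ (hdil hj.1 hj.2))
  have hfA (hk : m + 1 < k) (y : Simplex (m + 1)) (hy : ∃ j, y j = 0) : f y ∈ A := by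
    obtain ⟨j, hj⟩ := hy
    have hg := gauge_eq_one hj
    rw [hf (some j) y ⟨by rw [hg]; norm_num, by rw [hg, height_eq_one.2 hj]⟩]
    have ht : time y = 1 := clamp_eq_one (by rw [hg, max_eq_left (by norm_num)]; norm_num)
    change D.map (σ.comp (faceMap m j)) (time y, _) ∈ A
    rw [ht]
    exact D.map_one (by omega) _ _
  -- Below dimension `k` the boundary of `f` already lies in `A`, and the vanishing of the relative
  -- homotopy pushes the rest there. From dimension `k` on nothing is required, and `N` is constant.
  obtain ⟨N, hN0, hN1, hN2⟩ : ∃ N : C(unitInterval × Simplex (m + 1), X),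
      (∀ y, N (0, y) = f y) ∧ (m + 1 < k → ∀ t y, (∃ j, y j = 0) → N (t, y) ∈ A) ∧
        (m + 1 < k → ∀ y, N (1, y) ∈ A) := by
    by_cases hk : m + 1 < k
    · obtain ⟨N, h0, h1, h2⟩ := exists_homotopy_into hA (hlow hk) (hfA hk)
      exact ⟨N, h0, fun _ => h1, fun _ => h2⟩
    · exact ⟨⟨fun p => f p.2, by fun_prop⟩, fun _ => rfl, fun h => (hk h).elim,
        fun h => (hk h).elim⟩
  -- At time `0` only the inner simplex is seen, which gives `σ`. On a facet `N` stands still and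
  -- the radius is `1 / (2 - t)`, so the given deformation is read at time `t`. At time `1` a point
  -- is either dilated to the boundary, if its gauge is at least `1/2`, or carried by `N` to its
  -- end; both lie in `A` below dimension `k`.
  refine ⟨⟨fun q => N (clamp (q.1 * (2 * (1 - gauge q.2))),
    dilate (2 - q.1 - q.1 * min (1 / 2) (1 - gauge q.2)) q.2), by fun_prop⟩,
    fun y => ?_, fun hk y => ?_, fun i t y => ?_⟩
  · change N (clamp (((0 : unitInterval) : ℝ) * _), dilate (2 - ((0 : unitInterval) : ℝ) -
      ((0 : unitInterval) : ℝ) * _) y) = σ y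
    rw [Set.Icc.coe_zero, zero_mul, clamp_eq_zero le_rfl, hN0, zero_mul, sub_zero, sub_zero]
    have h2 : dilateFactor 2 y = 2 := by
      rw [dilateFactor, max_eq_left (by norm_num : (1 / 2 : ℝ) ≤ 2), max_eq_right]
      linarith [gauge_le_one y]
    have hg : gauge (dilate 2 y) ≤ 1 / 2 := by
      rw [gauge_dilate, h2]; linarith [gauge_le_one y]
    rw [hf none _ hg]
    change σ (dilate (1 / 2) (dilate 2 y)) = σ y
    rw [dilate_dilate]
    rw [h2, dilateFactor, max_self, max_eq_right hg]; norm_num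
  · change N (clamp (((1 : unitInterval) : ℝ) * _), dilate (2 - ((1 : unitInterval) : ℝ) -
      ((1 : unitInterval) : ℝ) * _) y) ∈ A
    rw [Set.Icc.coe_one, one_mul, one_mul]
    rcases le_total (gauge y) (1 / 2) with h | h
    · rw [clamp_eq_one (by linarith)]
      exact hN2 hk _
    · obtain ⟨j, hj⟩ := exists_height_eq_gauge y
      refine hN1 hk _ _ ⟨j, ?_⟩
      rw [← height_eq_one, height_dilate, hj, min_eq_right (by linarith), dilateFactor,
        max_eq_left (max_le (by linarith) h), div_self (by linarith)]
  · have hz : faceMap m i y i = 0 := faceMap_apply_self i y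
    have hg := gauge_eq_one hz
    have ht0 := t.2.1; have ht1 := t.2.2
    change N (clamp (t * (2 * (1 - gauge (faceMap m i y)))),
      dilate (2 - t - t * min (1 / 2) (1 - gauge (faceMap m i y))) (faceMap m i y)) = _
    rw [hg, sub_self, mul_zero, mul_zero, clamp_eq_zero le_rfl, hN0, min_eq_right (by norm_num),
      mul_zero, sub_zero]
    have h2 : dilateFactor (2 - t) (faceMap m i y) = 2 - t := by
      rw [dilateFactor, hg, max_eq_left (by linarith : (1 / 2 : ℝ) ≤ 2 - t),
        max_eq_right (by linarith)]
    have hg' : gauge (dilate (2 - t) (faceMap m i y)) = 1 / (2 - t) := by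
      rw [gauge_dilate, h2, hg]
    have hle : 1 / 2 ≤ 1 / (2 - (t : ℝ)) :=
      one_div_le_one_div_of_le (by linarith) (by linarith)
    have htm : time (dilate (2 - t) (faceMap m i y)) = t := by
      refine clamp_eq ?_
      rw [hg', max_eq_left hle, one_div_one_div]; ring
    rw [hf (some i) _ ⟨by rw [hg']; exact hle, by
      rw [hg', height_dilate, h2, height_eq_one.2 hz]⟩]
    change D.map (σ.comp (faceMap m i)) (time _, facetRetraction m i (dilate (1 / 2) _)) = _
    rw [htm, dilate_dilate, facetRetraction_faceMap]
    rw [h2, dilateFactor, hg', max_self, max_eq_left hle, mul_one_div_cancel (by linarith)]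

/-- Simplices in `A` stay put and the others are extended from their boundary. Agreement where
facets of the next dimension meet is automatic: the intersection lies in a common facet of both,
where both deformations restrict to `D`. -/
theorem Deformation.exists_succ {x : A} (hA : ∀ a : A, Joined a x) {k m : ℕ}
    (hlow : m + 1 < k → Subsingleton (RelPi x (m + 1))) (D : Deformation A k m) :
    ∃ D' : Deformation A k (m + 1), ∀ σ i t y,
      D'.map σ (t, faceMap m i y) = D.map (σ.comp (faceMap m i)) (t, y) := by
  have h (σ : C(Simplex (m + 1), X)) : ∃ P : C(unitInterval × Simplex (m + 1), X),
      (∀ y, P (0, y) = σ y) ∧ (Set.range σ ⊆ A → ∀ t y, P (t, y) = σ y) ∧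
      (m + 1 < k → ∀ y, P (1, y) ∈ A) ∧
      ∀ i t y, P (t, faceMap m i y) = D.map (σ.comp (faceMap m i)) (t, y) := by
    by_cases hσ : Set.range σ ⊆ A
    · refine ⟨⟨fun p => σ p.2, by fun_prop⟩, fun _ => rfl, fun _ _ _ => rfl,
        fun _ y => hσ (Set.mem_range_self y), fun i t y => ?_⟩
      rw [D.map_const _ ((Set.range_comp_subset_range (faceMap m i) σ).trans hσ)]
      rfl
    · obtain ⟨P, h0, h1, h2⟩ := D.exists_extension hA hlow σ
      exact ⟨P, h0, fun h => (hσ h).elim, h1, h2⟩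
  choose P h0 hc h1 hf using h
  have hlt (τ : C(Simplex (m + 2), X)) {i j : Fin (m + 3)} (hij : i < j) (y z : Simplex (m + 1))
      (t : unitInterval) (h : faceMap (m + 1) i y = faceMap (m + 1) j z) :
      P (τ.comp (faceMap (m + 1) i)) (t, y) = P (τ.comp (faceMap (m + 1) j)) (t, z) := by
    obtain ⟨i', j', v, rfl, rfl, hc⟩ := exists_common_facet hij h
    rw [hf, hf, ContinuousMap.comp_assoc, ContinuousMap.comp_assoc, hc]
  refine ⟨⟨P, h0, hc, fun hk σ => h1 σ hk, fun τ i j y z t h => ?_⟩, fun σ i t y => hf σ i t y⟩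
  rcases lt_trichotomy i j with hij | rfl | hij
  · exact hlt τ hij y z t h
  · rw [faceMap_injective i h]
  · exact (hlt τ hij z y t h.symm).symm

/-- A system of deformations of all singular simplices, compatible with the faces, that takes the
simplices of dimension less than `k` to `A`. -/
theorem exists_deformation [PathConnectedSpace X] {x : A} {k : ℕ} (hk : 1 < k)
    (hlow : ∀ j, 1 ≤ j → j < k → Subsingleton (RelPi x j)) :
    ∃ D : ∀ m, Deformation A k m, ∀ m σ i t y,
      (D (m + 1)).map σ (t, faceMap m i y) = (D m).map (σ.comp (faceMap m i)) (t, y) := by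
  have hA := joined_of_subsingleton x (hlow 1 le_rfl hk)
  have h (m : ℕ) (D : Deformation A k m) := D.exists_succ hA fun hm => hlow (m + 1) (by omega) hm
  choose next hnext using h
  exact ⟨fun m => Nat.rec (deformationZero x k) next m, fun m σ i t y => hnext m _ σ i t y⟩

end Deformation

/-! ### The map from chains to the tensor product -/

section ChainClass

variable {X : Type u} [TopologicalSpace X] (L : LocalSystem.{u, w} X) {A : Set X} {x : A} {n : ℕ}

/-- A functional may depend on the cube alone, so the coefficient is fixed at one point `a` of `Z`
and carried to the vertex of each cube. Simple connectedness makes it follow homotopies and halvings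
correctly. -/
theorem cubeFunctional_cubeClass (hA : ∀ a : A, Joined a x) {Z : Type*} [TopologicalSpace Z]
    [SimplyConnectedSpace Z] (g : C(Z, X)) (a : Z) (l : L.Fiber (g a)) {B : Set Z}
    (hB : ∀ z ∈ B, g z ∈ A) : CubeFunctional (0 : Fin (n + 2)) B
      fun m => cubeClass L x (g.comp m) (L.along g a (m 0) l) where
  homotopy H hH := by
    let γ : Path (H (0, (0 : Cube (n + 2)))) (H (1, 0)) :=
      { toFun := fun t => H (t, 0)
        continuous_toFun := by fun_prop
        source' := rfl
        target' := rfl }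
    let K : (g.comp (H.comp ⟨fun y => (0, y), by fun_prop⟩)).HomotopyWith
        (g.comp (H.comp ⟨fun y => (1, y), by fun_prop⟩)) (PairMap A) :=
      { toFun := fun p => g (H p)
        continuous_toFun := by fun_prop
        map_zero_left := fun y => rfl
        map_one_left := fun y => rfl
        prop' := fun t y hy => hB _ (hH t y hy) }
    rw [← cubeClass_of_homotopy L hA K]
    congr 1
    change L.transport (γ.map g.continuous) (L.along g a (H (0, 0)) l) = L.along g a (H (1, 0)) l
    rw [← L.along_eq g γ, L.along_along]
  split m hm hw := by
    rw [cubeClass_split L hA (fun y hy => hB _ (hm y hy)) (fun y hy => hB _ (hw y hy))]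
    congr 1
    · rw [← cubeClass_castFiber L (rfl : g.comp (m.comp (coordMap 0 leftHalf)) = _)]
      congr 1
      rw [L.castFiber_rfl]
      exact (L.along_cast_right g a (congrArg m (coordMap_leftHalf_zero 0).symm) l).symm
    · rw [L.along_comp, L.along_along]
      rfl

theorem cubeClass_eq_zero (hA : ∀ a : A, Joined a x) {f : C(Cube (n + 2), X)} (hf : ∀ y, f y ∈ A)
    (l : L.Fiber (f 0)) : cubeClass L x f l = 0 := by
  have h := (cubeFunctional_cubeClass (n := n) L hA f 0 l (B := f ⁻¹' A) fun _ h => h).eq_zero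
    (ContinuousMap.id _) hf
  exact (congrArg (cubeClass L x f) (L.along_self f 0 l).symm).trans h

theorem map_mem_of_mem_chainsIn {m : ℕ} {G : Type*} [AddCommGroup G] (φ : Chains L m →+ G)
    (S : AddSubgroup G)
    (h : ∀ (σ : C(Simplex m, X)) (l : L.Fiber (σ (e0 m))), Set.range σ ⊆ A → φ (gen L σ l) ∈ S)
    {c : Chains L m} (hc : c ∈ chainsIn L A m) : φ c ∈ S := by
  classical
  rw [← DirectSum.sum_support_of c, map_sum]
  refine sum_mem fun σ hσ => ?_
  have hσA : Set.range σ ⊆ A := by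
    by_contra h
    exact (DFinsupp.mem_support_iff.1 hσ) (hc σ h)
  have e : DirectSum.of (fun τ : C(Simplex m, X) => L.Fiber (τ (e0 m))) σ (c σ) =
      gen L σ (c σ) := by unfold gen; congr!
  rw [e]
  exact h σ _ hσA

theorem chains_induction {m : ℕ} {p : Chains L m → Prop} (c : Chains L m)
    (gen : ∀ (σ : C(Simplex m, X)) (l : L.Fiber (σ (e0 m))), p (gen L σ l))
    (zero : p 0) (add : ∀ c d, p c → p d → p (c + d)) : p c := by
  classical
  induction c using DirectSum.induction_on with
  | zero => exact zero
  | of σ l => exact gen σ l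
  | add a b ha hb => exact add a b ha hb

namespace Deformation

/-- The end of the deformation of a simplex. -/
def endMap {k m : ℕ} (D : Deformation A k m) (σ : C(Simplex m, X)) : C(Simplex m, X) :=
  (D.map σ).comp ⟨fun y => (1, y), by fun_prop⟩

/-- The deformation of a simplex as a homotopy. -/
def homotopy {k m : ℕ} (D : Deformation A k m) (σ : C(Simplex m, X)) : σ.Homotopy (D.endMap σ) where
  toContinuousMap := D.map σ
  map_zero_left := D.map_zero σ
  map_one_left _ := rfl

/-- The homomorphism from chains to the tensor product that takes a simplex to the class of its
deformation. -/
def chainClass (x : A) (D : Deformation A (n + 2) (n + 2)) :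
    Chains L (n + 2) →+ RelTensor L x n := by
  classical
  exact DirectSum.toAddMonoid fun σ : C(Simplex (n + 2), X) =>
    (cubeClass L x ((D.endMap σ).comp (cubeToSimplex (n + 2)))).comp
      (L.castFiber (by rw [ContinuousMap.comp_apply, cubeToSimplex_zero]) ∘ₗ
        L.trace (D.homotopy σ) (e0 (n + 2))).toAddMonoidHom

theorem chainClass_gen (x : A) (D : Deformation A (n + 2) (n + 2)) (σ : C(Simplex (n + 2), X))
    (l : L.Fiber (σ (e0 (n + 2)))) :
    chainClass L x D (gen L σ l) = cubeClass L x ((D.endMap σ).comp (cubeToSimplex (n + 2)))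
      (L.castFiber (by rw [ContinuousMap.comp_apply, cubeToSimplex_zero])
        (L.trace (D.homotopy σ) (e0 (n + 2)) l)) := by
  simp [chainClass, gen]

/-- Compatibility of deformations with faces. -/
def Compatible {k m : ℕ} (D' : Deformation A k (m + 1)) (D : Deformation A k m) : Prop :=
  ∀ σ i t y, D'.map σ (t, faceMap m i y) = D.map (σ.comp (faceMap m i)) (t, y)

theorem Compatible.endMap_comp {k m : ℕ} {D' : Deformation A k (m + 1)} {D : Deformation A k m}
    (h : D'.Compatible D) (σ : C(Simplex (m + 1), X)) (i : Fin (m + 2)) :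
    D.endMap (σ.comp (faceMap m i)) = (D'.endMap σ).comp (faceMap m i) :=
  ContinuousMap.ext fun y => (h σ i 1 y).symm

theorem Compatible.trace_comp {k m : ℕ} {D' : Deformation A k (m + 1)} {D : Deformation A k m}
    (h : D'.Compatible D) (σ : C(Simplex (m + 1), X)) (i : Fin (m + 2)) (y : Simplex m)
    (l : L.Fiber (σ (faceMap m i y))) :
    L.trace (D.homotopy (σ.comp (faceMap m i))) y l =
      L.castFiber (by rw [h.endMap_comp]; rfl) (L.trace (D'.homotopy σ) (faceMap m i y) l) := by
  have e : D.endMap (σ.comp (faceMap m i)) y = D'.endMap σ (faceMap m i y) := by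
    rw [h.endMap_comp]; rfl
  have hp : (D.homotopy (σ.comp (faceMap m i))).evalAt y =
      ((D'.homotopy σ).evalAt (faceMap m i y)).cast rfl e := by
    ext t; exact (h σ i t y).symm
  refine (congrArg (fun γ => L.transport γ l) hp).trans ?_
  refine (L.transport_cast ((D'.homotopy σ).evalAt (faceMap m i y)) rfl e l).trans ?_
  rw [L.castFiber_rfl]
  rfl

/-- All faces are presented as cubes in one deformed simplex with one common coefficient, as
required for applying homotopy addition with that simplex as `Z`. -/
theorem Compatible.chainClass_face {D' : Deformation A (n + 2) (n + 3)}
    {D : Deformation A (n + 2) (n + 2)} (h : D'.Compatible D) (σ : C(Simplex (n + 3), X))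
    (l : L.Fiber (σ (e0 (n + 3)))) (i : Fin (n + 4)) :
    chainClass L x D (face L (n + 2) i (gen L σ l)) =
      cubeClass L x ((D'.endMap σ).comp ((faceMap (n + 2) i).comp (cubeToSimplex (n + 2))))
        (L.along (D'.endMap σ) (e0 (n + 3)) (faceMap (n + 2) i (cubeToSimplex (n + 2) 0))
          (L.trace (D'.homotopy σ) (e0 (n + 3)) l)) := by
  have e : (D.endMap (σ.comp (faceMap (n + 2) i))).comp (cubeToSimplex (n + 2)) =
      (D'.endMap σ).comp ((faceMap (n + 2) i).comp (cubeToSimplex (n + 2))) := by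
    rw [h.endMap_comp]; rfl
  rw [face_gen, chainClass_gen, ← cubeClass_castFiber L e, ← L.along_eq]
  congr 1
  rw [L.castFiber_castFiber]
  refine (congrArg _ (h.trace_comp L σ i (e0 (n + 2)) _)).trans ?_
  rw [L.castFiber_castFiber, L.trace_along]
  exact (L.along_cast_right (D'.endMap σ) (e0 (n + 3))
    (congrArg (faceMap (n + 2) i) (cubeToSimplex_zero (n + 2)).symm) _).symm

/-- The faces of codimension two of a simplex of dimension `n + 3` have dimension `n + 1 < n + 2`,
so they end in `A`. The homotopy addition theorem for simplices then makes the alternating sum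
vanish. -/
theorem chainClass_boundary (hA : ∀ a : A, Joined a x) {D'' : Deformation A (n + 2) (n + 3)}
    {D' : Deformation A (n + 2) (n + 2)} {D : Deformation A (n + 2) (n + 1)}
    (h' : D''.Compatible D') (h : D'.Compatible D) (c : Chains L (n + 3)) :
    chainClass L x D' (boundary L (n + 2) c) = 0 := by
  induction c using chains_induction with
  | zero => simp
  | add c d hc hd => rw [map_add, map_add, hc, hd, add_zero]
  | gen σ l =>
    have hF := cubeFunctional_cubeClass (n := n) L hA (D''.endMap σ) (e0 (n + 3))
      (L.trace (D''.homotopy σ) (e0 (n + 3)) l) (B := codimTwo (n + 3)) (by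
        rintro z ⟨i, j, hij, hi, hj⟩
        obtain ⟨y, rfl⟩ := exists_faceMap_eq hi
        obtain ⟨j, rfl⟩ := Fin.exists_succAbove_eq hij.symm
        rw [faceMap_apply_succAbove] at hj
        obtain ⟨v, rfl⟩ := exists_faceMap_eq hj
        have := D.map_one (by omega) ((σ.comp (faceMap (n + 2) i)).comp (faceMap (n + 1) j)) v
        rwa [← h, ← h'] at this)
    have := CubeFunctional.sum_simplex_faces (k := n + 1) hF
    rw [boundary_apply, map_sum, ← this]
    refine Finset.sum_congr rfl fun i _ => ?_
    rw [map_zsmul, h'.chainClass_face]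
    rfl

theorem chainClass_eq_zero (hA : ∀ a : A, Joined a x) {D'' : Deformation A (n + 2) (n + 3)}
    {D' : Deformation A (n + 2) (n + 2)} {D : Deformation A (n + 2) (n + 1)}
    (h' : D''.Compatible D') (h : D'.Compatible D) {c : Chains L (n + 2)}
    (hc : c ∈ relBoundaries L A (n + 2)) : chainClass L x D' c = 0 := by
  obtain ⟨_, ⟨b, rfl⟩, a, ha, rfl⟩ := AddSubgroup.mem_sup.1 hc
  rw [map_add, chainClass_boundary L hA h' h, zero_add]
  refine AddSubgroup.mem_bot.1 (map_mem_of_mem_chainsIn L (A := A) _ _ (fun σ l hσ => ?_) ha)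
  rw [AddSubgroup.mem_bot, chainClass_gen]
  refine cubeClass_eq_zero L hA (fun y => ?_) _
  have := D'.map_const σ hσ 1 (cubeToSimplex _ y)
  change D'.map σ (1, _) ∈ A
  rw [this]
  exact hσ (Set.mem_range_self _)

/-- The deformation does not matter for a simplex with boundary in `A`. -/
theorem Compatible.chainClass_gen_eq (hA : ∀ a : A, Joined a x)
    {D' : Deformation A (n + 2) (n + 2)} {D : Deformation A (n + 2) (n + 1)}
    (h : D'.Compatible D) {σ : C(Simplex (n + 2), X)} (hσ : ∀ y, (∃ j, y j = 0) → σ y ∈ A)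
    (l : L.Fiber (σ (e0 (n + 2)))) :
    chainClass L x D' (gen L σ l) = cubeClass L x (σ.comp (cubeToSimplex (n + 2)))
      (L.castFiber (by rw [ContinuousMap.comp_apply, cubeToSimplex_zero]) l) := by
  let H : (σ.comp (cubeToSimplex (n + 2))).HomotopyWith
      ((D'.endMap σ).comp (cubeToSimplex (n + 2))) (PairMap A) :=
    { toFun := fun p => D'.map σ (p.1, cubeToSimplex _ p.2)
      continuous_toFun := by fun_prop
      map_zero_left := fun y => D'.map_zero σ _
      map_one_left := fun y => rfl
      prop' := fun t y hy => by
        obtain ⟨j, hj⟩ := cubeToSimplex_boundary hy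
        obtain ⟨z, hz⟩ := exists_faceMap_eq hj
        change D'.map σ (t, cubeToSimplex _ y) ∈ A
        rw [← hz, h, D.map_const]
        · exact hσ _ ⟨j, faceMap_apply_self j z⟩
        · rintro _ ⟨v, rfl⟩
          exact hσ _ ⟨j, faceMap_apply_self j v⟩ }
  rw [chainClass_gen, ← cubeClass_of_homotopy L hA H]
  congr 1
  exact (L.trace_castFiber (D'.homotopy σ) (cubeToSimplex_zero (n + 2)).symm l).symm

end Deformation

end ChainClass

/-! ### The boundary of the fundamental chain of the cube -/

section CubeBoundary

variable {k : ℕ}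

/-- The inclusion of a face of the cube. -/
def insertMap (i : Fin (k + 1)) (ε : unitInterval) : C(Cube k, Cube (k + 1)) :=
  ⟨fun y => i.insertNth (α := fun _ => unitInterval) ε y, by fun_prop⟩

theorem insertMap_apply_self (i : Fin (k + 1)) (ε : unitInterval) (y : Cube k) :
    insertMap i ε y i = ε :=
  Fin.insertNth_apply_same (α := fun _ => unitInterval) i ε y

theorem insertMap_apply_succAbove (i : Fin (k + 1)) (ε : unitInterval) (y : Cube k) (j : Fin k) :
    insertMap i ε y (i.succAbove j) = y j :=
  Fin.insertNth_apply_succAbove (α := fun _ => unitInterval) i ε y j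

theorem coe_cubeSimplex_apply (s : Equiv.Perm (Fin k)) (t : Simplex k) (i : Fin k) :
    (cubeSimplex s t (s i) : ℝ) = ∑ j with i.castSucc < j, t j := by
  change ∑ j with (s.symm (s i)).castSucc < j, t j = _
  rw [s.symm_apply_apply]

theorem coe_cubeSimplex_faceMap (s : Equiv.Perm (Fin (k + 1))) (j : Fin (k + 2)) (t : Simplex k)
    (i : Fin (k + 1)) :
    (cubeSimplex s (faceMap k j t) (s i) : ℝ) = ∑ l with i.castSucc < j.succAbove l, t l := by
  rw [coe_cubeSimplex_apply, Finset.sum_filter, Finset.sum_filter, Fin.sum_univ_succAbove _ j,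
    faceMap_apply_self, ite_self, zero_add]
  simp only [faceMap_apply_succAbove]

/-- The permutation that takes `0` to `i` and the other elements to the complement of `i`. -/
def permCons (i : Fin (k + 1)) (s : Equiv.Perm (Fin k)) : Equiv.Perm (Fin (k + 1)) :=
  i.cycleRange.symm * Equiv.Perm.decomposeFin.symm (0, s)

theorem permCons_zero (i : Fin (k + 1)) (s : Equiv.Perm (Fin k)) : permCons i s 0 = i := by
  simp [permCons]

theorem permCons_succ (i : Fin (k + 1)) (s : Equiv.Perm (Fin k)) (j : Fin k) :
    permCons i s j.succ = i.succAbove (s j) := by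
  simp [permCons]

theorem sign_permCons (i : Fin (k + 1)) (s : Equiv.Perm (Fin k)) :
    (Equiv.Perm.sign (permCons i s) : ℤ) = (-1) ^ (i : ℕ) * Equiv.Perm.sign s := by
  rw [permCons, Equiv.Perm.sign_mul, Equiv.Perm.sign_symm, Fin.sign_cycleRange,
    Equiv.Perm.decomposeFin.symm_sign, if_pos rfl, one_mul]
  simp

theorem permCons_bijective :
    Function.Bijective fun p : Fin (k + 1) × Equiv.Perm (Fin k) => permCons p.1 p.2 := by
  rw [Fintype.bijective_iff_injective_and_card]
  refine ⟨?_, by simp [Fintype.card_perm, Nat.factorial_succ]⟩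
  rintro ⟨i, s⟩ ⟨i', s'⟩ h
  have hi : i = i' := by simpa [permCons_zero] using Equiv.congr_fun h 0
  subst hi
  refine Prod.ext rfl (Equiv.ext fun j => ?_)
  have := Equiv.congr_fun h j.succ
  simp only [permCons_succ] at this
  exact Fin.succAbove_right_injective this

theorem sum_perm_eq {G : Type*} [AddCommGroup G] (F : Equiv.Perm (Fin (k + 1)) → G) :
    ∑ s, (Equiv.Perm.sign s : ℤ) • F s = ∑ i : Fin (k + 1), (-1 : ℤ) ^ (i : ℕ) •
      ∑ s : Equiv.Perm (Fin k), (Equiv.Perm.sign s : ℤ) • F (permCons i s) := by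
  rw [← (permCons_bijective (k := k)).sum_comp, Fintype.sum_prod_type]
  refine Finset.sum_congr rfl fun i _ => ?_
  rw [Finset.smul_sum]
  refine Finset.sum_congr rfl fun s _ => ?_
  rw [sign_permCons, smul_smul]

/-- Once the initial vertex is omitted, the coordinate raised first is constantly `1`. -/
theorem cubeSimplex_permCons_face_zero (i : Fin (k + 1)) (s : Equiv.Perm (Fin k)) :
    (cubeSimplex (permCons i s)).comp (faceMap k 0) = (insertMap i 1).comp (cubeSimplex s) := by
  refine ContinuousMap.ext fun t => funext fun c => Subtype.ext ?_
  obtain ⟨a, rfl⟩ := (permCons i s).surjective c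
  rw [ContinuousMap.comp_apply, coe_cubeSimplex_faceMap, ContinuousMap.comp_apply]
  induction a using Fin.cases with
  | zero =>
    rw [permCons_zero, insertMap_apply_self, Finset.filter_true_of_mem fun l _ => by simp]
    exact stdSimplex.sum_eq_one t
  | succ b =>
    rw [permCons_succ, insertMap_apply_succAbove, coe_cubeSimplex_apply]
    simp [Fin.lt_def]

/-- Once the final vertex is omitted, the coordinate raised last is constantly `0`. The rotation
moves `i` from the first to the last place. -/
theorem cubeSimplex_permCons_face_last (i : Fin (k + 1)) (s : Equiv.Perm (Fin k)) :
    (cubeSimplex (permCons i s * finRotate (k + 1))).comp (faceMap k (Fin.last (k + 1))) =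
      (insertMap i 0).comp (cubeSimplex s) := by
  refine ContinuousMap.ext fun t => funext fun c => Subtype.ext ?_
  obtain ⟨a, rfl⟩ := (permCons i s * finRotate (k + 1)).surjective c
  rw [ContinuousMap.comp_apply, coe_cubeSimplex_faceMap, ContinuousMap.comp_apply,
    Equiv.Perm.mul_apply]
  induction a using Fin.lastCases with
  | last =>
    rw [finRotate_last, permCons_zero, insertMap_apply_self]
    refine (Finset.sum_eq_zero fun l hl => ?_).trans Set.Icc.coe_zero.symm
    have := (Finset.mem_filter.1 hl).2
    rw [Fin.succAbove_last, Fin.castSucc_lt_castSucc_iff] at this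
    exact (this.not_ge (Fin.le_last l)).elim
  | cast b =>
    have hb : finRotate (k + 1) b.castSucc = b.succ := by
      rw [finRotate_apply, Fin.coeSucc_eq_succ]
    rw [hb, permCons_succ, insertMap_apply_succAbove, coe_cubeSimplex_apply]
    simp

/-- Omitting the vertex between two consecutive steps forgets the order in which the two coordinates
were raised. -/
theorem cubeSimplex_mul_swap_face (s : Equiv.Perm (Fin (k + 1))) (l : Fin k) :
    (cubeSimplex (s * Equiv.swap l.castSucc l.succ)).comp (faceMap k l.succ.castSucc) =
      (cubeSimplex s).comp (faceMap k l.succ.castSucc) := by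
  refine ContinuousMap.ext fun t => funext fun c => Subtype.ext ?_
  obtain ⟨a, rfl⟩ := s.surjective c
  rw [ContinuousMap.comp_apply, ContinuousMap.comp_apply, coe_cubeSimplex_faceMap]
  have h := coe_cubeSimplex_faceMap (s * Equiv.swap l.castSucc l.succ) l.succ.castSucc t
    (Equiv.swap l.castSucc l.succ a)
  rw [Equiv.Perm.mul_apply, Equiv.swap_apply_self] at h
  rw [h]
  have e : ∀ m : Fin (k + 1), l.castSucc.castSucc < l.succ.castSucc.succAbove m ↔
      l.succ.castSucc < l.succ.castSucc.succAbove m := by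
    intro m
    simp only [Fin.succAbove, Fin.lt_def]
    split_ifs <;> simp_all <;> omega
  rcases eq_or_ne a l.castSucc with rfl | h1
  · rw [Equiv.swap_apply_left]; simp only [e]
  · rcases eq_or_ne a l.succ with rfl | h2
    · rw [Equiv.swap_apply_right]; simp only [e]
    · rw [Equiv.swap_apply_of_ne_of_ne h1 h2]

/-- The boundary of the fundamental chain of the cube is the signed sum of the fundamental chains
of the faces. -/
theorem sum_cubeSimplex_faces {G : Type*} [AddCommGroup G] (Φ : C(Simplex k, Cube (k + 1)) → G) :
    ∑ s : Equiv.Perm (Fin (k + 1)), (Equiv.Perm.sign s : ℤ) •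
      ∑ j : Fin (k + 2), (-1 : ℤ) ^ (j : ℕ) • Φ ((cubeSimplex s).comp (faceMap k j)) =
    ∑ i : Fin (k + 1), (-1 : ℤ) ^ (i : ℕ) •
      (∑ s : Equiv.Perm (Fin k), (Equiv.Perm.sign s : ℤ) • Φ ((insertMap i 1).comp (cubeSimplex s)) -
      ∑ s : Equiv.Perm (Fin k),
        (Equiv.Perm.sign s : ℤ) • Φ ((insertMap i 0).comp (cubeSimplex s))) := by
  have hfirst : ∑ s : Equiv.Perm (Fin (k + 1)), (Equiv.Perm.sign s : ℤ) •
      Φ ((cubeSimplex s).comp (faceMap k 0)) = ∑ i : Fin (k + 1), (-1 : ℤ) ^ (i : ℕ) •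
      ∑ s : Equiv.Perm (Fin k), (Equiv.Perm.sign s : ℤ) •
        Φ ((insertMap i 1).comp (cubeSimplex s)) := by
    simp only [sum_perm_eq, cubeSimplex_permCons_face_zero]
  have hlast : ∑ s : Equiv.Perm (Fin (k + 1)), (Equiv.Perm.sign s : ℤ) •
      Φ ((cubeSimplex s).comp (faceMap k (Fin.last (k + 1)))) =
      (-1 : ℤ) ^ k • ∑ i : Fin (k + 1), (-1 : ℤ) ^ (i : ℕ) •
      ∑ s : Equiv.Perm (Fin k), (Equiv.Perm.sign s : ℤ) •
        Φ ((insertMap i 0).comp (cubeSimplex s)) := by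
    -- Reindexing by the rotation brings the last faces into the form of `permCons`, at the cost of
    -- the sign `(-1) ^ k`.
    rw [← Equiv.sum_comp (Equiv.mulRight (finRotate (k + 1)))]
    simp only [Equiv.coe_mulRight, Equiv.Perm.sign_mul, sign_finRotate]
    simp only [← cubeSimplex_permCons_face_last]
    rw [← sum_perm_eq fun s => Φ ((cubeSimplex (s * finRotate (k + 1))).comp
      (faceMap k (Fin.last (k + 1)))), Finset.smul_sum]
    refine Finset.sum_congr rfl fun s _ => ?_
    rw [smul_smul, mul_comm]
    simp
  -- Inner faces cancel in pairs: exchanging two consecutive coordinates keeps the face and changes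
  -- the sign.
  have hmid (l : Fin k) : ∑ s : Equiv.Perm (Fin (k + 1)), (Equiv.Perm.sign s : ℤ) •
      Φ ((cubeSimplex s).comp (faceMap k l.succ.castSucc)) = 0 := by
    have hne : l.castSucc ≠ l.succ := (Fin.castSucc_lt_succ).ne
    refine Finset.sum_involution (fun s _ => s * Equiv.swap l.castSucc l.succ) (fun s _ => ?_)
      (fun s _ _ h => ?_) (fun _ _ => Finset.mem_univ _) (fun s _ => ?_)
    · rw [cubeSimplex_mul_swap_face, Equiv.Perm.sign_mul, Equiv.Perm.sign_swap hne]
      simp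
    · exact hne (Equiv.swap_eq_one_iff.1 (mul_eq_left.1 h))
    · rw [mul_assoc, Equiv.swap_mul_self, mul_one]
  simp only [Finset.smul_sum (s := (Finset.univ : Finset (Fin (k + 2))))]
  rw [Finset.sum_comm]
  simp only [smul_comm _ ((-1 : ℤ) ^ (_ : ℕ)) (Φ _), ← Finset.smul_sum]
  rw [Fin.sum_univ_castSucc, Fin.sum_univ_succ]
  simp only [Fin.castSucc_zero, hfirst, hlast, hmid, smul_zero, Finset.sum_const_zero, add_zero,
    Fin.val_zero, pow_zero, one_smul, Fin.val_last, smul_smul, smul_sub, Finset.sum_sub_distrib]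
  rw [sub_eq_add_neg, ← neg_one_smul ℤ (∑ i : Fin (k + 1), (-1 : ℤ) ^ (i : ℕ) • _)]
  congr 2
  -- The last face carries `(-1) ^ (k + 1)` and the rotation `(-1) ^ k`; together they give the
  -- minus sign of the faces at `0`.
  rw [← pow_add, show k + 1 + k = 2 * k + 1 by ring, pow_succ, pow_mul]
  simp

end CubeBoundary

/-! ### The triangulation of the prism -/

section Prism

theorem val_succAbove {n : ℕ} (j : Fin (n + 1)) (l : Fin n) :
    (j.succAbove l : ℕ) = if (l : ℕ) < j then (l : ℕ) else l + 1 := by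
  simp only [Fin.succAbove, Fin.lt_def, Fin.val_castSucc]
  split_ifs <;> rfl

theorem val_predAbove {n : ℕ} (i : Fin n) (l : Fin (n + 1)) :
    (i.predAbove l : ℕ) = if (i : ℕ) < l then (l : ℕ) - 1 else l := by
  simp only [Fin.predAbove, Fin.lt_def, Fin.val_castSucc]
  split_ifs <;> rfl

/-- The index manipulation behind the boundary formula for prisms. -/
theorem sum_prism {N : ℕ} {G : Type*} [AddCommGroup G] (f : Fin (N + 1) → Fin (N + 2) → G)
    (g : Fin N → Fin (N + 1) → G)
    (h1 : ∀ i j, j ≤ i.castSucc → f i.succ j.castSucc = g i j)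
    (h2 : ∀ i j, i.castSucc < j → f i.castSucc j.succ = g i j)
    (h3 : ∀ i : Fin N, f i.castSucc i.castSucc.succ = f i.succ i.succ.castSucc) :
    ∑ i : Fin (N + 1), (-1 : ℤ) ^ (i : ℕ) • ∑ j : Fin (N + 2), (-1 : ℤ) ^ (j : ℕ) • f i j =
      f 0 0 - f (Fin.last N) (Fin.last (N + 1)) -
        ∑ j : Fin (N + 1), (-1 : ℤ) ^ (j : ℕ) • ∑ i : Fin N, (-1 : ℤ) ^ (i : ℕ) • g i j := by
  -- In each row the entries `j = i` and `j = i + 1` get opposite signs. They are split off because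
  -- they telescope along `h3`, whereas the others come from faces of the base.
  have hrow (i : Fin (N + 1)) :
      (-1 : ℤ) ^ (i : ℕ) • ∑ j : Fin (N + 2), (-1 : ℤ) ^ (j : ℕ) • f i j =
        (f i i.castSucc - f i i.succ) + ∑ l : Fin N, (-1 : ℤ) ^ (i : ℕ) •
          (-1 : ℤ) ^ (i.castSucc.succAbove (i.succAbove l) : ℕ) •
            f i (i.castSucc.succAbove (i.succAbove l)) := by
    rw [Fin.sum_univ_succAbove _ i.castSucc, Fin.sum_univ_succAbove _ i,
      Fin.succAbove_castSucc_self, smul_add, smul_add, ← Finset.smul_sum, ← add_assoc,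
      smul_smul, smul_smul, ← pow_add, ← pow_add, Fin.val_castSucc, Fin.val_succ, ← add_assoc,
      pow_succ, Even.neg_one_pow ⟨_, rfl⟩]
    simp [sub_eq_add_neg]
  have htel : ∑ i : Fin (N + 1), (f i i.castSucc - f i i.succ) =
      f 0 0 - f (Fin.last N) (Fin.last (N + 1)) := by
    rw [Finset.sum_sub_distrib, Fin.sum_univ_succ, Fin.sum_univ_castSucc (fun i => f i i.succ)]
    simp only [h3, Fin.castSucc_zero, Fin.succ_last]
    abel
  -- An involution that exchanges "prism simplex, then remaining face" with "face of the base, then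
  -- prism simplex over it".
  let e : Fin (N + 1) × Fin N ≃ Fin (N + 1) × Fin N :=
    { toFun := fun p => (p.1.succAbove p.2, p.2.predAbove p.1)
      invFun := fun p => (p.1.succAbove p.2, p.2.predAbove p.1)
      left_inv := fun p => by
        simp [Fin.succAbove_succAbove_predAbove, Fin.predAbove_predAbove_succAbove]
      right_inv := fun p => by
        simp [Fin.succAbove_succAbove_predAbove, Fin.predAbove_predAbove_succAbove] }
  have hrest : ∑ i : Fin (N + 1), ∑ l : Fin N, (-1 : ℤ) ^ (i : ℕ) •
      (-1 : ℤ) ^ (i.castSucc.succAbove (i.succAbove l) : ℕ) •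
        f i (i.castSucc.succAbove (i.succAbove l)) =
      -∑ j : Fin (N + 1), (-1 : ℤ) ^ (j : ℕ) • ∑ i : Fin N, (-1 : ℤ) ^ (i : ℕ) • g i j := by
    simp only [Finset.smul_sum, ← Finset.sum_neg_distrib]
    rw [← Fintype.sum_prod_type', ← Fintype.sum_prod_type']
    refine Fintype.sum_equiv e _ _ fun ⟨i, l⟩ => ?_
    change _ = -((-1 : ℤ) ^ (i.succAbove l : ℕ) • (-1 : ℤ) ^ (l.predAbove i : ℕ) •
      g (l.predAbove i) (i.succAbove l))
    rcases lt_or_ge l.castSucc i with h | h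
    · obtain ⟨i, rfl⟩ : ∃ i' : Fin N, i = i'.succ :=
        ⟨i.pred (Fin.ne_zero_of_lt h), (Fin.succ_pred _ _).symm⟩
      have hle : l ≤ i := Fin.castSucc_lt_succ_iff.1 h
      rw [Fin.succAbove_of_castSucc_lt _ _ h, Fin.predAbove_succ_of_le _ _ hle,
        Fin.succAbove_of_castSucc_lt _ _ (Fin.castSucc_lt_castSucc_iff.2 h),
        h1 i l.castSucc (Fin.castSucc_le_castSucc_iff.2 hle), smul_smul, smul_smul, ← neg_smul]
      congr 1
      simp only [Fin.val_succ, Fin.val_castSucc]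
      ring
    · obtain ⟨i, rfl⟩ : ∃ i' : Fin N, i = i'.castSucc :=
        ⟨i.castPred (Fin.ne_last_of_lt (h.trans_lt (Fin.castSucc_lt_last l))),
          (Fin.castSucc_castPred _ _).symm⟩
      have hle : i ≤ l := Fin.castSucc_le_castSucc_iff.1 h
      have hlt : i.castSucc < l.succ := Fin.castSucc_lt_succ_iff.2 hle
      rw [Fin.succAbove_of_le_castSucc _ _ h, Fin.predAbove_castSucc_of_le _ _ hle,
        Fin.succAbove_of_le_castSucc _ _ (Fin.castSucc_le_castSucc_iff.2 hlt.le),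
        h2 i l.succ hlt, smul_smul, smul_smul, ← neg_smul]
      congr 1
      simp only [Fin.val_succ, Fin.val_castSucc]
      ring
  rw [Finset.sum_congr rfl fun i _ => hrow i, Finset.sum_add_distrib, htel, hrest, ← sub_eq_add_neg]

variable {n : ℕ}

instance (n : ℕ) : ContractibleSpace (Simplex n) :=
  (convex_stdSimplex ℝ (Fin (n + 1))).contractibleSpace ⟨_, (e0 n).2⟩

/-- The simplices of the standard triangulation of the prism. -/
def prismMap (n : ℕ) (i : Fin (n + 1)) : C(Simplex (n + 1), unitInterval × Simplex n) where
  toFun t := (⟨∑ j with i.castSucc < j, t j,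
    Finset.sum_nonneg fun j _ => stdSimplex.zero_le t j,
    (Finset.sum_le_univ_sum_of_nonneg fun j => stdSimplex.zero_le t j).trans_eq
      (stdSimplex.sum_eq_one t)⟩, stdSimplex.map i.predAbove t)
  continuous_toFun := by
    refine Continuous.prodMk (Continuous.subtype_mk ?_ _) (stdSimplex.continuous_map _)
    exact continuous_finsetSum _ fun j _ => (continuous_apply j).comp continuous_subtype_val

theorem coe_prismMap_faceMap (i : Fin (n + 1)) (j : Fin (n + 2)) (t : Simplex n) :
    ((prismMap n i (faceMap n j t)).1 : ℝ) = ∑ l with i.castSucc < j.succAbove l, t l := by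
  change ∑ l with i.castSucc < l, faceMap n j t l = _
  rw [Finset.sum_filter, Finset.sum_filter, Fin.sum_univ_succAbove _ j,
    faceMap_apply_self, ite_self, zero_add]
  simp only [faceMap_apply_succAbove]

theorem prismMap_snd_faceMap (i : Fin (n + 1)) (j : Fin (n + 2)) (t : Simplex n) :
    (prismMap n i (faceMap n j t)).2 = stdSimplex.map (i.predAbove ∘ j.succAbove) t :=
  stdSimplex.map_comp_apply _ _ _

theorem prismMap_top (n : ℕ) :
    (prismMap n 0).comp (faceMap n 0) = ⟨fun y => (1, y), by fun_prop⟩ := by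
  refine ContinuousMap.ext fun t => Prod.ext (Subtype.ext ?_) ?_
  · rw [ContinuousMap.comp_apply, coe_prismMap_faceMap, Finset.filter_true_of_mem fun l _ => by simp]
    exact stdSimplex.sum_eq_one t
  · rw [ContinuousMap.comp_apply, prismMap_snd_faceMap]
    have : (0 : Fin (n + 1)).predAbove ∘ (0 : Fin (n + 2)).succAbove = id := by
      funext l; simp
    rw [this]
    exact stdSimplex.map_id_apply t

theorem prismMap_bottom (n : ℕ) :
    (prismMap n (Fin.last n)).comp (faceMap n (Fin.last (n + 1))) =
      ⟨fun y => (0, y), by fun_prop⟩ := by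
  refine ContinuousMap.ext fun t => Prod.ext (Subtype.ext ?_) ?_
  · rw [ContinuousMap.comp_apply, coe_prismMap_faceMap]
    refine Finset.sum_eq_zero fun l hl => ?_
    have := (Finset.mem_filter.1 hl).2
    rw [Fin.succAbove_last, Fin.castSucc_lt_castSucc_iff] at this
    exact (this.not_ge (Fin.le_last l)).elim
  · rw [ContinuousMap.comp_apply, prismMap_snd_faceMap]
    have : (Fin.last n).predAbove ∘ (Fin.last (n + 1)).succAbove = id := by
      funext l; simp
    rw [this]
    exact stdSimplex.map_id_apply t

/-- The product of a face inclusion with the unit interval. -/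
def prismFace (n : ℕ) (j : Fin (n + 2)) : C(unitInterval × Simplex n, unitInterval × Simplex (n + 1)) :=
  ⟨fun p => (p.1, faceMap n j p.2), by fun_prop⟩

/-- Neighbouring simplices of the prism share the facet omitting the vertex in which they differ;
these facets cancel in the boundary. -/
theorem prismMap_middle (i : Fin n) :
    (prismMap n i.castSucc).comp (faceMap n i.castSucc.succ) =
      (prismMap n i.succ).comp (faceMap n i.succ.castSucc) := by
  refine ContinuousMap.ext fun t => Prod.ext (Subtype.ext ?_) ?_
  · rw [ContinuousMap.comp_apply, coe_prismMap_faceMap, ContinuousMap.comp_apply,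
      coe_prismMap_faceMap]
    congr 1
    refine Finset.filter_congr fun l _ => ?_
    simp only [Fin.lt_def, val_succAbove, Fin.val_castSucc, Fin.val_succ]
    split_ifs <;> omega
  · rw [ContinuousMap.comp_apply, prismMap_snd_faceMap, ContinuousMap.comp_apply,
      prismMap_snd_faceMap]
    congr 1
    funext l
    refine Fin.ext ?_
    simp only [Function.comp_apply, val_succAbove, val_predAbove,
      Fin.val_castSucc, Fin.val_succ]
    split_ifs <;> omega

theorem prismMap_face_of_le {i : Fin (n + 1)} {j : Fin (n + 2)} (h : j ≤ i.castSucc) :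
    (prismMap (n + 1) i.succ).comp (faceMap (n + 1) j.castSucc) =
      (prismFace n j).comp (prismMap n i) := by
  refine ContinuousMap.ext fun t => Prod.ext (Subtype.ext ?_) ?_
  · rw [ContinuousMap.comp_apply, coe_prismMap_faceMap]
    change _ = ∑ l with i.castSucc < l, t l
    congr 1
    refine Finset.filter_congr fun l _ => ?_
    simp only [Fin.lt_def, Fin.le_def, val_succAbove, Fin.val_castSucc, Fin.val_succ] at h ⊢
    split_ifs <;> omega
  · rw [ContinuousMap.comp_apply, prismMap_snd_faceMap]
    change _ = stdSimplex.map _ (stdSimplex.map _ t)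
    rw [stdSimplex.map_comp_apply]
    congr 1
    funext l
    refine Fin.ext ?_
    simp only [Function.comp_apply, Fin.le_def, val_succAbove, val_predAbove,
      Fin.val_castSucc, Fin.val_succ] at h ⊢
    split_ifs <;> omega

theorem prismMap_face_of_lt {i : Fin (n + 1)} {j : Fin (n + 2)} (h : i.castSucc < j) :
    (prismMap (n + 1) i.castSucc).comp (faceMap (n + 1) j.succ) =
      (prismFace n j).comp (prismMap n i) := by
  refine ContinuousMap.ext fun t => Prod.ext (Subtype.ext ?_) ?_
  · rw [ContinuousMap.comp_apply, coe_prismMap_faceMap]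
    change _ = ∑ l with i.castSucc < l, t l
    congr 1
    refine Finset.filter_congr fun l _ => ?_
    simp only [Fin.lt_def, val_succAbove, Fin.val_castSucc, Fin.val_succ] at h ⊢
    split_ifs <;> omega
  · rw [ContinuousMap.comp_apply, prismMap_snd_faceMap]
    change _ = stdSimplex.map _ (stdSimplex.map _ t)
    rw [stdSimplex.map_comp_apply]
    congr 1
    funext l
    refine Fin.ext ?_
    simp only [Function.comp_apply, Fin.lt_def, val_succAbove, val_predAbove,
      Fin.val_castSucc, Fin.val_succ] at h ⊢
    split_ifs <;> omega

theorem sum_prismMap_faces {G : Type*} [AddCommGroup G]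
    (Φ : C(Simplex (n + 1), unitInterval × Simplex (n + 1)) → G) :
    ∑ i : Fin (n + 2), (-1 : ℤ) ^ (i : ℕ) • ∑ j : Fin (n + 3), (-1 : ℤ) ^ (j : ℕ) •
        Φ ((prismMap (n + 1) i).comp (faceMap (n + 1) j)) =
      Φ ⟨fun y => (1, y), by fun_prop⟩ - Φ ⟨fun y => (0, y), by fun_prop⟩ -
        ∑ j : Fin (n + 2), (-1 : ℤ) ^ (j : ℕ) • ∑ i : Fin (n + 1), (-1 : ℤ) ^ (i : ℕ) •
          Φ ((prismFace n j).comp (prismMap n i)) := by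
  rw [sum_prism _ (fun i j => Φ ((prismFace n j).comp (prismMap n i)))
    (fun i j h => by rw [prismMap_face_of_le h]) (fun i j h => by rw [prismMap_face_of_lt h])
    (fun i => by rw [prismMap_middle]), prismMap_top, prismMap_bottom]

end Prism

/-! ### Deformations and relative homology -/

namespace Deformation

variable {X : Type u} [TopologicalSpace X] (L : LocalSystem.{u, w} X) {A : Set X} {k m : ℕ}

/-- The chain map given by the ends of the deformations. -/
def endChain (D : Deformation A k m) : Chains L m →+ Chains L m := by
  classical
  exact DirectSum.toAddMonoid fun σ : C(Simplex m, X) =>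
    (gen L (D.endMap σ)).comp (L.trace (D.homotopy σ) (e0 m)).toAddMonoidHom

theorem endChain_gen (D : Deformation A k m) (σ : C(Simplex m, X)) (l : L.Fiber (σ (e0 m))) :
    D.endChain L (gen L σ l) = gen L (D.endMap σ) (L.trace (D.homotopy σ) (e0 m) l) := by
  simp [endChain, gen]

/-- The prism operator of a system of deformations. -/
def prismChain (D : Deformation A k m) : Chains L m →+ Chains L (m + 1) := by
  classical
  exact DirectSum.toAddMonoid fun σ : C(Simplex m, X) =>
    ∑ i : Fin (m + 1), (-1 : ℤ) ^ (i : ℕ) • (push L (D.map σ) (0, e0 m) (prismMap m i)).comp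
      (L.castFiber (D.map_zero σ (e0 m)).symm).toAddMonoidHom

theorem prismChain_gen (D : Deformation A k m) (σ : C(Simplex m, X)) (l : L.Fiber (σ (e0 m))) :
    D.prismChain L (gen L σ l) = ∑ i : Fin (m + 1), (-1 : ℤ) ^ (i : ℕ) •
      push L (D.map σ) (0, e0 m) (prismMap m i) (L.castFiber (D.map_zero σ (e0 m)).symm l) := by
  simp [prismChain, gen]

theorem prismChain_mem_chainsIn (D : Deformation A k m) {c : Chains L m}
    (hc : c ∈ chainsIn L A m) : D.prismChain L c ∈ chainsIn L A (m + 1) := by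
  refine map_mem_of_mem_chainsIn L _ _ (fun σ l hσ => ?_) hc
  rw [prismChain_gen]
  refine sum_mem fun i _ => zsmul_mem (push_mem_chainsIn L A _ _ _ (fun t => ?_) _) _
  rw [← Prod.mk.eta (p := prismMap m i t), D.map_const σ hσ]
  exact hσ (Set.mem_range_self _)

theorem push_top (D : Deformation A k m) (σ : C(Simplex m, X)) (l : L.Fiber (σ (e0 m))) :
    push L (D.map σ) (0, e0 m) ⟨fun y => (1, y), by fun_prop⟩
      (L.castFiber (D.map_zero σ (e0 m)).symm l) = D.endChain L (gen L σ l) := by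
  let K : (⟨fun y => (0, y), by fun_prop⟩ : C(Simplex m, unitInterval × Simplex m)).Homotopy
      ⟨fun y => (1, y), by fun_prop⟩ :=
    { toContinuousMap := ContinuousMap.id _
      map_zero_left := fun y => rfl
      map_one_left := fun y => rfl }
  rw [endChain_gen, push_apply]
  refine congrArg (gen L (D.endMap σ)) (Eq.trans ?_
    (L.trace_eq_along (D.map σ) K (D.homotopy σ) (fun p => rfl) (e0 m) l).symm)
  exact (L.castFiber_rfl _ _).symm

theorem push_bottom (D : Deformation A k m) (σ : C(Simplex m, X)) (l : L.Fiber (σ (e0 m))) :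
    push L (D.map σ) (0, e0 m) ⟨fun y => (0, y), by fun_prop⟩
      (L.castFiber (D.map_zero σ (e0 m)).symm l) = gen L σ l := by
  have e : σ = (D.map σ).comp ⟨fun y => (0, y), by fun_prop⟩ :=
    ContinuousMap.ext fun y => (D.map_zero σ y).symm
  rw [push_apply, ← gen_castFiber L e]
  congr 1
  exact L.along_self _ _ _

theorem Compatible.prismChain_face {D' : Deformation A k (m + 1)} {D : Deformation A k m}
    (h : D'.Compatible D) (σ : C(Simplex (m + 1), X)) (l : L.Fiber (σ (e0 (m + 1))))
    (j : Fin (m + 2)) : D.prismChain L (face L m j (gen L σ l)) =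
      ∑ i : Fin (m + 1), (-1 : ℤ) ^ (i : ℕ) • push L (D'.map σ) (0, e0 (m + 1))
        ((prismFace m j).comp (prismMap m i))
        (L.castFiber (D'.map_zero σ (e0 (m + 1))).symm l) := by
  have e : D.map (σ.comp (faceMap m j)) = (D'.map σ).comp (prismFace m j) :=
    ContinuousMap.ext fun p => (h σ j p.1 p.2).symm
  let bot : C(Simplex (m + 1), unitInterval × Simplex (m + 1)) := ⟨fun y => (0, y), by fun_prop⟩
  have e' : σ = (D'.map σ).comp bot := ContinuousMap.ext fun y => (D'.map_zero σ y).symm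
  rw [face_gen, prismChain_gen]
  refine Finset.sum_congr rfl fun i _ => ?_
  congr 1
  rw [← push_of_eq L e, ← push_along L (D'.map σ) (0, e0 (m + 1)) (prismFace m j (0, e0 m)),
    push_comp, ← L.along_eq, L.castFiber_castFiber]
  congr 1
  have h1 := L.along_of_eq e' (e0 (m + 1)) (faceMap m j (e0 m)) l
  rw [L.along_comp] at h1
  exact h1.symm

theorem Compatible.boundary_prismChain {D' : Deformation A k (m + 1)} {D : Deformation A k m}
    (h : D'.Compatible D) (c : Chains L (m + 1)) :
    boundary L (m + 1) (D'.prismChain L c) =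
      D'.endChain L c - c - D.prismChain L (boundary L m c) := by
  induction c using chains_induction with
  | zero => simp
  | add c d hc hd => simp only [map_add, hc, hd]; abel
  | gen σ l =>
    rw [prismChain_gen, map_sum]
    simp only [map_zsmul, boundary_push]
    rw [sum_prismMap_faces fun τ => push L (D'.map σ) (0, e0 (m + 1)) τ
      (L.castFiber (D'.map_zero σ (e0 (m + 1))).symm l), push_top, push_bottom, boundary_apply,
      map_sum]
    simp only [map_zsmul, h.prismChain_face]

/-- For a relative cycle the prism over the boundary lies in `A`, since simplices of `A` are not
moved. The chain homotopy formula then leaves only a boundary. -/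
theorem Compatible.endChain_sub_mem {D' : Deformation A k (m + 1)} {D : Deformation A k m}
    (h : D'.Compatible D) {c : Chains L (m + 1)} (hc : c ∈ relCycles L A (m + 1)) :
    D'.endChain L c - c ∈ relBoundaries L A (m + 1) := by
  rw [← sub_add_cancel (D'.endChain L c - c) (D.prismChain L (boundary L m c)),
    ← h.boundary_prismChain]
  exact add_mem (AddSubgroup.mem_sup_left ⟨_, rfl⟩)
    (AddSubgroup.mem_sup_right (D.prismChain_mem_chainsIn L hc))

end Deformation

/-! ### The fundamental chain of a map of cubes -/

section CubeChain

variable {X : Type u} [TopologicalSpace X] (L : LocalSystem.{u, w} X) (A : Set X)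
variable {Z : Type*} [TopologicalSpace Z] [SimplyConnectedSpace Z] (g : C(Z, X)) (a : Z) {k : ℕ}

/-- The image under `g ∘ m` of the fundamental chain of the cube, with coefficients transported
from the point `a`. -/
def cubeChain (m : C(Cube k, Z)) : L.Fiber (g a) →+ Chains L k :=
  ∑ s : Equiv.Perm (Fin k), (Equiv.Perm.sign s : ℤ) • push L g a (m.comp (cubeSimplex s))

theorem cubeChain_apply (m : C(Cube k, Z)) (l : L.Fiber (g a)) :
    cubeChain L g a m l =
      ∑ s : Equiv.Perm (Fin k), (Equiv.Perm.sign s : ℤ) • push L g a (m.comp (cubeSimplex s)) l := by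
  simp [cubeChain]

theorem boundary_cubeChain (m : C(Cube (k + 1), Z)) (l : L.Fiber (g a)) :
    boundary L k (cubeChain L g a m l) = ∑ i : Fin (k + 1), (-1 : ℤ) ^ (i : ℕ) •
      (cubeChain L g a (m.comp (insertMap i 1)) l -
        cubeChain L g a (m.comp (insertMap i 0)) l) := by
  simp only [cubeChain_apply, map_sum, map_zsmul, boundary_push]
  exact sum_cubeSimplex_faces fun τ => push L g a (m.comp τ) l

variable {A} in
theorem cubeChain_mem_chainsIn {m : C(Cube k, Z)} (h : ∀ y, g (m y) ∈ A) (l : L.Fiber (g a)) :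
    cubeChain L g a m l ∈ chainsIn L A k := by
  rw [cubeChain_apply]
  exact sum_mem fun s _ => zsmul_mem (push_mem_chainsIn L A g a _ (fun t => h _) l) _

theorem cubeChain_comp_id (m : C(Cube k, Z)) (l : L.Fiber (g a)) :
    cubeChain L (g.comp m) 0 (ContinuousMap.id _) (L.along g a (m 0) l) =
      cubeChain L g a m l := by
  simp only [cubeChain_apply, push_comp, push_along]
  rfl

theorem cubeChain_of_eq {g g' : C(Z, X)} (h : g = g') (m : C(Cube k, Z)) (l : L.Fiber (g a)) :
    cubeChain L g' a m (L.castFiber (by rw [h]) l) = cubeChain L g a m l := by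
  subst h; simp

/-- The class of the fundamental chain modulo the relative boundaries. -/
def cubeChainClass (m : C(Cube k, Z)) :
    L.Fiber (g a) →+ Chains L k ⧸ relBoundaries L A k :=
  (QuotientAddGroup.mk' _).comp (cubeChain L g a m)

variable {A} in
theorem cubeChainClass_eq_zero {m : C(Cube k, Z)} (h : ∀ y, g (m y) ∈ A) (l : L.Fiber (g a)) :
    cubeChainClass L A g a m l = 0 :=
  (QuotientAddGroup.eq_zero_iff _).2
    (AddSubgroup.mem_sup_right (cubeChain_mem_chainsIn L g a h l))

theorem sum_cubeChainClass_faces (m : C(Cube (k + 1), Z)) (l : L.Fiber (g a)) :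
    ∑ i : Fin (k + 1), (-1 : ℤ) ^ (i : ℕ) •
      (cubeChainClass L A g a (m.comp (insertMap i 1)) l -
        cubeChainClass L A g a (m.comp (insertMap i 0)) l) = 0 := by
  have h : (QuotientAddGroup.mk' (relBoundaries L A k)) (boundary L k (cubeChain L g a m l)) = 0 :=
    (QuotientAddGroup.eq_zero_iff _).2 (AddSubgroup.mem_sup_left ⟨_, rfl⟩)
  rw [boundary_cubeChain, map_sum] at h
  simp only [map_zsmul, map_sub] at h
  exact h

theorem insertMap_zero (ε : unitInterval) (y : Cube k) : insertMap 0 ε y = Fin.cons ε y :=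
  Fin.insertNth_zero' ε y

variable {A} in
/-- The fundamental chain modulo the relative boundaries has the same formal properties as the
class of a map of cubes in the relative homotopy group. -/
theorem cubeFunctional_cubeChainClass (l : L.Fiber (g a)) :
    CubeFunctional (0 : Fin (k + 1)) (g ⁻¹' A) fun m => cubeChainClass L A g a m l where
  homotopy H hH := by
    -- The homotopy is itself a cube. All its faces except the two ends lie over `A`, so its
    -- boundary equates the ends.
    let M : C(Cube (k + 2), Z) := ⟨fun y => H (y 0, fun i => y i.succ), by fun_prop⟩
    have hM (ε : unitInterval) (y : Cube (k + 1)) : M (insertMap 0 ε y) = H (ε, y) := by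
      change H (_, _) = _
      rw [insertMap_zero]; simp
    have h := sum_cubeChainClass_faces L A g a M l
    rw [Fin.sum_univ_succ, Finset.sum_eq_zero] at h
    · rw [Fin.val_zero, pow_zero, one_smul, add_zero, sub_eq_zero] at h
      have e (ε : unitInterval) : M.comp (insertMap 0 ε) = H.comp ⟨fun y => (ε, y), by fun_prop⟩ :=
        ContinuousMap.ext (hM ε)
      rw [e, e] at h
      exact h.symm
    · intro i _
      have hz (ε : unitInterval) (hε : ε = 0 ∨ ε = 1) :
          cubeChainClass L A g a (M.comp (insertMap i.succ ε)) l = 0 := by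
        refine cubeChainClass_eq_zero L g a (fun y => hH _ _ ⟨i, ?_⟩) l
        rwa [insertMap_apply_self]
      rw [hz 0 (Or.inl rfl), hz 1 (Or.inr rfl), sub_zero, smul_zero]
  split m hm hw := by
    -- Interpolates between halving and the identity. The faces `y 0 = 0` and `y 0 = 1` give the
    -- left half and `m`, the face `y 1 = 1` gives the right half, and all the others lie over `A`.
    let μ : C(Cube (k + 2), Cube (k + 1)) :=
      ⟨fun y => Function.update (fun i => y i.succ) 0 (clamp (y 1 * (1 + y 0) / 2)),
        Continuous.update (by fun_prop) 0 (by fun_prop)⟩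
    have hμ0 (z : Cube (k + 2)) : μ z 0 = clamp (z 1 * (1 + z 0) / 2) := by
      simp only [μ, ContinuousMap.coe_mk, Function.update_self]
    have hμs (z : Cube (k + 2)) (i : Fin k) : μ z i.succ = z i.succ.succ := by simp [μ]
    have h := sum_cubeChainClass_faces L A g a (m.comp μ) l
    rw [Fin.sum_univ_succ, Fin.sum_univ_succ, Finset.sum_eq_zero] at h
    · have e0 : (m.comp μ).comp (insertMap 0 0) = m.comp (coordMap 0 leftHalf) := by
        refine ContinuousMap.ext fun y => congrArg m ?_
        change Function.update _ 0 _ = Function.update _ 0 _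
        rw [insertMap_zero]
        congr 1
        refine clamp_eq ?_
        rw [coe_leftHalf, show (1 : Fin (k + 2)) = Fin.succ 0 from rfl]
        simp
      have e1 : (m.comp μ).comp (insertMap 0 1) = m := by
        refine ContinuousMap.ext fun y => congrArg m ?_
        change Function.update _ 0 _ = y
        rw [insertMap_zero]
        refine (congrArg _ (clamp_eq (u := y 0) ?_)).trans (Function.update_eq_self 0 y)
        rw [show (1 : Fin (k + 2)) = Fin.succ 0 from rfl]
        simp; ring
      have e2 : (m.comp μ).comp (insertMap (Fin.succ 0) 1) = m.comp (coordMap 0 rightHalf) := by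
        refine ContinuousMap.ext fun y => congrArg m ?_
        have h0 : insertMap (Fin.succ 0) 1 y 0 = y 0 := by
          have := insertMap_apply_succAbove (Fin.succ 0) 1 y 0
          rwa [Fin.succ_succAbove_zero] at this
        have hs (i : Fin k) : insertMap (Fin.succ 0) 1 y i.succ.succ = y i.succ := by
          have := insertMap_apply_succAbove (Fin.succ 0) 1 y i.succ
          rwa [Fin.succ_succAbove_succ, Fin.zero_succAbove] at this
        change Function.update _ 0 _ = Function.update _ 0 _
        have hc : clamp (insertMap (Fin.succ 0) 1 y 1 * (1 + insertMap (Fin.succ 0) 1 y 0) / 2) =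
            rightHalf (y 0) := by
          refine clamp_eq ?_
          rw [coe_rightHalf, h0, show (1 : Fin (k + 2)) = Fin.succ 0 from rfl,
            insertMap_apply_self]
          simp
        rw [hc]
        funext i
        induction i using Fin.cases with
        | zero => simp
        | succ i =>
          rw [Function.update_of_ne (Fin.succ_ne_zero i), Function.update_of_ne (Fin.succ_ne_zero i)]
          exact hs i
      have e3 : cubeChainClass L A g a ((m.comp μ).comp (insertMap (Fin.succ 0) 0)) l = 0 := by
        refine cubeChainClass_eq_zero L (A := A) g a (fun y => ?_) l
        refine hm (μ (insertMap (Fin.succ 0) 0 y)) ⟨0, Or.inl ?_⟩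
        have h1 : insertMap (Fin.succ 0) 0 y 1 = 0 := insertMap_apply_self (Fin.succ 0) 0 y
        rw [hμ0, h1]
        exact clamp_eq_zero (by simp)
      rw [e0, e1, e2, e3] at h
      simp only [Fin.val_zero, Fin.val_succ, pow_zero, one_smul, sub_zero, add_zero, zero_add,
        pow_one, neg_smul] at h
      rw [← sub_eq_add_neg, sub_sub, sub_eq_zero] at h
      exact h
    · intro i _
      have hz (ε : unitInterval) (hε : ε = 0 ∨ ε = 1) :
          cubeChainClass L A g a ((m.comp μ).comp (insertMap i.succ.succ ε)) l = 0 := by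
        refine cubeChainClass_eq_zero L (A := A) g a (fun y => ?_) l
        refine hm (μ (insertMap i.succ.succ ε y)) ⟨i.succ, ?_⟩
        rw [hμs, insertMap_apply_self]
        exact hε
      rw [hz 0 (Or.inl rfl), hz 1 (Or.inr rfl), sub_zero, smul_zero]

end CubeChain

/-! ### The standard triangulation and the map from the cube to the simplex -/

/-- On this simplex the coordinates decrease, so the prefix minima are the coordinates themselves
and their differences recover the barycentric coordinates. -/
theorem cubeToSimplex_cubeSimplex_one {k : ℕ} :
    (cubeToSimplex k).comp (cubeSimplex 1) = ContinuousMap.id _ := by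
  refine ContinuousMap.ext fun t => Simplex.ext_apply fun j => ?_
  have hc (i : Fin k) : (cubeSimplex 1 t i : ℝ) = ∑ l with i.castSucc < l, t l :=
    coe_cubeSimplex_apply 1 t i
  have hp : ∀ j : ℕ, j ≤ k →
      prefixMin (cubeSimplex 1 t) j = ∑ l ∈ Finset.univ.filter (fun l : Fin (k + 1) => j ≤ (l : ℕ)), t l := by
    intro j hj
    induction j with
    | zero =>
      rw [prefixMin_zero, Finset.filter_true_of_mem fun l _ => Nat.zero_le _]
      exact (stdSimplex.sum_eq_one t).symm
    | succ j ih =>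
      rw [prefixMin_succ_of_lt _ hj, ih (by omega), hc, min_eq_right]
      · rfl
      · refine Finset.sum_le_sum_of_subset_of_nonneg (fun l hl => ?_)
          fun l _ _ => stdSimplex.zero_le t l
        have h1 := (Finset.mem_filter.1 hl).2
        rw [Fin.lt_def] at h1
        exact Finset.mem_filter.2 ⟨Finset.mem_univ _, h1.le⟩
  have hp' : prefixMin (cubeSimplex 1 t) (j + 1) =
      ∑ l ∈ Finset.univ.filter (fun l : Fin (k + 1) => (j : ℕ) + 1 ≤ l), t l := by
    rcases Nat.lt_succ_iff_lt_or_eq.1 j.2 with h | h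
    · exact hp _ h
    · rw [h, prefixMin_last, Finset.sum_eq_zero]
      intro l hl
      have := (Finset.mem_filter.1 hl).2
      have := l.2
      omega
  rw [ContinuousMap.comp_apply, cubeToSimplex_apply, hp j (Nat.lt_succ_iff.1 j.2), hp',
    sub_eq_iff_eq_add]
  have : Finset.univ.filter (fun l : Fin (k + 1) => (j : ℕ) ≤ l) =
      insert j (Finset.univ.filter fun l : Fin (k + 1) => (j : ℕ) + 1 ≤ l) := by
    ext l
    simp only [Finset.mem_filter, Finset.mem_univ, true_and, Finset.mem_insert, Fin.ext_iff]
    omega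
  rw [this, Finset.sum_insert (by simp)]
  rfl

/-- A permutation other than the identity raises some coordinate `i + 1` before `i`. Then coordinate
`i + 1` is at least coordinate `i`, the prefix minimum does not drop, and a barycentric coordinate
vanishes. -/
theorem exists_cubeToSimplex_cubeSimplex_eq_zero {k : ℕ} {s : Equiv.Perm (Fin k)} (hs : s ≠ 1)
    (t : Simplex k) : ∃ j, cubeToSimplex k (cubeSimplex s t) j = 0 := by
  obtain ⟨i, j, hij, hs'⟩ : ∃ i j : Fin k, (j : ℕ) = i + 1 ∧ s.symm j ≤ s.symm i := by
    by_contra! h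
    have hmono : StrictMono s.symm := by
      cases k with
      | zero => exact fun i => i.elim0
      | succ k => exact Fin.strictMono_iff_lt_succ.2 fun i => h i.castSucc i.succ (by simp)
    have : OrderIso.ofRelIsoLT ⟨s.symm, hmono.lt_iff_lt⟩ = OrderIso.refl (Fin k) :=
      Subsingleton.elim _ _
    refine hs (Equiv.ext fun i => ?_)
    have h1 : s.symm (s i) = s i := DFunLike.congr_fun this (s i)
    rw [s.symm_apply_apply] at h1
    exact h1.symm
  refine ⟨j.castSucc, ?_⟩
  have hle : (cubeSimplex s t i : ℝ) ≤ cubeSimplex s t j := by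
    change ∑ l with (s.symm i).castSucc < l, t l ≤ ∑ l with (s.symm j).castSucc < l, t l
    refine Finset.sum_le_sum_of_subset_of_nonneg (fun l hl => ?_)
      fun l _ _ => stdSimplex.zero_le t l
    exact Finset.mem_filter.2 ⟨Finset.mem_univ _,
      (Fin.castSucc_le_castSucc_iff.2 hs').trans_lt (Finset.mem_filter.1 hl).2⟩
  rw [cubeToSimplex_apply, Fin.val_castSucc, prefixMin_succ, sub_eq_zero, eq_comm, min_eq_left_iff,
    hij, prefixMin_succ]
  exact (min_le_right _ _).trans hle

/-- Modulo the relative boundaries, a simplex is the fundamental chain of a cube. -/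
theorem cubeChainClass_comp_cubeToSimplex {X : Type u} [TopologicalSpace X]
    (L : LocalSystem.{u, w} X) {A : Set X} {Z : Type*} [TopologicalSpace Z]
    [SimplyConnectedSpace Z] (g : C(Z, X)) (a : Z) {k : ℕ} (τ : C(Simplex k, Z))
    (hτ : ∀ y, (∃ j, y j = 0) → g (τ y) ∈ A) (l : L.Fiber (g a)) :
    cubeChainClass L A g a (τ.comp (cubeToSimplex k)) l = QuotientAddGroup.mk (push L g a τ l) := by
  change QuotientAddGroup.mk (cubeChain L g a _ l) = _
  rw [QuotientAddGroup.eq_iff_sub_mem]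
  refine AddSubgroup.mem_sup_right ?_
  rw [cubeChain_apply, ← Finset.add_sum_erase _ _ (Finset.mem_univ 1), ContinuousMap.comp_assoc,
    cubeToSimplex_cubeSimplex_one, ContinuousMap.comp_id, Equiv.Perm.sign_one, Units.val_one,
    one_smul, add_sub_cancel_left]
  refine sum_mem fun s hs => zsmul_mem (push_mem_chainsIn L A g a _ (fun t => ?_) l) _
  refine hτ (cubeToSimplex k (cubeSimplex s t)) ?_
  exact exists_cubeToSimplex_cubeSimplex_eq_zero (Finset.ne_of_mem_erase hs) t

/-! ### The Hurewicz homomorphism -/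

section Hurewicz

variable {X : Type u} [TopologicalSpace X] (L : LocalSystem.{u, w} X) {A : Set X} {x : A} {n : ℕ}

theorem hurewiczChain_eq (p : RelLoop x n) (l : L.Fiber (x : X)) :
    hurewiczChain L p l =
      cubeChain L p.cube 0 (ContinuousMap.id _) (L.castFiber p.cube_zero.symm l) := by
  rw [hurewiczChain, cubeChain_apply]
  refine Finset.sum_congr rfl fun s _ => ?_
  congr 1
  have h0 : (0 : Cube (n + 2)) = cubeSimplex s (e0 (n + 2)) :=
    funext fun i => (cubeSimplex_e0 s i).symm
  rw [single_apply, push_apply]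
  refine congrArg (gen L (p.cube.comp (cubeSimplex s))) ?_
  refine Eq.trans ?_ (L.along_cast_right p.cube 0 h0 _).symm
  rw [L.along_self, L.castFiber_castFiber]

theorem hurewiczChain_mem_relCycles (p : RelLoop x n) (l : L.Fiber (x : X)) :
    hurewiczChain L p l ∈ relCycles L A (n + 2) := by
  change boundary L (n + 1) _ ∈ chainsIn L A (n + 1)
  rw [hurewiczChain_eq, boundary_cubeChain]
  refine sum_mem fun i _ => zsmul_mem (sub_mem ?_ ?_) _
  · exact cubeChain_mem_chainsIn L _ _ (fun y => p.tripleMap_cube.pairMap _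
      ⟨i, Or.inr (insertMap_apply_self i 1 y)⟩) _
  · exact cubeChain_mem_chainsIn L _ _ (fun y => p.tripleMap_cube.pairMap _
      ⟨i, Or.inl (insertMap_apply_self i 0 y)⟩) _

theorem cubeChainClass_comp_id {Z : Type*} [TopologicalSpace Z] [SimplyConnectedSpace Z]
    (g : C(Z, X)) (a : Z) {k : ℕ} (m : C(Cube k, Z)) (l : L.Fiber (g a)) :
    cubeChainClass L A (g.comp m) 0 (ContinuousMap.id _) (L.along g a (m 0) l) =
      cubeChainClass L A g a m l :=
  congrArg QuotientAddGroup.mk (cubeChain_comp_id L g a m l)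

/-- The whole homotopy is one map `G` of the prism. The two ends of the prism are homotopic cubes in
it, and transport inside the prism is the trace of the vertex. -/
theorem cubeChainClass_of_homotopy {k : ℕ} {f g : C(Cube (k + 1), X)}
    (H : f.HomotopyWith g (PairMap A)) (l : L.Fiber (f 0)) :
    cubeChainClass L A g 0 (ContinuousMap.id _) (L.trace H.toHomotopy 0 l) =
      cubeChainClass L A f 0 (ContinuousMap.id _) l := by
  let G : C(unitInterval × Cube (k + 1), X) := H.toContinuousMap
  let m (ε : unitInterval) : C(Cube (k + 1), unitInterval × Cube (k + 1)) :=
    ⟨fun y => (ε, y), by fun_prop⟩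
  have hf : f = G.comp (m 0) := ContinuousMap.ext fun y => (H.apply_zero y).symm
  have hg : G.comp (m 1) = g := ContinuousMap.ext fun y => H.apply_one y
  let K : (m 0).Homotopy (m 1) :=
    { toContinuousMap := ContinuousMap.id _
      map_zero_left := fun y => rfl
      map_one_left := fun y => rfl }
  have h := (cubeFunctional_cubeChainClass (A := A) L G (0, 0)
    (L.castFiber (congrArg (fun f : C(Cube (k + 1), X) => f 0) hf) l)).homotopy
    (ContinuousMap.id _) fun t y hy => H.prop t y hy
  have h0 := cubeChainClass_comp_id (A := A) L G (0, 0) (m 0)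
    (L.castFiber (congrArg (fun f : C(Cube (k + 1), X) => f 0) hf) l)
  have h1 := cubeChainClass_comp_id (A := A) L G (0, 0) (m 1)
    (L.castFiber (congrArg (fun f : C(Cube (k + 1), X) => f 0) hf) l)
  rw [L.trace_eq_along G K H.toHomotopy fun p => rfl]
  refine (congrArg QuotientAddGroup.mk (cubeChain_of_eq L 0 hg _ _)).trans
    (h1.trans (h.symm.trans (h0.symm.trans ?_)))
  refine Eq.trans ?_ (congrArg QuotientAddGroup.mk (cubeChain_of_eq L 0 hf (ContinuousMap.id _) l))
  exact congrArg (cubeChainClass L A (G.comp (m 0)) 0 (ContinuousMap.id _)) (L.along_self _ _ _)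

/-- The class of the Hurewicz chain modulo the relative boundaries. -/
def hurewiczClass (p : RelLoop x n) : L.Fiber (x : X) →+ Chains L (n + 2) ⧸ relBoundaries L A (n + 2) :=
  (cubeChainClass L A p.cube 0 (ContinuousMap.id _)).comp
    (L.castFiber p.cube_zero.symm).toAddMonoidHom

theorem hurewiczClass_apply (p : RelLoop x n) (l : L.Fiber (x : X)) :
    hurewiczClass L p l = QuotientAddGroup.mk (hurewiczChain L p l) :=
  congrArg QuotientAddGroup.mk (hurewiczChain_eq L p l).symm

theorem hurewiczClass_eq (p : RelLoop x n) (l : L.Fiber (x : X)) : hurewiczClass L p l =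
    cubeChainClass L A p.cube 0 (ContinuousMap.id _) (L.castFiber p.cube_zero.symm l) := rfl

theorem hurewiczClass_congr {p q : RelLoop x n} (h : GenLoop.Homotopic p q) :
    hurewiczClass L p = hurewiczClass L q := by
  obtain ⟨H⟩ := homotopicWith_of_genLoop h (f := p.cube) (g := q.cube) (fun y => rfl) fun y => rfl
  let H' : p.cube.HomotopyWith q.cube (PairMap A) :=
    { H with prop' := fun t => (H.prop t).pairMap }
  ext l
  have hc : ∀ t, H' (t, 0) = p.cube 0 := fun t =>
    ((H.prop t).2 0 (Or.inr ⟨0, Or.inl rfl⟩)).trans p.cube_zero.symm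
  rw [hurewiczClass_eq, hurewiczClass_eq, ← cubeChainClass_of_homotopy L H',
    L.trace_of_const H'.toHomotopy 0 hc, L.castFiber_castFiber]

/-- The Hurewicz class of an element of the relative homotopy group. -/
def hurewiczPi (a : RelPi x (n + 2)) :
    L.Fiber (x : X) →+ Chains L (n + 2) ⧸ relBoundaries L A (n + 2) :=
  Quotient.lift (s := GenLoop.Homotopic.setoid (Fin (n + 1)) (PathFiber.base x))
    (fun p : RelLoop x n => hurewiczClass L p) (fun _ _ h => hurewiczClass_congr L h) a

theorem hurewiczPi_toPi (p : RelLoop x n) : hurewiczPi L p.toPi = hurewiczClass L p := rfl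

/-- A product is a concatenation, so its fundamental chain splits along the middle wall. The
coefficient reaches the vertex of the right half along a path with constant image. -/
theorem hurewiczPi_mul (a b : RelPi x (n + 2)) (l : L.Fiber (x : X)) :
    hurewiczPi L (a * b) l = hurewiczPi L a l + hurewiczPi L b l := by
  obtain ⟨p, rfl⟩ : ∃ p : RelLoop x n, p.toPi = a := Quotient.exists_rep a
  obtain ⟨q, rfl⟩ : ∃ q : RelLoop x n, q.toPi = b := Quotient.exists_rep b
  let r : RelLoop x n := GenLoop.transAt 0 q p
  have hr : p.toPi * q.toPi = r.toPi := HomotopyGroup.mul_spec (N := Fin (n + 1)) (i := 0)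
  obtain ⟨hleft, hright⟩ := RelLoop.cube_transAt q p
  rw [hr, hurewiczPi_toPi, hurewiczPi_toPi, hurewiczPi_toPi]
  have hF := cubeFunctional_cubeChainClass (A := A) L r.cube (0 : Cube (n + 2))
    (k := n + 1) (L.castFiber r.cube_zero.symm l)
  -- The middle wall is the far wall of the left half, where `q` takes the base value.
  have hmid (y : Cube (n + 2)) (hy : (y 0 : ℝ) = 1 / 2) : r.cube y = x := by
    have e : y = coordMap 0 leftHalf (Function.update y 0 1) := by
      simp only [coordMap, ContinuousMap.coe_mk, Function.update_self, Function.update_idem]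
      refine (Function.eq_update_self_iff.2 (Subtype.ext ?_))
      rw [coe_leftHalf, hy]; simp
    have h1 := DFunLike.congr_fun hleft (Function.update y 0 1)
    rw [ContinuousMap.comp_apply, ← e] at h1
    rw [h1]
    exact q.cube_eq_base _ (Or.inr ⟨0, Or.inr (Function.update_self _ _ _)⟩)
  have hsplit := hF.split (ContinuousMap.id _) (fun y hy => r.tripleMap_cube.pairMap y hy)
    (fun y hy => by
      change r.cube y ∈ A
      rw [hmid y hy]; exact x.2)
  have key (φ : C(unitInterval, unitInterval)) (s : RelLoop x n)
      (hs : r.cube.comp (coordMap 0 φ) = s.cube) (γ : Path (0 : Cube (n + 2)) (coordMap 0 φ 0))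
      (hγ : ∀ t, r.cube (γ t) = x) :
      cubeChainClass L A r.cube 0 ((ContinuousMap.id _).comp (coordMap 0 φ))
        (L.castFiber r.cube_zero.symm l) = hurewiczClass L s l := by
    rw [ContinuousMap.id_comp, ← cubeChainClass_comp_id,
      L.along_of_const r.cube γ (fun t => by rw [hγ, r.cube_zero]), L.castFiber_castFiber]
    have h0 : (x : X) = (r.cube.comp (coordMap 0 φ)) 0 := by rw [hs, s.cube_zero]
    refine Eq.trans ?_ (congrArg QuotientAddGroup.mk
      (cubeChain_of_eq L 0 hs (ContinuousMap.id _) (L.castFiber h0 l))).symm |>.trans ?_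
    · rfl
    · rw [L.castFiber_castFiber]; rfl
  rw [key leftHalf q hleft ((Path.refl 0).cast rfl (coordMap_leftHalf_zero 0))
      fun t => r.cube_zero] at hsplit
  obtain ⟨γ, hγ⟩ := exists_path_rightHalf n
  rw [key rightHalf p hright γ fun t => (hγ t).elim (r.tripleMap_cube.2 _) (hmid _)] at hsplit
  exact hsplit.trans (add_comm _ _)

/-- A free homotopy along `γ` is in particular a homotopy of pairs, and the vertex `0`, which lies
in `J`, traces out `γ`. -/
theorem hurewiczPi_balanced {γ : Path x x} {p q : RelLoop x n} (h : FreelyHomotopicAlong γ p q)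
    (l : L.Fiber (x : X)) :
    hurewiczPi L q.toPi (loopTransport L x γ l) = hurewiczPi L p.toPi l := by
  obtain ⟨H, h0, h1, hb, hJ⟩ := h
  let K : p.cube.HomotopyWith q.cube (PairMap A) :=
    { toContinuousMap := H
      map_zero_left := h0
      map_one_left := h1
      prop' := fun t y hy => by
        rcases mem_boundary_iff.1 hy with hy | hy
        · exact hb t y hy
        · have := hJ t y hy
          change H (t, y) ∈ A
          rw [this]; exact (γ t).2 }
  rw [hurewiczPi_toPi, hurewiczPi_toPi, hurewiczClass_eq, hurewiczClass_eq,
    ← cubeChainClass_of_homotopy L K]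
  congr 1
  have hγ : γ.map continuous_subtype_val =
      (K.toHomotopy.evalAt 0).cast p.cube_zero.symm q.cube_zero.symm := by
    ext t
    exact (hJ t 0 (Or.inr ⟨0, Or.inl rfl⟩)).symm
  rw [loopTransport, hγ, L.transport_cast, L.castFiber_castFiber]
  exact L.castFiber_rfl _ _

/-- The Hurewicz homomorphism, with values in chains modulo relative boundaries. -/
def hurewiczHom (x : A) (n : ℕ) : RelTensor L x n →+ Chains L (n + 2) ⧸ relBoundaries L A (n + 2) :=
  QuotientAddGroup.lift _
    (FreeAbelianGroup.lift fun al : RelPi x (n + 2) × L.Fiber (x : X) => hurewiczPi L al.1 al.2) (by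
      rw [AddSubgroup.closure_le]
      rintro r (⟨a, b, l⟩ | ⟨a, l, m⟩ | ⟨γ, p, q, h, l⟩)
      · change FreeAbelianGroup.lift _ _ = 0
        simp [hurewiczPi_mul]
      · change FreeAbelianGroup.lift _ _ = 0
        simp
      · change FreeAbelianGroup.lift _ _ = 0
        simp [hurewiczPi_balanced L h])

theorem hurewiczHom_tmul (a : RelPi x (n + 2)) (l : L.Fiber (x : X)) :
    hurewiczHom L x n (tmul L x a l) = hurewiczPi L a l := by
  simp [hurewiczHom, tmul]

theorem hurewiczHom_cubeClass (hA : ∀ a : A, Joined a x) {f : C(Cube (n + 2), X)}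
    (hf : PairMap A f) (l : L.Fiber (f 0)) : hurewiczHom L x n (cubeClass L x f l) =
      cubeChainClass L A f 0 (ContinuousMap.id _) l := by
  obtain ⟨p, ⟨H⟩⟩ := hf.exists_relLoop hA
  rw [cubeClass_eq L p H, hurewiczHom_tmul, hurewiczPi_toPi, hurewiczClass_eq,
    L.castFiber_castFiber, L.castFiber_rfl, cubeChainClass_of_homotopy]

namespace Deformation

/-- A deformed simplex has its boundary in `A`; by `cubeChainClass_comp_cubeToSimplex` it is then,
modulo relative boundaries, the fundamental chain of the cube whose class was taken. -/
theorem Compatible.hurewiczHom_chainClass (hA : ∀ a : A, Joined a x)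
    {D' : Deformation A (n + 2) (n + 2)} {D : Deformation A (n + 2) (n + 1)}
    (h : D'.Compatible D) (c : Chains L (n + 2)) :
    hurewiczHom L x n (chainClass L x D' c) = QuotientAddGroup.mk (D'.endChain L c) := by
  induction c using chains_induction with
  | zero => simp
  | add c d hc hd => rw [map_add, map_add, hc, hd, map_add]; rfl
  | gen σ l =>
    have hσ (y : Simplex (n + 2)) (hy : ∃ j, y j = 0) : D'.endMap σ y ∈ A := by
      obtain ⟨j, hj⟩ := hy
      obtain ⟨z, rfl⟩ := exists_faceMap_eq hj
      change D'.map σ (1, faceMap (n + 1) j z) ∈ A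
      rw [h]
      exact D.map_one (by omega) _ _
    rw [chainClass_gen, hurewiczHom_cubeClass L hA fun y hy => hσ _ (cubeToSimplex_boundary hy),
      endChain_gen]
    have h0 := cubeChainClass_comp_id (A := A) L (D'.endMap σ) (e0 (n + 2))
      (cubeToSimplex (n + 2)) (L.trace (D'.homotopy σ) (e0 (n + 2)) l)
    have h1 := cubeChainClass_comp_cubeToSimplex L (D'.endMap σ) (e0 (n + 2))
      (ContinuousMap.id _) hσ (L.trace (D'.homotopy σ) (e0 (n + 2)) l)
    rw [push_apply] at h1
    refine Eq.trans ?_ (h0.trans (h1.trans ?_))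
    · exact congrArg _ (L.along_cast_right (D'.endMap σ) (e0 (n + 2))
        (cubeToSimplex_zero (n + 2)).symm _ |>.trans (by rw [L.along_self])).symm
    · exact congrArg (fun l => QuotientAddGroup.mk (gen L (D'.endMap σ) l)) (L.along_self _ _ _)

theorem Compatible.hurewiczHom_chainClass_of_mem (hA : ∀ a : A, Joined a x)
    {D' : Deformation A (n + 2) (n + 2)} {D : Deformation A (n + 2) (n + 1)}
    (h : D'.Compatible D) {c : Chains L (n + 2)} (hc : c ∈ relCycles L A (n + 2)) :
    hurewiczHom L x n (chainClass L x D' c) = QuotientAddGroup.mk c := by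
  rw [h.hurewiczHom_chainClass L hA, QuotientAddGroup.eq_iff_sub_mem]
  exact h.endChain_sub_mem L hc

end Deformation

/-- A functional on the maps of cubes does not change under the self map of the cube that factors
through the simplex. -/
theorem CubeFunctional.simplexToCube_comp {k : ℕ} {i₀ : Fin (k + 1)} {B : Set (Cube (k + 1))}
    {G : Type*} [AddCommGroup G] {F : C(Cube (k + 1), Cube (k + 1)) → G}
    (hF : CubeFunctional i₀ B F) (hB : Cube.boundary (Fin (k + 1)) ⊆ B) :
    F ((simplexToCube (k + 1)).comp (cubeToSimplex (k + 1))) = F (ContinuousMap.id _) := by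
  let c : C(Cube (k + 1), Cube (k + 1)) := (simplexToCube (k + 1)).comp (cubeToSimplex (k + 1))
  -- If `y i = 0`, then `c y` has a zero coordinate, but perhaps in another place, so `c` and the
  -- identity need not share a wall. The minimum shares a wall with each of them.
  let m : C(Cube (k + 1), Cube (k + 1)) := ⟨fun y i => min (y i) (c y i), by fun_prop⟩
  have hone {y : Cube (k + 1)} {i : Fin (k + 1)} (h : y i = 1) : c y i = 1 :=
    simplexToCube_of_eq_zero (cubeToSimplex_of_eq_one h)
  have hzero {y : Cube (k + 1)} {i : Fin (k + 1)} (h : y i = 0) : ∃ j, c y j = 0 :=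
    exists_simplexToCube_eq_zero (Nat.succ_ne_zero k)
      (cubeToSimplex_of_eq_zero h (Fin.castSucc_lt_last i))
  have h1 : F ((ContinuousMap.id _).comp c) = F ((ContinuousMap.id _).comp m) := by
    refine hF.eq_of_lerp_walls _ (fun y hy => hB hy) fun y hy => ?_
    obtain ⟨i, hi | hi⟩ := hy
    · obtain ⟨j, hj⟩ := hzero hi
      have hm : m y j = 0 := by
        change min (y j) (c y j) = 0
        rw [hj]; exact min_eq_right unitInterval.nonneg'
      exact ⟨j, by rw [hj, hm], Or.inl hm⟩
    · have hm : m y i = 1 := by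
        change min (y i) (c y i) = 1
        rw [hi, hone hi, min_self]
      exact ⟨i, by rw [hone hi, hm], Or.inr hm⟩
  have h2 : F ((ContinuousMap.id _).comp m) =
      F ((ContinuousMap.id _).comp (ContinuousMap.id _)) := by
    refine hF.eq_of_lerp_walls _ (fun y hy => hB hy) fun y hy => ?_
    obtain ⟨i, hi | hi⟩ := hy
    · refine ⟨i, ?_, Or.inl hi⟩
      change min (y i) (c y i) = y i
      rw [hi]; exact min_eq_left unitInterval.nonneg'
    · refine ⟨i, ?_, Or.inr hi⟩
      change min (y i) (c y i) = y i
      rw [hi, hone hi, min_self]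
  exact h1.trans h2

/-- `simplexToCube_comp` is used twice. For fundamental chains it replaces the chain of `p`, modulo
relative boundaries, by the single simplex `p ∘ simplexToCube`. For `cubeClass` it identifies the
class of that simplex, read on the cube again, with the class of `p`. -/
theorem Deformation.chainClass_hurewiczChain (hA : ∀ a : A, Joined a x)
    {D'' : Deformation A (n + 2) (n + 3)} {D' : Deformation A (n + 2) (n + 2)}
    {D : Deformation A (n + 2) (n + 1)} (h' : D''.Compatible D') (h : D'.Compatible D)
    (p : RelLoop x n) (l : L.Fiber (x : X)) :
    chainClass L x D' (hurewiczChain L p l) = tmul L x p.toPi l := by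
  set l₀ := L.castFiber p.cube_zero.symm l with hl₀
  let s := simplexToCube (n + 2)
  have hs (y : Simplex (n + 2)) (hy : ∃ j, y j = 0) : p.cube (s y) ∈ A :=
    let ⟨_, hj⟩ := hy
    p.tripleMap_cube.pairMap _ (simplexToCube_boundary (Nat.succ_ne_zero _) hj)
  have h1 : hurewiczChain L p l - push L p.cube 0 s l₀ ∈ relBoundaries L A (n + 2) := by
    rw [← QuotientAddGroup.eq_iff_sub_mem, ← cubeChainClass_comp_cubeToSimplex L p.cube 0 s hs,
      ← hurewiczClass_apply, hurewiczClass_eq]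
    exact ((cubeFunctional_cubeChainClass (A := A) L p.cube 0 l₀).simplexToCube_comp
      fun y hy => p.tripleMap_cube.pairMap y hy).symm
  have h2 := chainClass_eq_zero L hA h' h h1
  rw [map_sub, sub_eq_zero] at h2
  rw [h2, push_apply, h.chainClass_gen_eq L hA (σ := p.cube.comp s) hs]
  have h3 := (cubeFunctional_cubeClass (n := n) L hA p.cube 0 l₀ (B := p.cube ⁻¹' A)
    fun _ h => h).simplexToCube_comp fun y hy => p.tripleMap_cube.pairMap y hy
  refine Eq.trans (congrArg _ ?_) (h3.trans ?_)
  · exact (L.along_cast_right p.cube 0 (congrArg s (cubeToSimplex_zero (n + 2)).symm) l₀ |>.trans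
      rfl).symm
  · refine (congrArg (cubeClass L x p.cube) (L.along_self p.cube 0 l₀)).trans ?_
    rw [cubeClass_cube, hl₀, L.castFiber_castFiber, L.castFiber_rfl]

end Hurewicz

end TwistedHurewicz

end
-- The Hurewicz isomorphism
open TwistedHurewicz in
theorem proposition2p1 {X : Type u} [TopologicalSpace X] [PathConnectedSpace X] (A : Set X)
    (x : A) (L : LocalSystem.{u, w} X) (hL : L.IsFree (x : X)) (n : ℕ)
    (hlow : ∀ j, 1 ≤ j → j < n + 2 → Subsingleton (RelPi x j))
    (hne : Nontrivial (RelPi x (n + 2))) :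
    ∃ e : RelTensor L x n ≃+ RelHomology L A (n + 2),
      ∀ (p : RelLoop x n) (l : L.Fiber (x : X)),
        ∃ hz : hurewiczChain L p l ∈ relCycles L A (n + 2),
          e (tmul L x p.toPi l) = QuotientAddGroup.mk ⟨hurewiczChain L p l, hz⟩ := by
  have hA := joined_of_subsingleton x (hlow 1 le_rfl (by omega))
  obtain ⟨D, hD⟩ := exists_deformation (by omega) hlow
  have h' : (D (n + 3)).Compatible (D (n + 2)) := hD (n + 2)
  have h : (D (n + 2)).Compatible (D (n + 1)) := hD (n + 1)
  let φ := Deformation.chainClass L x (D (n + 2))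
  -- The inverse of the Hurewicz map, induced by `chainClass` on relative cycles.
  let ψ : RelHomology L A (n + 2) →+ RelTensor L x n :=
    QuotientAddGroup.lift _ (φ.comp (relCycles L A (n + 2)).subtype) fun c hc =>
      Deformation.chainClass_eq_zero L hA h' h hc
  have hψ (p : RelLoop x n) (l : L.Fiber (x : X)) :
      ψ (QuotientAddGroup.mk ⟨hurewiczChain L p l, hurewiczChain_mem_relCycles L p l⟩) =
        tmul L x p.toPi l :=
    Deformation.chainClass_hurewiczChain L hA h' h p l
  -- `hurewiczHom` recovers a cycle from its image modulo relative boundaries, so a cycle in the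
  -- kernel is a relative boundary.
  have hinj : Function.Injective ψ := by
    rw [injective_iff_map_eq_zero]
    intro c
    induction c using QuotientAddGroup.induction_on with
    | H c =>
      intro hc
      have h1 := h.hurewiczHom_chainClass_of_mem L hA c.2
      have hc' : φ c = 0 := hc
      rw [hc', map_zero] at h1
      exact (QuotientAddGroup.eq_zero_iff _).2 
        ((QuotientAddGroup.eq_zero_iff (N := relBoundaries L A (n + 2)) c.1).1 h1.symm)
  -- The pure tensors generate, and each is the image of its own Hurewicz chain.
  have hsurj : Function.Surjective ψ := by
    intro t
    induction t using QuotientAddGroup.induction_on with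
    | H t =>
      change _ ∈ ψ.range
      induction t using FreeAbelianGroup.induction_on with
      | zero => exact zero_mem _
      | of al =>
        obtain ⟨a, l⟩ := al
        obtain ⟨p, rfl⟩ : ∃ p : RelLoop x n, p.toPi = a := Quotient.exists_rep a
        exact ⟨_, hψ p l⟩
      | neg al hal => exact neg_mem hal
      | add a b ha hb => exact add_mem ha hb
  let e := AddEquiv.ofBijective ψ ⟨hinj, hsurj⟩
  refine ⟨e.symm, fun p l => ⟨hurewiczChain_mem_relCycles L p l, ?_⟩⟩
  rw [AddEquiv.symm_apply_eq]
  exact (hψ p l).symm
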